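/- For $\alpha\in[0,1)$ let $T_\alpha$ be the self-adjoint operator in $L^2((0,\infty),dr)$ associated with the closure of the quadratic form $$ \int_0^\infty |\eta'(r)|^2\,dr-\alpha|\eta(1)|^2-\frac14\int_0^1\frac{|\eta(r)|^2}{r^2}\,dr+\Big(\alpha^2-\frac14\Big)\int_1^\infty\frac{|\eta(r)|^2}{r^2}\,dr,\qquad \eta\in C^1_c((0,\infty)). $$ For every $\kappa>0$ the operator $T_\alpha+\kappa^2$ has a bounded inverse on $L^2((0,\infty))$, and this inverse is an integral operator with a (unique) continuous kernel $(T_\alpha+\kappa^2)^{-1}(r,r')$ on $(0,\infty)\times(0,\infty)$. Moreover, for every $\alpha\in(0,1)$ there is a constant $C_\alpha$ such that for all $\kappa>0$ and all $r,r'\in(0,\infty)$ $$ \left|(T_\alpha+\kappa^2)^{-1}(r,r')-(T_0+\kappa^2)^{-1}(r,r')\right|\le C_\alpha\,\kappa^{-2\alpha}\,\sqrt{rr'}\,(1+r)^{-\alpha}(1+r')^{-\alpha}. $$ -/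

import Mathlib

open Set Filter Topology MeasureTheory

noncomputable section

namespace PointInteraction

/-- The open half-line `(0, ∞)` as an open subset of `ℝ`. -/
def halfLine : TopologicalSpace.Opens ℝ := ⟨Ioi 0, isOpen_Ioi⟩

/-- The complex Hilbert space `L²((0, ∞), dr)`. -/
abbrev HalfLineL2 : Type := Lp ℂ 2 (volume.restrict (Ioi (0 : ℝ)))

/-- `C¹_c((0, ∞))`: complex-valued `C¹` functions on `ℝ` whose support is a compact subset of the
open half-line. -/
abbrev Core : Type := TestFunction halfLine ℂ 1

theorem Core.memLp (η : Core) : MemLp (η : ℝ → ℂ) 2 (volume.restrict (Ioi (0 : ℝ))) :=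
  (η.continuous.memLp_of_hasCompactSupport η.hasCompactSupport).restrict _

/-- The class in `L²((0, ∞))` of a function in `C¹_c((0, ∞))`. -/
def Core.toL2 (η : Core) : HalfLineL2 := (Core.memLp η).toLp η

/-- The sesquilinear form (conjugate-linear in the first variable) on `C¹_c((0, ∞))` whose
quadratic form is
`∫₀^∞ |η'|² - α |η(1)|² - (1/4) ∫₀¹ |η|² / r² + (α² - 1/4) ∫₁^∞ |η|² / r²`. -/
def form (α : ℝ) (η ξ : Core) : ℂ :=
  (∫ r in Ioi (0 : ℝ), (starRingEnd ℂ) (deriv η r) * deriv ξ r)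
    - (α : ℂ) * ((starRingEnd ℂ) (η 1) * ξ 1)
    - (1 / 4 : ℂ) * (∫ r in Ioo (0 : ℝ) 1, (starRingEnd ℂ) (η r) * ξ r / (r : ℂ) ^ 2)
    + ((α : ℂ) ^ 2 - 1 / 4) * (∫ r in Ioi (1 : ℝ), (starRingEnd ℂ) (η r) * ξ r / (r : ℂ) ^ 2)

/-- The sequence `η` in `C¹_c((0, ∞))` converges to `u` in `L²` and is Cauchy with respect to the
quadratic form. -/
def FormTendsto (α : ℝ) (η : ℕ → Core) (u : HalfLineL2) : Prop :=
  Tendsto (fun n => (η n).toL2) atTop (𝓝 u) ∧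
    Tendsto (fun p : ℕ × ℕ => form α (η p.1 - η p.2) (η p.1 - η p.2)) atTop (𝓝 0)

/-- The domain of the closure of the form. -/
def formDomain (α : ℝ) : Set HalfLineL2 := {u | ∃ η : ℕ → Core, FormTendsto α η u}

/-- `IsClosedFormValue α u v z`: the closure of the form takes the value `z` at `(u, v)`, that is,
`z` is the limit of the form along form-Cauchy approximations of `u` and `v` in `C¹_c((0, ∞))`. -/
def IsClosedFormValue (α : ℝ) (u v : HalfLineL2) (z : ℂ) : Prop :=
  ∃ η ξ : ℕ → Core, FormTendsto α η u ∧ FormTendsto α ξ v ∧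
    Tendsto (fun n => form α (η n) (ξ n)) atTop (𝓝 z)

/-- The graph of the operator `T_α` in `L²((0, ∞))` associated with the closed form:
`u ∈ dom T_α` and `T_α u = f` if and only if `u` lies in the form domain and the closed form at
`(v, u)` equals `⟨v, f⟩` for every `v` in the form domain. -/
def operatorGraph (α : ℝ) : Set (HalfLineL2 × HalfLineL2) :=
  {p | p.1 ∈ formDomain α ∧
    ∀ v ∈ formDomain α, IsClosedFormValue α v p.1 (inner ℂ v p.2)}

/-- The bounded operator `R` on `L²((0, ∞))` is the inverse `(T_α + κ²)⁻¹`: one has `R g = u` if and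
only if `u ∈ dom T_α` and `T_α u + κ² u = g`. -/
def IsResolvent (α κ : ℝ) (R : HalfLineL2 →L[ℂ] HalfLineL2) : Prop :=
  ∀ g u : HalfLineL2, R g = u ↔ (u, g - ((κ : ℂ) ^ 2) • u) ∈ operatorGraph α

/-- `G` is an integral kernel of the operator `R` on `L²((0, ∞))`. -/
def IsIntegralKernel (R : HalfLineL2 →L[ℂ] HalfLineL2) (G : ℝ → ℝ → ℂ) : Prop :=
  ∀ g : HalfLineL2, ∀ᵐ r ∂(volume.restrict (Ioi (0 : ℝ))),
    IntegrableOn (fun s => G r s * g s) (Ioi 0) ∧ R g r = ∫ s in Ioi (0 : ℝ), G r s * g s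

/-- `G`, restricted to `(0, ∞) × (0, ∞)`, is the integral kernel of `(T_α + κ²)⁻¹`. An integral
kernel is determined only almost everywhere; its pointwise values are those of the continuous
representative. -/
def IsResolventKernel (α κ : ℝ) (G : ℝ → ℝ → ℂ) : Prop :=
  ContinuousOn (Function.uncurry G) (Ioi 0 ×ˢ Ioi 0) ∧
    ∃ R : HalfLineL2 →L[ℂ] HalfLineL2, IsResolvent α κ R ∧ IsIntegralKernel R G

end PointInteraction

end

/-!
Write `φ(r) = √r · max(1, r)^(-α)`. This positive function solves `T_α φ = 0`, with the jump
condition at `r = 1` that the point interaction prescribes. Hence the form is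
`∫ |η' - (φ'/φ) η|²` on test functions (`form_eq_inner`), and it is nonnegative and closable. Its
closure with the inner product of `T_α + κ²` is a closed subspace of `L² × L²`, so that the resolvent
is read off from an orthogonal projection (`isResolvent_resolventOp`).

The substitution `η = φ f` turns `T_α η = -κ² η` into `(w f')' = κ² w f` with `w = φ²`, that is
`w(r) = r` on `(0, 1]` and `w(r) = r^(1-2α)` on `[1, ∞)`. On the two pieces the solutions are modified
Bessel functions, of order `0` and `α`; gluing them at `1`, with reduction of order for the second
solution on each side, gives a solution `u` regular at `0` and a solution `v` decaying at infinity,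
of weighted Wronskian `1`. The function `G(r, s) = φ(r) φ(s) u(min r s) v(max r s)` is the kernel of
the resolvent (`isResolventKernel_greenFun`): its slices lie in the form domain
(`isClosedGrad_groundState_mul`, by truncation and mollification), and by Green's identity they
represent the point evaluations (`isIntegralKernel_of_reproducing`). Two continuous kernels of the
same operator agree, and the resolvent is unique, so it is enough to compare these explicit kernels
(`IsResolventKernel.eq`).

Let `r ≤ s`, `x = κ r`, `y = κ s`, and let `D` be the difference of the kernels for `α` and for `0`.
The claim amounts to `|D(r, s)| ≤ C κ^(-2α) φ(r) φ(s)`, because `φ(r)` is at most a multiple of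
`√r (1 + r)^(-α)`.

* For `1 ≤ r` and `x ≤ 1` no cancellation is needed. The Wronskian identity bounds `G(r, s)` by
  `φ(r) φ(s) K(y) / (-w(r) κ K'(x))`, with `K` a multiple of `x^ν K_ν(x)`; the flux in the
  denominator is at least `κ^(2ν)` times a constant, and `K(y)` is bounded for `ν = α` and
  `O(y^(-α))` for `ν = 0`.
* For `1 ≤ r` and `1 ≤ x` the two kernels are close. The diagonal `E(r) = G(r, r)` solves
  `E' = 1 - 2 ρ E`, where `ρ` is the decay rate of `φ v`; the rates for `α` and `0` differ by
  `O(κ / x²)`, and a barrier gives `|E_α - E_0| ≤ 32 / (κ x)`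
  (`abs_resolventKernel_diag_sub_le`). Off the diagonal `G(r, s) / G(r, r)` is the ratio of two values
  of `√x K_ν(x)`, which decays exponentially and depends on `ν` only to relative order `1 / x`
  (`decayFun_ratio_bounds`). The bounds on the decay rates come from comparing the equation
  `V'' = (1 + (ν² - 1/4) / x²) V` with equations of constant coefficients (`decayRate_bounds`).
* For `r ≤ 1` the solution `u` on `(0, 1]` and the weight do not depend on `α`, so that `D(r, s)` is
  `√r` times a factor in `[0, 1]` times `D(1, s)`, and likewise in `s`.
-/

noncomputable section

namespace PointInteraction

/-! ### Functions in `C¹_c((0, ∞))` -/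

theorem Core.exists_support_Icc (η : Core) :
    ∃ a b : ℝ, 0 < a ∧ a < 1 ∧ 1 < b ∧ tsupport η ⊆ Icc a b := by
  have hK : IsCompact (tsupport η) := η.hasCompactSupport
  have hsub : tsupport η ⊆ Ioi (0 : ℝ) := η.tsupport_subset
  obtain ⟨B, hB⟩ := hK.bddAbove
  have hlow : ∃ a : ℝ, 0 < a ∧ ∀ x ∈ tsupport η, a ≤ x := by
    rcases (tsupport η).eq_empty_or_nonempty with h | h
    · exact ⟨1, one_pos, by simp [h]⟩
    · obtain ⟨x, hx, hmin⟩ := hK.exists_isMinOn h continuousOn_id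
      exact ⟨x, hsub hx, fun y hy => hmin hy⟩
  obtain ⟨a, ha, hA⟩ := hlow
  refine ⟨min a (1 / 2), max B 2, by positivity, ?_, ?_, fun x hx => ⟨?_, ?_⟩⟩
  · exact (min_le_right _ _).trans_lt (by norm_num)
  · exact lt_of_lt_of_le (by norm_num) (le_max_right _ _)
  · exact (min_le_left _ _).trans (hA x hx)
  · exact (hB hx).trans (le_max_left _ _)

theorem Core.eq_zero_of_nonpos (η : Core) {r : ℝ} (hr : r ≤ 0) : η r = 0 := by
  apply image_eq_zero_of_notMem_tsupport
  exact fun h => absurd (η.tsupport_subset h : (0 : ℝ) < r) (not_lt.2 hr)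

theorem Core.contDiff_one (η : Core) : ContDiff ℝ 1 η := η.contDiff

theorem Core.hasDerivAt (η : Core) (r : ℝ) : HasDerivAt η (deriv η r) r :=
  (η.contDiff_one.differentiable one_ne_zero r).hasDerivAt

theorem Core.continuous_deriv (η : Core) : Continuous (deriv η) :=
  η.contDiff_one.continuous_deriv le_rfl

theorem Core.deriv_add (η ξ : Core) (r : ℝ) : deriv (η + ξ : Core) r = deriv η r + deriv ξ r := by
  have h := (η.hasDerivAt r).add (ξ.hasDerivAt r)
  exact h.deriv

theorem Core.deriv_sub (η ξ : Core) (r : ℝ) : deriv (η - ξ : Core) r = deriv η r - deriv ξ r := by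
  have h := (η.hasDerivAt r).sub (ξ.hasDerivAt r)
  exact h.deriv

theorem Core.deriv_smul (c : ℂ) (η : Core) (r : ℝ) : deriv (c • η : Core) r = c * deriv η r := by
  have h := (η.hasDerivAt r).const_mul c
  exact h.deriv

/-- A product `g · η` with `η ∈ C¹_c((0, ∞))` is `C¹` on `ℝ` if `g` is `C¹` on `(0, ∞)`, whatever
the values of `g` on `(-∞, 0]`. -/
theorem Core.contDiff_mul (η : Core) {g : ℝ → ℂ} (hg : ContDiffOn ℝ 1 g (Ioi 0)) :
    ContDiff ℝ 1 fun r => g r * η r := by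
  rw [contDiff_iff_contDiffAt]
  intro r
  by_cases hr : r ∈ tsupport η
  · have h0 : (0 : ℝ) < r := η.tsupport_subset hr
    exact (hg.contDiffAt (Ioi_mem_nhds h0)).mul η.contDiff_one.contDiffAt
  · have : (fun r => g r * η r) =ᶠ[𝓝 r] fun _ => 0 := by
      have hopen : (tsupport η)ᶜ ∈ 𝓝 r := (isClosed_tsupport η).isOpen_compl.mem_nhds hr
      filter_upwards [hopen] with s hs
      rw [image_eq_zero_of_notMem_tsupport hs, mul_zero]
    exact contDiffAt_const.congr_of_eventuallyEq this

theorem Core.hasCompactSupport_mul (η : Core) (g : ℝ → ℂ) :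
    HasCompactSupport fun r => g r * η r :=
  η.hasCompactSupport.mul_left

/-! ### The first-order factorisation of the form -/

/-- The zero-energy solution `√r · max(1, r)^(-α)` of `T_α`; it is positive, and it carries the jump
condition at `r = 1`. -/
def groundState (α r : ℝ) : ℝ := √r * max 1 r ^ (-α)

/-- The numerator `r · φ'(r) / φ(r)` of the logarithmic derivative of the ground state. -/
def logSlope (α r : ℝ) : ℝ := if r < 1 then 1 / 2 else 1 / 2 - α

/-- The first-order operator `η ↦ η' - (φ'/φ) η`, where `φ` is the ground state. -/
def gradOp (α : ℝ) (η : ℝ → ℂ) (r : ℝ) : ℂ := deriv η r - (logSlope α r / r : ℝ) * η r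

theorem measurable_logSlope (α : ℝ) : Measurable (logSlope α) :=
  Measurable.ite measurableSet_Iio measurable_const measurable_const

theorem abs_logSlope_le (α r : ℝ) : |logSlope α r| ≤ 1 / 2 + |α| := by
  unfold logSlope
  have := abs_nonneg α
  split_ifs
  · rw [abs_of_pos (by norm_num)]; linarith
  · have := abs_sub (1 / 2) α
    rw [abs_of_pos (by norm_num : (0 : ℝ) < 1 / 2)] at this; exact this

theorem groundState_pos (α : ℝ) {r : ℝ} (hr : 0 < r) : 0 < groundState α r :=
  mul_pos (Real.sqrt_pos.2 hr) (Real.rpow_pos_of_pos (lt_max_of_lt_left one_pos) _)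

theorem continuous_groundState (α : ℝ) : Continuous (groundState α) := by
  unfold groundState
  refine Real.continuous_sqrt.mul ?_
  exact (continuous_const.max continuous_id).rpow_const
    fun r => Or.inl (lt_max_of_lt_left one_pos).ne'

theorem groundState_of_le_one (α : ℝ) {r : ℝ} (hr : r ≤ 1) : groundState α r = √r := by
  simp [groundState, max_eq_left hr]

theorem groundState_of_one_le (α : ℝ) {r : ℝ} (hr : 1 ≤ r) :
    groundState α r = r ^ (1 / 2 - α) := by
  have h0 : 0 < r := one_pos.trans_le hr
  rw [groundState, max_eq_right hr, Real.sqrt_eq_rpow, ← Real.rpow_add h0]; rfl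

theorem hasDerivAt_groundState (α : ℝ) {r : ℝ} (hr : 0 < r) (h1 : r ≠ 1) :
    HasDerivAt (groundState α) (logSlope α r / r * groundState α r) r := by
  rcases lt_or_gt_of_ne h1 with h | h
  · have h2 : HasDerivAt (fun s => √s) (1 / (2 * √r)) r := Real.hasDerivAt_sqrt hr.ne'
    have h3 : groundState α =ᶠ[𝓝 r] fun s => √s := by
      filter_upwards [Iio_mem_nhds h] with s hs
      exact groundState_of_le_one α (le_of_lt hs)
    refine (h2.congr_of_eventuallyEq h3).congr_deriv ?_
    rw [groundState_of_le_one α h.le, logSlope, if_pos h]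
    have hs := Real.sqrt_pos.2 hr
    field_simp
    rw [Real.sq_sqrt hr.le]
  · have h2 := Real.hasDerivAt_rpow_const (p := 1 / 2 - α) (Or.inl hr.ne')
    have h3 : groundState α =ᶠ[𝓝 r] fun s => s ^ (1 / 2 - α) := by
      filter_upwards [Ioi_mem_nhds h] with s hs
      exact groundState_of_one_le α (le_of_lt hs)
    refine (h2.congr_of_eventuallyEq h3).congr_deriv ?_
    rw [groundState_of_one_le α h.le, logSlope, if_neg (not_lt.2 h.le),
      Real.rpow_sub_one hr.ne']
    ring

theorem contDiffOn_ofReal_inv : ContDiffOn ℝ 1 (fun r : ℝ => ((r⁻¹ : ℝ) : ℂ)) (Ioi 0) := by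
  refine Complex.ofRealCLM.contDiff.comp_contDiffOn (contDiffOn_inv ℝ |>.mono ?_)
  intro x hx
  exact ne_of_gt hx

theorem Core.memLp_gradOp (α : ℝ) (η : Core) :
    MemLp (gradOp α η) 2 (volume.restrict (Ioi (0 : ℝ))) := by
  have h1 : MemLp (deriv η) 2 (volume.restrict (Ioi (0 : ℝ))) :=
    (η.continuous_deriv.memLp_of_hasCompactSupport η.hasCompactSupport.deriv).restrict _
  have h2 : MemLp (fun r => ((r⁻¹ : ℝ) : ℂ) * η r) 2 (volume.restrict (Ioi (0 : ℝ))) :=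
    ((η.contDiff_mul contDiffOn_ofReal_inv).continuous.memLp_of_hasCompactSupport
      (η.hasCompactSupport_mul _)).restrict _
  have h3 : MemLp (fun r => (logSlope α r : ℂ) * (((r⁻¹ : ℝ) : ℂ) * η r)) 2
      (volume.restrict (Ioi (0 : ℝ))) := by
    refine h2.of_le_mul (c := 1 / 2 + |α|) ?_ (ae_of_all _ fun r => ?_)
    · exact (Complex.measurable_ofReal.comp
        (measurable_logSlope α)).aestronglyMeasurable.mul h2.1
    · rw [norm_mul, Complex.norm_real]
      exact mul_le_mul_of_nonneg_right (abs_logSlope_le α r) (norm_nonneg _)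
  refine (h1.sub h3).ae_eq (ae_of_all _ fun r => ?_)
  simp only [gradOp, Pi.sub_apply, div_eq_mul_inv, Complex.ofReal_mul]
  ring

/-- The class in `L²((0, ∞))` of `η' - (φ'/φ) η`. -/
def Core.gradL2 (α : ℝ) (η : Core) : HalfLineL2 := (η.memLp_gradOp α).toLp (gradOp α η)

theorem Core.toL2_ae (η : Core) : η.toL2 =ᵐ[volume.restrict (Ioi (0 : ℝ))] η :=
  (Core.memLp η).coeFn_toLp

theorem Core.toL2_sub (η ξ : Core) : (η - ξ).toL2 = η.toL2 - ξ.toL2 := rfl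

theorem gradOp_sub (α : ℝ) (η ξ : Core) :
    gradOp α (η - ξ : Core) = gradOp α η - gradOp α ξ := by
  ext r
  simp only [gradOp, Core.deriv_sub, Pi.sub_apply, sub_apply]
  ring

theorem Core.gradL2_sub (α : ℝ) (η ξ : Core) :
    (η - ξ).gradL2 α = η.gradL2 α - ξ.gradL2 α := by
  rw [Core.gradL2, Core.gradL2, Core.gradL2, ← MemLp.toLp_sub]
  exact MemLp.toLp_congr _ _ (by rw [gradOp_sub])

theorem gradOp_add (α : ℝ) (η ξ : Core) :
    gradOp α (η + ξ : Core) = gradOp α η + gradOp α ξ := by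
  ext r
  simp only [gradOp, Core.deriv_add, Pi.add_apply, add_apply]
  ring

theorem gradOp_smul (α : ℝ) (c : ℂ) (η : Core) :
    gradOp α (c • η : Core) = c • gradOp α η := by
  ext r
  simp only [gradOp, Core.deriv_smul, Pi.smul_apply, smul_apply, smul_eq_mul]
  ring

theorem Core.gradL2_add (α : ℝ) (η ξ : Core) :
    (η + ξ).gradL2 α = η.gradL2 α + ξ.gradL2 α := by
  rw [Core.gradL2, Core.gradL2, Core.gradL2, ← MemLp.toLp_add]
  exact MemLp.toLp_congr _ _ (by rw [gradOp_add])

theorem Core.gradL2_smul (α : ℝ) (c : ℂ) (η : Core) :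
    (c • η).gradL2 α = c • η.gradL2 α := by
  rw [Core.gradL2, Core.gradL2, ← MemLp.toLp_const_smul]
  exact MemLp.toLp_congr _ _ (by rw [gradOp_smul])

theorem inner_toLp {f g : ℝ → ℂ} (hf : MemLp f 2 (volume.restrict (Ioi (0 : ℝ))))
    (hg : MemLp g 2 (volume.restrict (Ioi (0 : ℝ)))) :
    inner ℂ (hf.toLp f) (hg.toLp g) = ∫ r in Ioi (0 : ℝ), (starRingEnd ℂ) (f r) * g r := by
  rw [L2.inner_def]
  refine integral_congr_ae ?_
  filter_upwards [hf.coeFn_toLp, hg.coeFn_toLp] with r h1 h2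
  rw [h1, h2, RCLike.inner_apply, mul_comm]

/-- Integration by parts: the form factorises through the first-order operator. The boundary terms
at `r = 1` from `(0, 1)` and `(1, ∞)` add up to the point interaction. -/
theorem form_eq_inner (α : ℝ) (η ξ : Core) :
    form α η ξ = inner ℂ (η.gradL2 α) (ξ.gradL2 α) := by
  rw [Core.gradL2, Core.gradL2, inner_toLp]
  have hconj : ContDiff ℝ 1 fun r => (starRingEnd ℂ) (η r) :=
    (Complex.conjCLE.contDiff (n := 1)).comp η.contDiff_one
  set q : ℝ → ℂ := fun r => (((r⁻¹ : ℝ) : ℂ) * ξ r) * (starRingEnd ℂ) (η r) with hq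
  have hqC : ContDiff ℝ 1 q := (ξ.contDiff_mul contDiffOn_ofReal_inv).mul hconj
  have hqs : HasCompactSupport q := (ξ.hasCompactSupport_mul _).mul_right
  have hq1 : q 1 = (starRingEnd ℂ) (η 1) * ξ 1 := by simp [hq, mul_comm]
  set t : ℝ → ℂ := fun r => (starRingEnd ℂ) (η r) * ξ r / (r : ℂ) ^ 2 with ht
  set d : ℝ → ℂ := fun r => (starRingEnd ℂ) (deriv η r) * deriv ξ r with hd
  have htc : Integrable t := by
    have h1 : Continuous fun r => (((r⁻¹ : ℝ) : ℂ) * ξ r) *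
        (starRingEnd ℂ) (((r⁻¹ : ℝ) : ℂ) * η r) :=
      (ξ.contDiff_mul contDiffOn_ofReal_inv).continuous.mul
        (Complex.continuous_conj.comp (η.contDiff_mul contDiffOn_ofReal_inv).continuous)
    refine (h1.integrable_of_hasCompactSupport
      (ξ.hasCompactSupport_mul _).mul_right).congr (ae_of_all _ fun r => ?_)
    simp only [ht, map_mul, Complex.conj_ofReal, Complex.ofReal_inv, map_inv₀]
    ring
  have hdc : Integrable d :=
    ((Complex.continuous_conj.comp η.continuous_deriv).mul
      ξ.continuous_deriv).integrable_of_hasCompactSupport ξ.hasCompactSupport.deriv.mul_left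
  have hq'c : Integrable (deriv q) :=
    (hqC.continuous_deriv le_rfl).integrable_of_hasCompactSupport hqs.deriv
  -- with `c = r φ'/φ`: the integrand is that of the form minus the derivative of `c η̄ ξ / r`
  have hpt : ∀ r : ℝ, 0 < r → ∀ c : ℝ,
      (starRingEnd ℂ) (deriv η r - (c / r : ℝ) * η r) * (deriv ξ r - (c / r : ℝ) * ξ r)
        = d r - c * deriv q r - (c - c ^ 2) * t r := by
    intro r hr c
    have hr' : (r : ℂ) ≠ 0 := by exact_mod_cast hr.ne'
    have hinv : HasDerivAt (fun s : ℝ => ((s⁻¹ : ℝ) : ℂ)) ((-(r ^ 2)⁻¹ : ℝ) : ℂ) r :=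
      (hasDerivAt_inv hr.ne').ofReal_comp
    have hcj : HasDerivAt (fun s => (starRingEnd ℂ) (η s)) ((starRingEnd ℂ) (deriv η r)) r :=
      (η.hasDerivAt r).star
    have hqd : deriv q r = _ := ((hinv.mul (ξ.hasDerivAt r)).mul hcj).deriv
    rw [hqd]
    simp only [hd, ht, map_sub, map_mul, map_div₀, Complex.conj_ofReal, Complex.ofReal_div, Complex.ofReal_inv,
      Complex.ofReal_neg, Complex.ofReal_pow, Pi.mul_apply]
    field_simp
    ring
  have hI : Ioi (0 : ℝ) = Ioo 0 1 ∪ Ici 1 := (Ioo_union_Ici_eq_Ioi one_pos).symm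
  have e1 : ∫ r in Ioo (0 : ℝ) 1, (starRingEnd ℂ) (gradOp α η r) * gradOp α ξ r
      = (∫ r in Ioo (0 : ℝ) 1, d r) - (1 / 2 : ℂ) * q 1
        - (1 / 4 : ℂ) * ∫ r in Ioo (0 : ℝ) 1, t r := by
    have hqI : ∫ r in Ioo (0 : ℝ) 1, deriv q r = q 1 := by
      rw [← integral_Ioc_eq_integral_Ioo, ← intervalIntegral.integral_of_le zero_le_one,
        intervalIntegral.integral_deriv_eq_sub' q rfl
          (fun x _ => hqC.differentiable one_ne_zero x)
          (hqC.continuous_deriv le_rfl).continuousOn]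
      simp [hq, η.eq_zero_of_nonpos le_rfl]
    rw [← hqI, ← integral_const_mul, ← integral_const_mul, ← integral_sub, ← integral_sub]
    · refine setIntegral_congr_fun measurableSet_Ioo fun r hr => ?_
      have := hpt r hr.1 (1 / 2)
      simp only [gradOp, logSlope, if_pos hr.2]
      rw [this]; push_cast; ring
    · exact (hdc.sub (hq'c.const_mul _)).integrableOn
    · exact (htc.const_mul _).integrableOn
    · exact hdc.integrableOn
    · exact (hq'c.const_mul _).integrableOn
  have e2 : ∫ r in Ioi (1 : ℝ), (starRingEnd ℂ) (gradOp α η r) * gradOp α ξ r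
      = (∫ r in Ioi (1 : ℝ), d r) + (1 / 2 - α : ℂ) * q 1
        + ((α : ℂ) ^ 2 - 1 / 4) * ∫ r in Ioi (1 : ℝ), t r := by
    have hqI : q 1 = - ∫ r in Ioi (1 : ℝ), deriv q r := by
      rw [hqs.integral_Ioi_deriv_eq hqC, neg_neg]
    rw [hqI, mul_neg, ← sub_eq_add_neg, ← integral_const_mul, ← integral_const_mul, ← integral_sub,
      ← integral_add]
    · refine setIntegral_congr_fun measurableSet_Ioi fun r hr => ?_
      have := hpt r (one_pos.trans hr) (1 / 2 - α)
      simp only [gradOp, logSlope, if_neg (not_lt.2 (le_of_lt (mem_Ioi.1 hr)))]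
      rw [this]; push_cast; ring
    · exact (hdc.sub (hq'c.const_mul _)).integrableOn
    · exact (htc.const_mul _).integrableOn
    · exact hdc.integrableOn
    · exact (hq'c.const_mul _).integrableOn
  have hgi : IntegrableOn (fun r => (starRingEnd ℂ) (gradOp α η r) * gradOp α ξ r) (Ioi 0) := by
    have h1 : MemLp (fun r => (starRingEnd ℂ) (gradOp α η r)) 2
      (volume.restrict (Ioi (0 : ℝ))) := (η.memLp_gradOp α).star
    exact h1.integrable_mul (ξ.memLp_gradOp α)
  have hsplit : ∀ f : ℝ → ℂ, IntegrableOn f (Ioi 0) →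
      ∫ r in Ioi (0 : ℝ), f r = (∫ r in Ioo (0 : ℝ) 1, f r) + ∫ r in Ioi (1 : ℝ), f r := by
    intro f hf
    rw [hI, setIntegral_union, integral_Ici_eq_integral_Ioi]
    · rw [Set.disjoint_left]; intro x hx hx'; exact absurd hx.2 (not_lt.2 hx')
    · exact measurableSet_Ici
    · exact hf.mono_set Ioo_subset_Ioi_self
    · exact hf.mono_set (Ici_subset_Ioi.2 one_pos)
  rw [hsplit _ hgi, e1, e2, form, hsplit _ hdc.integrableOn, hq1]
  simp only [hd, ht]
  ring

/-! ### The closed form and the resolvent -/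

/-- `h` is the value at `u` of the closure of the operator `gradOp α` on `C¹_c((0, ∞))`. -/
def IsClosedGrad (α : ℝ) (u h : HalfLineL2) : Prop :=
  ∃ η : ℕ → Core, Tendsto (fun n => (η n).toL2) atTop (𝓝 u) ∧
    Tendsto (fun n => (η n).gradL2 α) atTop (𝓝 h)

theorem memLp_deriv (ψ : Core) : MemLp (deriv ψ) 2 (volume.restrict (Ioi (0 : ℝ))) :=
  (ψ.continuous_deriv.memLp_of_hasCompactSupport ψ.hasCompactSupport.deriv).restrict _

theorem inner_toL2_gradL2 (α : ℝ) (ψ η : Core) :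
    inner ℂ ψ.toL2 (η.gradL2 α)
      = inner ℂ (ψ.gradL2 α - (2 : ℂ) • (memLp_deriv ψ).toLp (deriv ψ)) η.toL2 := by
  rw [inner_sub_left, inner_smul_left, ← sub_eq_zero, Core.toL2, Core.toL2,
    Core.gradL2, Core.gradL2, inner_toLp, inner_toLp, inner_toLp, ← integral_const_mul]
  have hint : ∀ {f g : ℝ → ℂ}, MemLp f 2 (volume.restrict (Ioi (0 : ℝ))) →
      MemLp g 2 (volume.restrict (Ioi (0 : ℝ))) →
      IntegrableOn (fun r => (starRingEnd ℂ) (f r) * g r) (Ioi 0) := by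
    intro f g hf hg
    have h1 : MemLp (fun r => (starRingEnd ℂ) (f r)) 2 (volume.restrict (Ioi (0 : ℝ))) := hf.star
    exact h1.integrable_mul hg
  have i1 := hint (Core.memLp ψ) (η.memLp_gradOp α)
  have i2 := hint (ψ.memLp_gradOp α) (Core.memLp η)
  have i3 := (hint (memLp_deriv ψ) (Core.memLp η)).const_mul ((starRingEnd ℂ) 2)
  rw [← integral_sub i2 i3, ← integral_sub i1 (by exact i2.sub i3)]
  set q : ℝ → ℂ := fun r => (starRingEnd ℂ) (ψ r) * η r with hq
  have hconj : ContDiff ℝ 1 fun r => (starRingEnd ℂ) (ψ r) :=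
    (Complex.conjCLE.contDiff (n := 1)).comp ψ.contDiff_one
  have hqC : ContDiff ℝ 1 q := hconj.mul η.contDiff_one
  have hqs : HasCompactSupport q := η.hasCompactSupport.mul_left
  have h0 : ∫ r in Ioi (0 : ℝ), deriv q r = 0 := by
    rw [hqs.integral_Ioi_deriv_eq hqC]
    simp [hq, η.eq_zero_of_nonpos le_rfl]
  rw [← h0]
  refine setIntegral_congr_fun measurableSet_Ioi fun r _ => ?_
  have hcj : HasDerivAt (fun s => (starRingEnd ℂ) (ψ s)) ((starRingEnd ℂ) (deriv ψ r)) r :=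
    (ψ.hasDerivAt r).star
  have hqd : deriv q r = _ := (hcj.mul (η.hasDerivAt r)).deriv
  simp only [hqd, gradOp, map_sub, map_mul, Complex.conj_ofReal, map_ofNat]
  ring

/-- The operator `gradOp α` is closable: its formal adjoint is defined on all test functions. -/
theorem IsClosedGrad.eq_zero {α : ℝ} {h : HalfLineL2} (H : IsClosedGrad α 0 h) : h = 0 := by
  obtain ⟨η, h1, h2⟩ := H
  have key : ∀ ψ : Core, inner ℂ ψ.toL2 h = 0 := by
    intro ψ
    have t1 : Tendsto (fun n => inner ℂ ψ.toL2 ((η n).gradL2 α)) atTop (𝓝 (inner ℂ ψ.toL2 h)) :=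
      tendsto_const_nhds.inner h2
    simp_rw [inner_toL2_gradL2] at t1
    have t2 := (tendsto_const_nhds (x := ψ.gradL2 α - (2 : ℂ) • (memLp_deriv ψ).toLp (deriv ψ))
      (f := atTop (α := ℕ))).inner (𝕜 := ℂ) h1
    rw [inner_zero_right] at t2
    exact tendsto_nhds_unique t1 t2
  have hloc : LocallyIntegrableOn (h : ℝ → ℂ) (Ioi 0) volume := by
    apply locallyIntegrableOn_of_locallyIntegrable_restrict
    exact (Lp.memLp h).locallyIntegrable (by norm_num)
  have hae := isOpen_Ioi.ae_eq_zero_of_integral_contDiff_smul_eq_zero hloc (U := Ioi (0 : ℝ)) ?_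
  · rw [Lp.eq_zero_iff_ae_eq_zero]
    exact (ae_restrict_iff' measurableSet_Ioi).2 hae
  · intro g hg hgs hgt
    let ψ : Core := ⟨fun r => (g r : ℂ), Complex.ofRealCLM.contDiff.comp
      (hg.of_le (by exact_mod_cast le_top)), hgs.comp_left Complex.ofReal_zero, by
        refine subset_trans (closure_mono ?_) hgt
        intro x hx hgx
        exact hx (by simp [hgx])⟩
    have hk := key ψ
    rw [L2.inner_def] at hk
    rw [← hk, ← setIntegral_eq_integral_of_forall_compl_eq_zero (s := Ioi (0 : ℝ))]
    · refine integral_congr_ae ?_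
      filter_upwards [ψ.toL2_ae] with r hr
      have h2 : ψ r = (g r : ℂ) := rfl
      rw [hr, RCLike.inner_apply, h2, Complex.conj_ofReal, Complex.real_smul, mul_comm]
    · intro x hx
      rw [image_eq_zero_of_notMem_tsupport (fun h' => hx (hgt h')), zero_smul]

theorem IsClosedGrad.unique {α : ℝ} {u h h' : HalfLineL2} (H : IsClosedGrad α u h)
    (H' : IsClosedGrad α u h') : h = h' := by
  obtain ⟨η, h1, h2⟩ := H
  obtain ⟨ξ, h3, h4⟩ := H'
  rw [← sub_eq_zero]
  refine IsClosedGrad.eq_zero (α := α) ⟨fun n => η n - ξ n, ?_, ?_⟩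
  · simpa [Core.toL2_sub] using h1.sub h3
  · simpa only [Core.gradL2_sub] using h2.sub h4

theorem formTendsto_iff {α : ℝ} {η : ℕ → Core} {u : HalfLineL2} :
    FormTendsto α η u ↔ Tendsto (fun n => (η n).toL2) atTop (𝓝 u) ∧
      ∃ h, Tendsto (fun n => (η n).gradL2 α) atTop (𝓝 h) := by
  refine and_congr_right fun _ => ?_
  have hC : CauchySeq (fun n => (η n).gradL2 α) ↔
      Tendsto (fun p : ℕ × ℕ => form α (η p.1 - η p.2) (η p.1 - η p.2)) atTop (𝓝 0) := by
    rw [cauchySeq_iff_tendsto_dist_atTop_0]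
    have e : (fun p : ℕ × ℕ => form α (η p.1 - η p.2) (η p.1 - η p.2))
        = fun p : ℕ × ℕ => ((dist ((η p.1).gradL2 α) ((η p.2).gradL2 α) ^ 2 : ℝ) : ℂ) := by
      ext p
      rw [form_eq_inner, inner_self_eq_norm_sq_to_K, Core.gradL2_sub, dist_eq_norm]
      push_cast; rfl
    rw [e]
    constructor
    · intro h
      have := (Complex.continuous_ofReal.tendsto _).comp (h.pow 2)
      simpa [Function.comp_def] using this
    · intro h
      have h2 := (Complex.continuous_re.tendsto _).comp h
      have h3 := (Real.continuous_sqrt.tendsto _).comp h2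
      simp only [Function.comp_def, Complex.ofReal_re, Complex.zero_re, Real.sqrt_zero,
        Real.sqrt_sq dist_nonneg] at h3
      exact h3
  rw [← hC]
  exact ⟨fun h => cauchySeq_tendsto_of_complete h, fun ⟨h, hh⟩ => hh.cauchySeq⟩

theorem mem_formDomain_iff {α : ℝ} {u : HalfLineL2} :
    u ∈ formDomain α ↔ ∃ h, IsClosedGrad α u h := by
  constructor
  · rintro ⟨η, hη⟩
    obtain ⟨h1, h, h2⟩ := formTendsto_iff.1 hη
    exact ⟨h, η, h1, h2⟩
  · rintro ⟨h, η, h1, h2⟩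
    exact ⟨η, formTendsto_iff.2 ⟨h1, h, h2⟩⟩

theorem isClosedFormValue_iff {α : ℝ} {u v : HalfLineL2} {z : ℂ} :
    IsClosedFormValue α u v z ↔
      ∃ h h', IsClosedGrad α u h ∧ IsClosedGrad α v h' ∧ z = inner ℂ h h' := by
  constructor
  · rintro ⟨η, ξ, hη, hξ, hz⟩
    obtain ⟨h1, h, h2⟩ := formTendsto_iff.1 hη
    obtain ⟨h3, h', h4⟩ := formTendsto_iff.1 hξ
    refine ⟨h, h', ⟨η, h1, h2⟩, ⟨ξ, h3, h4⟩, ?_⟩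
    simp_rw [form_eq_inner] at hz
    exact tendsto_nhds_unique hz (h2.inner h4)
  · rintro ⟨h, h', ⟨η, h1, h2⟩, ⟨ξ, h3, h4⟩, rfl⟩
    refine ⟨η, ξ, formTendsto_iff.2 ⟨h1, h, h2⟩, formTendsto_iff.2 ⟨h3, h', h4⟩, ?_⟩
    simp_rw [form_eq_inner]
    exact h2.inner h4

theorem mem_operatorGraph_iff {α : ℝ} {u f : HalfLineL2} :
    (u, f) ∈ operatorGraph α ↔ ∃ h, IsClosedGrad α u h ∧
      ∀ v h', IsClosedGrad α v h' → inner ℂ h' h = inner ℂ v f := by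
  simp only [operatorGraph, mem_ofPred_eq, mem_formDomain_iff, isClosedFormValue_iff]
  constructor
  · rintro ⟨⟨h, hh⟩, H⟩
    refine ⟨h, hh, fun v h' hv => ?_⟩
    obtain ⟨k', k, hk', hk, e⟩ := H v ⟨h', hv⟩
    rw [e, hk'.unique hv, hk.unique hh]
  · rintro ⟨h, hh, H⟩
    exact ⟨⟨h, hh⟩, fun v ⟨h', hv⟩ => ⟨h', h, hv, hh, (H v h' hv).symm⟩⟩

/-- The map `η ↦ (κ η, gradOp α η)`, which is isometric for the form of `T_α + κ²`. -/
def graphMap (α κ : ℝ) : Core →ₗ[ℂ] WithLp 2 (HalfLineL2 × HalfLineL2) where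
  toFun η := WithLp.toLp 2 ((κ : ℂ) • η.toL2, η.gradL2 α)
  map_add' η ξ := by
    have : (η + ξ).toL2 = η.toL2 + ξ.toL2 := rfl
    rw [this, Core.gradL2_add, smul_add]; rfl
  map_smul' c η := by
    have : (c • η).toL2 = c • η.toL2 := rfl
    rw [this, Core.gradL2_smul, smul_comm]; rfl

/-- The form domain with the inner product of `T_α + κ²`, realised as a closed subspace of
`L² × L²` by means of `graphMap`. -/
def energySpace (α κ : ℝ) : Submodule ℂ (WithLp 2 (HalfLineL2 × HalfLineL2)) :=
  (LinearMap.range (graphMap α κ)).topologicalClosure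

instance (α κ : ℝ) : CompleteSpace (energySpace α κ) :=
  (Submodule.isClosed_topologicalClosure _).completeSpace_coe

theorem mem_energySpace_iff {α κ : ℝ} (hκ : 0 < κ) {u h : HalfLineL2} :
    WithLp.toLp 2 ((κ : ℂ) • u, h) ∈ energySpace α κ ↔ IsClosedGrad α u h := by
  have hκ' : (κ : ℂ) ≠ 0 := by exact_mod_cast hκ.ne'
  rw [energySpace, ← SetLike.mem_coe, Submodule.topologicalClosure_coe, mem_closure_iff_seq_limit]
  constructor
  · rintro ⟨x, hx, hlim⟩
    choose η hη using hx
    have hlim' := ((WithLp.prod_continuous_ofLp 2 _ _).tendsto _).comp hlim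
    have l1 := (continuous_fst.tendsto _).comp hlim'
    have l2 := (continuous_snd.tendsto _).comp hlim'
    refine ⟨η, ?_, ?_⟩
    · have l3 := l1.const_smul ((κ : ℂ)⁻¹)
      simp only [inv_smul_smul₀ hκ'] at l3
      refine l3.congr fun n => ?_
      simp only [Function.comp, ← hη n, graphMap]
      exact inv_smul_smul₀ hκ' _
    · refine l2.congr fun n => ?_
      simp only [Function.comp, ← hη n]; rfl
  · rintro ⟨η, h1, h2⟩
    refine ⟨fun n => graphMap α κ (η n), fun n => ⟨η n, rfl⟩, ?_⟩
    exact ((WithLp.prod_continuous_toLp 2 _ _).tendsto _).comp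
      ((h1.const_smul (κ : ℂ)).prodMk_nhds h2)

theorem exists_of_mem_energySpace {α κ : ℝ} (hκ : 0 < κ)
    {x : WithLp 2 (HalfLineL2 × HalfLineL2)} (hx : x ∈ energySpace α κ) :
    ∃ u h, x = WithLp.toLp 2 ((κ : ℂ) • u, h) ∧ IsClosedGrad α u h := by
  have hκ' : (κ : ℂ) ≠ 0 := by exact_mod_cast hκ.ne'
  have e : x = WithLp.toLp 2 ((κ : ℂ) • ((κ : ℂ)⁻¹ • x.fst), x.snd) := by
    rw [smul_inv_smul₀ hκ']
    rfl
  refine ⟨(κ : ℂ)⁻¹ • x.fst, x.snd, e, ?_⟩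
  rw [← mem_energySpace_iff hκ, ← e]
  exact hx

/-- The resolvent `(T_α + κ²)⁻¹`, obtained from the orthogonal projection onto the energy space
(Riesz representation of `v ↦ ⟨v, g⟩` in the form domain). -/
def resolventOp (α κ : ℝ) : HalfLineL2 →L[ℂ] HalfLineL2 :=
  (κ : ℂ)⁻¹ • ((ContinuousLinearMap.fst ℂ HalfLineL2 HalfLineL2).comp
    ((WithLp.prodContinuousLinearEquiv 2 ℂ HalfLineL2 HalfLineL2 :
      WithLp 2 (HalfLineL2 × HalfLineL2) →L[ℂ] HalfLineL2 × HalfLineL2).comp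
      ((energySpace α κ).starProjection.comp
        (((WithLp.prodContinuousLinearEquiv 2 ℂ HalfLineL2 HalfLineL2).symm :
          HalfLineL2 × HalfLineL2 →L[ℂ] WithLp 2 (HalfLineL2 × HalfLineL2)).comp
          ((κ : ℂ)⁻¹ • ContinuousLinearMap.inl ℂ HalfLineL2 HalfLineL2)))))

theorem resolventOp_apply (α κ : ℝ) (g : HalfLineL2) :
    resolventOp α κ g = (κ : ℂ)⁻¹ •
      ((energySpace α κ).starProjection (WithLp.toLp 2 ((κ : ℂ)⁻¹ • g, 0))).fst := by
  have : (κ : ℂ)⁻¹ • ((g, 0) : HalfLineL2 × HalfLineL2) = ((κ : ℂ)⁻¹ • g, 0) := by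
    rw [Prod.smul_mk, smul_zero]
  simp only [resolventOp, smul_apply, ContinuousLinearMap.comp_apply,
    ContinuousLinearMap.inl_apply, this]
  rfl

theorem inner_toLp_prod (a b c d : HalfLineL2) :
    inner ℂ (WithLp.toLp 2 (a, b)) (WithLp.toLp 2 (c, d)) = inner ℂ a c + inner ℂ b d :=
  WithLp.prod_inner_apply _ _

theorem isResolvent_resolventOp {α κ : ℝ} (hκ : 0 < κ) : IsResolvent α κ (resolventOp α κ) := by
  have hκ' : (κ : ℂ) ≠ 0 := by exact_mod_cast hκ.ne'
  have hweak : ∀ (g u h v h' : HalfLineL2),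
      inner ℂ (WithLp.toLp 2 ((κ : ℂ) • v, h'))
        (WithLp.toLp 2 ((κ : ℂ)⁻¹ • g, 0) - WithLp.toLp 2 ((κ : ℂ) • u, h))
        = inner ℂ v (g - ((κ : ℂ) ^ 2) • u) - inner ℂ h' h := by
    intro g u h v h'
    rw [inner_sub_right, inner_toLp_prod, inner_toLp_prod, inner_zero_right, inner_sub_right]
    simp only [inner_smul_left, inner_smul_right, Complex.conj_ofReal]
    field_simp
    ring
  intro g u
  rw [mem_operatorGraph_iff]
  constructor
  · intro hR
    obtain ⟨u', h, e, hc⟩ := exists_of_mem_energySpace hκ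
      ((energySpace α κ).starProjection_apply_mem (WithLp.toLp 2 ((κ : ℂ)⁻¹ • g, 0)))
    have hu : u' = u := by
      rw [← hR, resolventOp_apply, e]
      exact (inv_smul_smul₀ hκ' u').symm
    subst hu
    refine ⟨h, hc, fun v h' hv => ?_⟩
    have horth := (energySpace α κ).sub_starProjection_mem_orthogonal
      (WithLp.toLp 2 ((κ : ℂ)⁻¹ • g, 0))
    have := (Submodule.mem_orthogonal _ _).1 horth _ ((mem_energySpace_iff hκ).2 hv)
    rw [e, hweak, sub_eq_zero] at this
    exact this.symm
  · rintro ⟨h, hc, H⟩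
    have e : (energySpace α κ).starProjection (WithLp.toLp 2 ((κ : ℂ)⁻¹ • g, 0))
        = WithLp.toLp 2 ((κ : ℂ) • u, h) := by
      refine Submodule.eq_starProjection_of_mem_orthogonal ((mem_energySpace_iff hκ).2 hc) ?_
      rw [Submodule.mem_orthogonal]
      intro x hx
      obtain ⟨v, h', rfl, hv⟩ := exists_of_mem_energySpace hκ hx
      rw [hweak, H v h' hv, sub_self]
    rw [resolventOp_apply, e]
    exact inv_smul_smul₀ hκ' u

theorem IsResolvent.unique {α κ : ℝ} {R R' : HalfLineL2 →L[ℂ] HalfLineL2}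
    (h : IsResolvent α κ R) (h' : IsResolvent α κ R') : R = R' := by
  ext1 g
  exact ((h' g _).2 ((h g _).1 rfl)).symm

theorem IsResolvent.exists_grad {α κ : ℝ} {R : HalfLineL2 →L[ℂ] HalfLineL2}
    (h : IsResolvent α κ R) (g : HalfLineL2) :
    ∃ d, IsClosedGrad α (R g) d ∧ ∀ v h', IsClosedGrad α v h' →
      inner ℂ h' d + (κ : ℂ) ^ 2 * inner ℂ v (R g) = inner ℂ v g := by
  obtain ⟨d, hd, H⟩ := mem_operatorGraph_iff.1 ((h g _).1 rfl)
  refine ⟨d, hd, fun v h' hv => ?_⟩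
  rw [H v h' hv, inner_sub_right, inner_smul_right]
  ring

/-- If every point evaluation on `C¹_c((0, ∞))` is represented, in the inner product of
`T_α + κ²`, by an element `G(r, ·)` of the form domain, then `G` is an integral kernel of the
resolvent. -/
theorem isIntegralKernel_of_reproducing {α κ : ℝ} {R : HalfLineL2 →L[ℂ] HalfLineL2}
    (hR : IsResolvent α κ R) {G : ℝ → ℝ → ℂ} (hreal : ∀ r s, (starRingEnd ℂ) (G r s) = G r s)
    (H : ∀ r, 0 < r → ∃ hG : MemLp (G r) 2 (volume.restrict (Ioi (0 : ℝ))), ∃ d,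
      IsClosedGrad α (hG.toLp (G r)) d ∧ ∀ η : Core,
        inner ℂ d (η.gradL2 α) + (κ : ℂ) ^ 2 * inner ℂ (hG.toLp (G r)) η.toL2 = η r) :
    IsIntegralKernel R G := by
  intro g
  obtain ⟨d, ⟨η, h1, h2⟩, hd⟩ := hR.exists_grad g
  obtain ⟨ns, hns, hae⟩ := (tendstoInMeasure_of_tendsto_Lp h1).exists_seq_tendsto_ae
  have hall : ∀ᵐ r ∂(volume.restrict (Ioi (0 : ℝ))), ∀ n, (η n).toL2 r = η n r :=
    ae_all_iff.2 fun n => (η n).toL2_ae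
  filter_upwards [hae, hall, ae_restrict_mem measurableSet_Ioi] with r hr hr2 hr0
  obtain ⟨hG, k, hk, hrep⟩ := H r hr0
  have hconv : Tendsto (fun n => η n r) atTop (𝓝 (inner ℂ (hG.toLp (G r)) g)) := by
    rw [← hd _ _ hk]
    simp_rw [← hrep]
    exact (tendsto_const_nhds.inner h2).add ((tendsto_const_nhds.inner h1).const_mul _)
  have hval : R g r = inner ℂ (hG.toLp (G r)) g := by
    refine tendsto_nhds_unique hr ?_
    simp_rw [hr2]
    exact hconv.comp hns.tendsto_atTop
  refine ⟨hG.integrable_mul (Lp.memLp g), ?_⟩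
  rw [hval, L2.inner_def]
  refine integral_congr_ae ?_
  filter_upwards [hG.coeFn_toLp] with s hs
  rw [hs, RCLike.inner_apply, hreal, mul_comm]

/-! ### Uniqueness of a continuous kernel -/

/-- Two kernels of the same operator that are continuous on `(0, ∞)²` agree at every point. -/
theorem IsIntegralKernel.eqOn {R : HalfLineL2 →L[ℂ] HalfLineL2} {G G' : ℝ → ℝ → ℂ}
    (hG : ContinuousOn (Function.uncurry G) (Ioi 0 ×ˢ Ioi 0))
    (hG' : ContinuousOn (Function.uncurry G') (Ioi 0 ×ˢ Ioi 0))
    (h : IsIntegralKernel R G) (h' : IsIntegralKernel R G') {r s : ℝ} (hr : 0 < r) (hs : 0 < s) :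
    G r s = G' r s := by
  -- It suffices to test with indicators of rational intervals.
  let ind : ℚ × ℚ → HalfLineL2 := fun p =>
    indicatorConstLp 2 (measurableSet_Ioc (a := (p.1 : ℝ)) (b := p.2))
      ((Measure.restrict_apply_le _ _).trans_lt measure_Ioc_lt_top).ne (1 : ℂ)
  have hae : ∀ᵐ x ∂(volume.restrict (Ioi (0 : ℝ))), ∀ p : ℚ × ℚ, 0 < p.1 → p.1 < p.2 →
      ∫ y in (p.1 : ℝ)..p.2, (G x y - G' x y) = 0 := by
    rw [ae_all_iff]
    intro p
    filter_upwards [h (ind p), h' (ind p), ae_restrict_mem measurableSet_Ioi] with x hx hx' hx0 hp hpp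
    have hpp' : (p.1 : ℝ) ≤ p.2 := by exact_mod_cast hpp.le
    have hp' : (0 : ℝ) < p.1 := by exact_mod_cast hp
    have hsub : Ioc (p.1 : ℝ) p.2 ⊆ Ioi 0 := fun y hy => hp'.trans hy.1
    have hcong : ∀ K : ℝ → ℝ → ℂ, ∫ y in Ioi (0 : ℝ), K x y * ind p y
        = ∫ y in (p.1 : ℝ)..p.2, K x y := by
      intro K
      rw [intervalIntegral.integral_of_le hpp', ← inter_eq_self_of_subset_right hsub,
        ← setIntegral_indicator measurableSet_Ioc]
      refine integral_congr_ae ?_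
      filter_upwards [indicatorConstLp_coeFn (p := 2) (hs := measurableSet_Ioc (a := (p.1 : ℝ)) (b := p.2))
        (hμs := ((Measure.restrict_apply_le (μ := volume) (Ioi (0 : ℝ)) _).trans_lt
          measure_Ioc_lt_top).ne) (c := (1 : ℂ))] with y hy
      simp only [ind, hy, Set.indicator_apply]
      split_ifs <;> simp
    have hint : ∀ K : ℝ → ℝ → ℂ, ContinuousOn (Function.uncurry K) (Ioi 0 ×ˢ Ioi 0) →
        IntervalIntegrable (K x) volume (p.1 : ℝ) p.2 := by
      intro K hK
      apply ContinuousOn.intervalIntegrable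
      rw [uIcc_of_le hpp']
      exact hK.comp (f := fun y => (x, y)) (by fun_prop)
        fun y hy => ⟨hx0, hp'.trans_le hy.1⟩
    rw [intervalIntegral.integral_sub (hint G hG) (hint G' hG'), ← hcong G, ← hcong G', ← hx.2,
      ← hx'.2, sub_self]
  have hae2 : ∀ᵐ x ∂(volume.restrict (Ioi (0 : ℝ))), G x s = G' x s := by
    filter_upwards [hae, ae_restrict_mem measurableSet_Ioi] with x hx hx0
    by_contra hne
    have hc : ContinuousOn (fun y => G x y - G' x y) (Ioi 0) :=
      (hG.comp (f := fun y => (x, y)) (by fun_prop) fun y hy => ⟨hx0, hy⟩).sub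
        (hG'.comp (f := fun y => (x, y)) (by fun_prop) fun y hy => ⟨hx0, hy⟩)
    -- The integrals over rational intervals shrinking to `s` are small compared with the length.
    set c := G x s - G' x s with hcdef
    have hc0 : 0 < ‖c‖ := norm_pos_iff.2 (sub_ne_zero.2 hne)
    have hnear : ∀ᶠ y in 𝓝 s, ‖(G x y - G' x y) - c‖ < ‖c‖ / 2 := by
      have h2 : Tendsto (fun y => ‖(G x y - G' x y) - c‖) (𝓝 s) (𝓝 ‖c - c‖) :=
        ((hc.continuousAt (Ioi_mem_nhds hs)).tendsto.sub_const c).norm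
      rw [sub_self, norm_zero] at h2
      exact h2.eventually (gt_mem_nhds (half_pos hc0))
    obtain ⟨δ, hδ, hball⟩ := Metric.eventually_nhds_iff.1 hnear
    obtain ⟨p, hp1, hp2⟩ := exists_rat_btwn (show max (s - δ) 0 < s from max_lt (by linarith) hs)
    obtain ⟨q, hq1, hq2⟩ := exists_rat_btwn (show s < s + δ by linarith)
    have hp0 : (0 : ℝ) < p := (le_max_right _ _).trans_lt hp1
    have hpq : (p : ℝ) < q := hp2.trans hq1
    have hz := hx (p, q) (by exact_mod_cast hp0) (by exact_mod_cast hpq)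
    have hci : IntervalIntegrable (fun y => G x y - G' x y) volume (p : ℝ) q := by
      apply ContinuousOn.intervalIntegrable
      rw [uIcc_of_le hpq.le]
      exact hc.mono fun y hy => hp0.trans_le hy.1
    have hz2 : ∫ y in (p : ℝ)..q, ((G x y - G' x y) - c) = -(((q : ℝ) - p : ℝ) • c) := by
      rw [intervalIntegral.integral_sub hci intervalIntegrable_const, hz,
        intervalIntegral.integral_const, zero_sub]
    have hb := intervalIntegral.norm_integral_le_of_norm_le_const (a := (p : ℝ)) (b := q)
      (f := fun y => (G x y - G' x y) - c) (C := ‖c‖ / 2) (by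
        intro y hy
        rw [uIoc_of_le hpq.le] at hy
        refine (hball ?_).le
        rw [Real.dist_eq, abs_lt]
        constructor
        · have := (le_max_left (s - δ) 0).trans_lt hp1
          linarith [hy.1]
        · linarith [hy.2])
    rw [hz2, norm_neg, norm_smul, Real.norm_eq_abs] at hb
    have hpos : 0 < |(q : ℝ) - p| := abs_pos.2 (by linarith)
    nlinarith
  have hcx : ContinuousOn (fun x => G x s) (Ioi 0) :=
    hG.comp (f := fun x => (x, s)) (by fun_prop) fun y hy => ⟨hy, hs⟩
  have hcx' : ContinuousOn (fun x => G' x s) (Ioi 0) :=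
    hG'.comp (f := fun x => (x, s)) (by fun_prop) fun y hy => ⟨hy, hs⟩
  exact Measure.eqOn_open_of_ae_eq hae2 isOpen_Ioi hcx hcx' hr

theorem IsResolventKernel.eq {α κ : ℝ} {G G' : ℝ → ℝ → ℂ} (h : IsResolventKernel α κ G)
    (h' : IsResolventKernel α κ G') {r s : ℝ} (hr : 0 < r) (hs : 0 < s) : G r s = G' r s := by
  obtain ⟨hc, R, hR, hk⟩ := h
  obtain ⟨hc', R', hR', hk'⟩ := h'
  rw [← hR.unique hR'] at hk'
  exact hk.eqOn hc hc' hk' hr hs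

/-! ### Membership in the form domain -/

theorem norm_toLp_sq {f : ℝ → ℂ} (hf : MemLp f 2 (volume.restrict (Ioi (0 : ℝ)))) :
    ‖hf.toLp f‖ ^ 2 = ∫ r in Ioi (0 : ℝ), ‖f r‖ ^ 2 := by
  have h := inner_self_eq_norm_sq_to_K (𝕜 := ℂ) (hf.toLp f)
  rw [inner_toLp hf hf] at h
  have e : ∀ r, (starRingEnd ℂ) (f r) * f r = ((‖f r‖ ^ 2 : ℝ) : ℂ) := by
    intro r
    rw [mul_comm, Complex.mul_conj, Complex.normSq_eq_norm_sq]
  simp_rw [e] at h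
  have h2 := h.symm.trans (integral_ofReal (μ := volume.restrict (Ioi (0 : ℝ)))
    (f := fun r => ‖f r‖ ^ 2) (𝕜 := ℂ))
  exact_mod_cast h2

theorem tendsto_toLp_zero_of_integral {f : ℕ → ℝ → ℂ}
    (hf : ∀ n, MemLp (f n) 2 (volume.restrict (Ioi (0 : ℝ))))
    (h : Tendsto (fun n => ∫ r in Ioi (0 : ℝ), ‖f n r‖ ^ 2) atTop (𝓝 0)) :
    Tendsto (fun n => (hf n).toLp (f n)) atTop (𝓝 0) := by
  rw [tendsto_zero_iff_norm_tendsto_zero]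
  simp_rw [← norm_toLp_sq (hf _)] at h
  have := (Real.continuous_sqrt.tendsto _).comp h
  simpa only [Function.comp_def, Real.sqrt_sq (norm_nonneg _), Real.sqrt_zero] using this

theorem tendsto_toLp_of_dominated {f : ℕ → ℝ → ℂ} {F : ℝ → ℂ} {g : ℝ → ℝ}
    (hf : ∀ n, MemLp (f n) 2 (volume.restrict (Ioi (0 : ℝ))))
    (hF : MemLp F 2 (volume.restrict (Ioi (0 : ℝ))))
    (hg : MemLp g 2 (volume.restrict (Ioi (0 : ℝ))))
    (hbound : ∀ n, ∀ᵐ r ∂(volume.restrict (Ioi (0 : ℝ))), ‖f n r‖ ≤ g r)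
    (hlim : ∀ᵐ r ∂(volume.restrict (Ioi (0 : ℝ))),
      Tendsto (fun n => f n r) atTop (𝓝 (F r))) :
    Tendsto (fun n => (hf n).toLp (f n)) atTop (𝓝 (hF.toLp F)) := by
  rw [← tendsto_sub_nhds_zero_iff]
  simp_rw [← MemLp.toLp_sub]
  refine tendsto_toLp_zero_of_integral (fun n => (hf n).sub hF) ?_
  suffices h0 : Tendsto (fun n => ∫ r in Ioi (0 : ℝ), ‖(f n - F) r‖ ^ 2) atTop
      (𝓝 (∫ _ in Ioi (0 : ℝ), (0 : ℝ))) by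
    rwa [integral_zero] at h0
  refine tendsto_integral_of_dominated_convergence (fun r => (2 * g r) ^ 2) ?_ ?_ ?_ ?_
  · exact fun n => (((hf n).sub hF).1.norm.pow 2)
  · exact (hg.const_mul 2).integrable_sq
  · intro n
    filter_upwards [ae_all_iff.2 hbound, hlim] with r h1 h2
    have h3 : ‖F r‖ ≤ g r := le_of_tendsto h2.norm (Eventually.of_forall h1)
    rw [norm_pow, norm_norm]
    refine pow_le_pow_left₀ (norm_nonneg _) ?_ 2
    calc ‖(f n - F) r‖ ≤ ‖f n r‖ + ‖F r‖ := norm_sub_le _ _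
      _ ≤ 2 * g r := by linarith [h1 n]
  · filter_upwards [hlim] with r hr
    have : Tendsto (fun n => ‖f n r - F r‖ ^ 2) atTop (𝓝 (‖F r - F r‖ ^ 2)) :=
      ((hr.sub_const _).norm).pow 2
    simpa using this

/-- A continuous function with compact support in `(0, ∞)` that is differentiable off a countable
set, with bounded derivative, lies in the form domain: its Steklov averages
`ε⁻¹ ∫_t^{t+ε} F` are `C¹`. -/
theorem isClosedGrad_of_compactSupport {α a b L : ℝ} {F F' : ℝ → ℂ} {S : Set ℝ} (ha : 0 < a)
    (hF : Continuous F) (hsupp : ∀ t, t ∉ Icc a b → F t = 0) (hS : S.Countable)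
    (hderiv : ∀ t, t ∉ S → HasDerivAt F (F' t) t) (hL : ∀ t, t ∉ S → ‖F' t‖ ≤ L)
    (hu : MemLp F 2 (volume.restrict (Ioi (0 : ℝ))))
    (hd : MemLp (fun r => F' r - (logSlope α r / r : ℝ) * F r) 2
      (volume.restrict (Ioi (0 : ℝ)))) :
    IsClosedGrad α (hu.toLp F) (hd.toLp _) := by
  have hcs : HasCompactSupport F := HasCompactSupport.intro isCompact_Icc hsupp
  obtain ⟨M, hM⟩ := hF.bounded_above_of_compact_support hcs
  have hM0 : 0 ≤ M := (norm_nonneg _).trans (hM 0)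
  have hSae : ∀ᵐ t : ℝ, t ∉ S := compl_mem_ae_iff.2 (hS.measure_zero _)
  obtain ⟨t₀, ht₀⟩ : ∃ t, t ∉ S := hSae.exists
  have hL0 : 0 ≤ L := (norm_nonneg _).trans (hL t₀ ht₀)
  have hF'int : ∀ x y : ℝ, IntervalIntegrable F' volume x y := by
    intro x y
    have hm : AEStronglyMeasurable F' volume := by
      refine (aestronglyMeasurable_deriv F volume).congr ?_
      filter_upwards [hSae] with t ht
      exact (hderiv t ht).deriv
    refine (intervalIntegrable_const (c := L)).mono_fun hm.restrict ?_
    refine ae_restrict_of_ae ?_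
    filter_upwards [hSae] with t ht
    rw [Real.norm_eq_abs, abs_of_nonneg hL0]
    exact hL t ht
  have hlip : ∀ x y : ℝ, ‖F y - F x‖ ≤ L * |y - x| := by
    intro x y
    rw [← integral_eq_of_hasDerivAt_off_countable F F' hS hF.continuousOn
      (fun t ht => hderiv t ht.2) (hF'int x y)]
    refine intervalIntegral.norm_integral_le_of_norm_le_const_ae ?_
    filter_upwards [hSae] with t ht _
    exact hL t ht
  set ε : ℕ → ℝ := fun n => (a / 2) * (1 / ((n : ℝ) + 1)) with hε
  have hεpos : ∀ n, 0 < ε n := fun n => by positivity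
  have hεle : ∀ n, ε n ≤ a / 2 := fun n => by
    have : 1 / ((n : ℝ) + 1) ≤ 1 := by
      rw [div_le_one (by positivity)]; linarith [(Nat.cast_nonneg n : (0 : ℝ) ≤ n)]
    calc ε n ≤ (a / 2) * 1 := mul_le_mul_of_nonneg_left this (by positivity)
      _ = a / 2 := mul_one _
  have hεlim : Tendsto ε atTop (𝓝[≠] 0) := by
    refine tendsto_nhdsWithin_iff.2 ⟨?_, Eventually.of_forall fun n => (hεpos n).ne'⟩
    have := (tendsto_one_div_add_atTop_nhds_zero_nat (𝕜 := ℝ)).const_mul (a / 2)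
    rwa [mul_zero] at this
  set P : ℝ → ℂ := fun t => ∫ s in (0 : ℝ)..t, F s with hP
  have hPd : ∀ t, HasDerivAt P (F t) t := fun t =>
    intervalIntegral.integral_hasDerivAt_right (hF.intervalIntegrable _ _)
      (hF.stronglyMeasurableAtFilter _ _) hF.continuousAt
  have hPdiff : ∀ x y, P y - P x = ∫ s in x..y, F s := fun x y =>
    intervalIntegral.integral_interval_sub_left (hF.intervalIntegrable _ _)
      (hF.intervalIntegrable _ _)
  set A : ℕ → ℝ → ℂ := fun n t => (ε n)⁻¹ • (P (t + ε n) - P t) with hA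
  set A' : ℕ → ℝ → ℂ := fun n t => (ε n)⁻¹ • (F (t + ε n) - F t) with hA'
  have hAd : ∀ n t, HasDerivAt (A n) (A' n t) t := fun n t =>
    (((hPd (t + ε n)).comp_add_const t (ε n)).sub (hPd t)).const_smul (ε n)⁻¹
  have hAderiv : ∀ n, deriv (A n) = A' n := fun n => funext fun t => (hAd n t).deriv
  have hAC : ∀ n, ContDiff ℝ 1 (A n) := by
    intro n
    rw [contDiff_one_iff_deriv]
    refine ⟨fun t => (hAd n t).differentiableAt, ?_⟩
    rw [hAderiv]
    exact ((hF.comp (continuous_id.add continuous_const)).sub hF).const_smul (ε n)⁻¹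
  have hAs : ∀ n t, t ∉ Icc (a / 2) b → A n t = 0 := by
    intro n t ht
    have hz : ∫ s in t..(t + ε n), F s = 0 := by
      refine intervalIntegral.integral_zero_ae (Eventually.of_forall fun s hs => hsupp s ?_)
      rw [uIoc_of_le (by linarith [hεpos n])] at hs
      intro hs'
      exact ht ⟨by linarith [hs.1, hs.2, hs'.1, hs'.2, hεle n], hs.1.le.trans hs'.2⟩
    simp only [hA, hPdiff, hz, smul_zero]
  have hA's : ∀ n t, t ∉ Icc (a / 2) b → A' n t = 0 := by
    intro n t ht
    rw [← hAderiv]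
    have : A n =ᶠ[𝓝 t] fun _ => 0 := by
      filter_upwards [isClosed_Icc.isOpen_compl.mem_nhds ht] with s hs
      exact hAs n s hs
    rw [this.deriv_eq, deriv_const]
  have hAM : ∀ n t, ‖A n t‖ ≤ M := by
    intro n t
    have h1 : ‖P (t + ε n) - P t‖ ≤ M * |t + ε n - t| := by
      rw [hPdiff]
      exact intervalIntegral.norm_integral_le_of_norm_le_const fun s _ => hM s
    rw [add_sub_cancel_left, abs_of_pos (hεpos n)] at h1
    simp only [hA, norm_smul, norm_inv, Real.norm_eq_abs, abs_of_pos (hεpos n)]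
    rw [inv_mul_le_iff₀ (hεpos n), mul_comm]
    exact h1
  have hA'L : ∀ n t, ‖A' n t‖ ≤ L := by
    intro n t
    have h1 := hlip t (t + ε n)
    rw [add_sub_cancel_left, abs_of_pos (hεpos n)] at h1
    simp only [hA', norm_smul, norm_inv, Real.norm_eq_abs, abs_of_pos (hεpos n)]
    rw [inv_mul_le_iff₀ (hεpos n), mul_comm]
    exact h1
  have hslope : ∀ (Q : ℝ → ℂ) (q : ℂ) (t : ℝ), HasDerivAt Q q t →
      Tendsto (fun n => (ε n)⁻¹ • (Q (t + ε n) - Q t)) atTop (𝓝 q) := fun Q q t h =>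
    (hasDerivAt_iff_tendsto_slope_zero.1 h).comp hεlim
  let η : ℕ → Core := fun n => ⟨A n, hAC n, HasCompactSupport.intro isCompact_Icc (hAs n), by
    refine (closure_minimal (fun t ht => ?_) isClosed_Icc).trans
      (fun t ht => lt_of_lt_of_le (half_pos ha) ht.1 : Icc (a / 2) b ⊆ Ioi 0)
    by_contra h
    exact ht (hAs n t h)⟩
  have hind : ∀ c : ℝ, MemLp ((Icc (a / 2) b).indicator fun _ => c) 2
      (volume.restrict (Ioi (0 : ℝ))) := fun c =>
    memLp_indicator_const 2 measurableSet_Icc c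
      (Or.inr ((Measure.restrict_apply_le _ _).trans_lt measure_Icc_lt_top).ne)
  refine ⟨η, ?_, ?_⟩
  · refine tendsto_toLp_of_dominated (fun n => Core.memLp (η n)) hu (hind M) ?_ ?_
    · intro n
      refine Eventually.of_forall fun t => ?_
      change ‖A n t‖ ≤ _
      by_cases ht : t ∈ Icc (a / 2) b
      · rw [indicator_of_mem ht]; exact hAM n t
      · rw [indicator_of_notMem ht, hAs n t ht, norm_zero]
    · exact Eventually.of_forall fun t => hslope P _ t (hPd t)
  · refine tendsto_toLp_of_dominated (fun n => (η n).memLp_gradOp α) hd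
      (hind (L + (1 / 2 + |α|) / (a / 2) * M)) ?_ ?_
    · intro n
      refine Eventually.of_forall fun t => ?_
      change ‖deriv (A n) t - (logSlope α t / t : ℝ) * A n t‖ ≤ _
      rw [hAderiv]
      by_cases ht : t ∈ Icc (a / 2) b
      · rw [indicator_of_mem ht]
        refine (norm_sub_le _ _).trans (add_le_add (hA'L n t) ?_)
        rw [norm_mul, Complex.norm_real, Real.norm_eq_abs, abs_div,
          abs_of_pos (lt_of_lt_of_le (half_pos ha) ht.1)]
        refine mul_le_mul ?_ (hAM n t) (norm_nonneg _) (by positivity)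
        exact div_le_div₀ (by positivity) (abs_logSlope_le α t) (half_pos ha) ht.1
      · rw [indicator_of_notMem ht, hAs n t ht, hA's n t ht, mul_zero, sub_zero, norm_zero]
    · refine ae_restrict_of_ae ?_
      filter_upwards [hSae] with t ht
      change Tendsto (fun n => deriv (A n) t - (logSlope α t / t : ℝ) * A n t) atTop _
      simp_rw [hAderiv]
      exact (hslope F _ t (hderiv t ht)).sub ((hslope P _ t (hPd t)).const_mul _)

theorem exists_cutoff : ∃ (θ : ℝ → ℝ) (T : ℝ), ContDiff ℝ 1 θ ∧ (∀ x, 0 ≤ θ x ∧ θ x ≤ 1) ∧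
    (∀ x, |x| ≤ 1 → θ x = 1) ∧ (∀ x, 2 ≤ |x| → θ x = 0 ∧ deriv θ x = 0) ∧
    ∀ x, |deriv θ x| ≤ T := by
  let θ : ContDiffBump (0 : ℝ) := ⟨1, 2, one_pos, one_lt_two⟩
  have hC : ContDiff ℝ 1 θ := θ.contDiff
  obtain ⟨T, hT⟩ := (hC.continuous_deriv le_rfl).bounded_above_of_compact_support
    θ.hasCompactSupport.deriv
  refine ⟨θ, T, hC, fun x => ⟨θ.nonneg, θ.le_one⟩, fun x hx => ?_, fun x hx => ?_, hT⟩
  · exact θ.one_of_mem_closedBall (by simpa [θ] using hx)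
  · have h0 : θ x = 0 := θ.zero_of_le_dist (by simpa [θ] using hx)
    refine ⟨h0, IsLocalMin.deriv_eq_zero (Eventually.of_forall fun y => ?_)⟩
    rw [h0]
    exact θ.nonneg

/-- A function `φ f`, with `φ` the ground state, lies in the form domain if it and `φ f'` are square
integrable and `f` is bounded near `0`. At `0` the cut-off has to be logarithmic because the Hardy
weight `1 / (4 r²)` is critical. -/
theorem isClosedGrad_groundState_mul {α M : ℝ} {f df : ℝ → ℝ} {S : Set ℝ} (hα : 0 ≤ α)
    (hf : ContinuousOn f (Ioi 0)) (hS : S.Countable)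
    (hderiv : ∀ t, 0 < t → t ∉ S → HasDerivAt f (df t) t)
    (hloc : ∀ a b : ℝ, 0 < a → ∃ L, ∀ t ∈ Icc a b, |df t| ≤ L)
    (hM : ∀ t ∈ Ioc (0 : ℝ) 1, |f t| ≤ M)
    (hu : MemLp (fun r => ((groundState α r * f r : ℝ) : ℂ)) 2 (volume.restrict (Ioi (0 : ℝ))))
    (hd : MemLp (fun r => ((groundState α r * df r : ℝ) : ℂ)) 2
      (volume.restrict (Ioi (0 : ℝ)))) :
    IsClosedGrad α (hu.toLp _) (hd.toLp _) := by
  obtain ⟨θ, T, hθC, hθ01, hθ1, hθ0, hθT⟩ := exists_cutoff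
  have hT0 : 0 ≤ T := (abs_nonneg _).trans (hθT 0)
  have hM0 : 0 ≤ M := (abs_nonneg _).trans (hM 1 ⟨one_pos, le_rfl⟩)
  have hφ0 : ∀ t, t ≤ 0 → groundState α t = 0 := fun t ht => by
    rw [groundState, Real.sqrt_eq_zero_of_nonpos ht, zero_mul]
  have hφle : ∀ t, groundState α t ≤ √t := fun t => by
    rw [groundState]
    refine mul_le_of_le_one_right (Real.sqrt_nonneg _) ?_
    exact Real.rpow_le_one_of_one_le_of_nonpos (le_max_left _ _) (by linarith)
  have hφnn : ∀ t, 0 ≤ groundState α t := fun t => by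
    rcases le_or_gt t 0 with h | h
    · rw [hφ0 t h]
    · exact (groundState_pos α h).le
  set N : ℕ → ℝ := fun n => (n : ℝ) + 1 with hN
  have hN0 : ∀ n, 0 < N n := fun n => by positivity
  set χ : ℕ → ℝ → ℝ := fun n s => θ (Real.log s / N n) with hχ
  set dχ : ℕ → ℝ → ℝ := fun n s => deriv θ (Real.log s / N n) * (s⁻¹ / N n) with hdχ
  have hχd : ∀ n s, 0 < s → HasDerivAt (χ n) (dχ n s) s := fun n s hs =>
    ((hθC.differentiable one_ne_zero _).hasDerivAt).comp s
      ((Real.hasDerivAt_log hs.ne').div_const (N n))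
  have hχm : ∀ n, Measurable (χ n) := fun n =>
    hθC.continuous.measurable.comp (Real.measurable_log.div_const _)
  have hdχm : ∀ n, Measurable (dχ n) := fun n =>
    ((hθC.continuous_deriv le_rfl).measurable.comp (Real.measurable_log.div_const _)).mul
      (measurable_inv.div_const _)
  set a : ℕ → ℝ := fun n => Real.exp (-(2 * N n)) with ha
  set b : ℕ → ℝ := fun n => Real.exp (2 * N n) with hb
  have ha0 : ∀ n, 0 < a n := fun n => Real.exp_pos _
  -- outside `[a n, b n]` the cut-off and its derivative vanish
  have hout : ∀ n s, 0 < s → s ∉ Ioo (a n) (b n) → χ n s = 0 ∧ dχ n s = 0 := by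
    intro n s hs hs'
    have : 2 ≤ |Real.log s / N n| := by
      rw [abs_div, abs_of_pos (hN0 n), le_div_iff₀ (hN0 n)]
      by_contra! hlt
      rw [abs_lt] at hlt
      exact hs' ⟨(Real.lt_log_iff_exp_lt hs).1 hlt.1, (Real.log_lt_iff_lt_exp hs).1 hlt.2⟩
    obtain ⟨h1, h2⟩ := hθ0 _ this
    exact ⟨h1, by simp only [hdχ, h2, zero_mul]⟩
  have hχlim : ∀ s, ∀ᶠ n in atTop, χ n s = 1 := by
    intro s
    obtain ⟨m, hm⟩ := exists_nat_ge |Real.log s|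
    filter_upwards [eventually_ge_atTop m] with n hn
    apply hθ1
    rw [abs_div, abs_of_pos (hN0 n), div_le_one (hN0 n)]
    have : (m : ℝ) ≤ n := by exact_mod_cast hn
    simp only [hN]; linarith
  have hχabs : ∀ n s, |χ n s| ≤ 1 := fun n s => by
    rw [abs_of_nonneg (hθ01 _).1]; exact (hθ01 _).2
  have hdχabs : ∀ n s, 0 < s → |dχ n s| ≤ T * (s⁻¹ / N n) := fun n s hs => by
    rw [hdχ, abs_mul, abs_of_nonneg (div_nonneg (inv_nonneg.2 hs.le) (hN0 n).le)]
    exact mul_le_mul_of_nonneg_right (hθT _) (div_nonneg (inv_nonneg.2 hs.le) (hN0 n).le)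
  set u : ℝ → ℂ := fun r => ((groundState α r * f r : ℝ) : ℂ) with hu_def
  set d : ℝ → ℂ := fun r => ((groundState α r * df r : ℝ) : ℂ) with hd_def
  set U : ℕ → ℝ → ℂ := fun n r => (χ n r : ℂ) * u r with hU
  set D1 : ℕ → ℝ → ℂ := fun n r => (χ n r : ℂ) * d r with hD1
  set D2 : ℕ → ℝ → ℂ := fun n r => (dχ n r : ℂ) * u r with hD2
  have hUp : ∀ n, MemLp (U n) 2 (volume.restrict (Ioi (0 : ℝ))) := fun n => by
    refine hu.of_le ((Complex.measurable_ofReal.comp (hχm n)).aestronglyMeasurable.mul hu.1)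
      (ae_of_all _ fun r => ?_)
    rw [hU, norm_mul, Complex.norm_real]
    exact mul_le_of_le_one_left (norm_nonneg _) (hχabs n r)
  have hD1p : ∀ n, MemLp (D1 n) 2 (volume.restrict (Ioi (0 : ℝ))) := fun n => by
    refine hd.of_le ((Complex.measurable_ofReal.comp (hχm n)).aestronglyMeasurable.mul hd.1)
      (ae_of_all _ fun r => ?_)
    rw [hD1, norm_mul, Complex.norm_real]
    exact mul_le_of_le_one_left (norm_nonneg _) (hχabs n r)
  have hdχle : ∀ n r, 0 < r → |dχ n r| ≤ T * ((a n)⁻¹ / N n) := by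
    intro n r hr
    by_cases hr' : r ∈ Ioo (a n) (b n)
    · refine (hdχabs n r hr).trans (mul_le_mul_of_nonneg_left ?_ hT0)
      exact div_le_div_of_nonneg_right (inv_anti₀ (ha0 n) hr'.1.le) (hN0 n).le
    · rw [(hout n r hr hr').2, abs_zero]
      have := ha0 n; have := hN0 n; positivity
  have hD2p : ∀ n, MemLp (D2 n) 2 (volume.restrict (Ioi (0 : ℝ))) := fun n => by
    refine hu.of_le_mul (c := T * ((a n)⁻¹ / N n))
      ((Complex.measurable_ofReal.comp (hdχm n)).aestronglyMeasurable.mul hu.1) ?_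
    filter_upwards [ae_restrict_mem measurableSet_Ioi] with r hr
    rw [hD2, norm_mul, Complex.norm_real]
    exact mul_le_mul_of_nonneg_right (hdχle n r hr) (norm_nonneg _)
  -- the truncated functions lie in the form domain
  have hDeq : ∀ n, (fun r => (D1 n r + D2 n r + (logSlope α r / r : ℝ) * U n r)
      - (logSlope α r / r : ℝ) * U n r) = D1 n + D2 n := fun n => by
    ext r; simp
  have hmem : ∀ n, IsClosedGrad α ((hUp n).toLp _) (((hD1p n).add (hD2p n)).toLp _) := by
    intro n
    have hUs : ∀ t, t ∉ Icc (a n) (b n) → U n t = 0 := by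
      intro t ht
      rcases le_or_gt t 0 with h | h
      · simp only [hU, hu_def, hφ0 t h]; simp
      · have := (hout n t h fun h' => ht ⟨h'.1.le, h'.2.le⟩).1
        simp only [hU, this]; simp
    have hzero : ∀ t, t < a n → U n =ᶠ[𝓝 t] fun _ => 0 := fun t ht => by
      filter_upwards [Iio_mem_nhds ht] with s hs
      exact hUs s fun h => absurd h.1 (not_le.2 hs)
    have hUc : Continuous (U n) := by
      rw [continuous_iff_continuousAt]
      intro t
      rcases lt_or_ge t (a n) with h | h
      · exact continuousAt_const.congr (hzero t h).symm
      · have h0 := (ha0 n).trans_le h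
        have h1 : ContinuousAt (fun r => χ n r * (groundState α r * f r)) t :=
          (hχd n t h0).continuousAt.mul
            ((continuous_groundState α).continuousAt.mul (hf.continuousAt (Ioi_mem_nhds h0)))
        have h2 := Complex.continuous_ofReal.continuousAt.comp h1
        refine h2.congr (Eventually.of_forall fun s => ?_)
        simp [hU, hu_def, Function.comp]
    have hUd : ∀ t, t ∉ S ∪ {1} →
        HasDerivAt (U n) (D1 n t + D2 n t + (logSlope α t / t : ℝ) * U n t) t := by
      intro t ht
      rw [mem_union, mem_singleton_iff, not_or] at ht
      rcases le_or_gt t 0 with h | h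
      · have e : D1 n t + D2 n t + (logSlope α t / t : ℝ) * U n t = 0 := by
          simp [hD1, hD2, hU, hu_def, hd_def, hφ0 t h]
        rw [e]
        exact (hasDerivAt_const t (0 : ℂ)).congr_of_eventuallyEq (hzero t (h.trans_lt (ha0 n)))
      · have h1 := ((hχd n t h).mul ((hasDerivAt_groundState α h ht.2).mul
          (hderiv t h ht.1))).ofReal_comp
        refine (h1.congr_deriv ?_).congr_of_eventuallyEq (Eventually.of_forall fun s => ?_)
        · simp only [hD1, hD2, hU, hu_def, hd_def, Pi.mul_apply]
          push_cast
          ring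
        · simp [hU, hu_def]
    obtain ⟨L, hL⟩ := hloc (a n) (b n) (ha0 n)
    obtain ⟨Mf, hMf⟩ := isCompact_Icc.exists_bound_of_continuousOn
      (hf.mono (fun t ht => (ha0 n).trans_le ht.1 : Icc (a n) (b n) ⊆ Ioi 0))
    have hMf0 : 0 ≤ Mf := (norm_nonneg _).trans (hMf (a n)
      ⟨le_rfl, Real.exp_le_exp.2 (by linarith [hN0 n])⟩)
    have hbd : ∀ t, t ∉ S ∪ {1} → ‖D1 n t + D2 n t + (logSlope α t / t : ℝ) * U n t‖ ≤
        √(b n) * L + (T * ((a n)⁻¹ / N n)) * (√(b n) * Mf)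
          + ((1 / 2 + |α|) / a n) * (√(b n) * Mf) := by
      intro t ht
      by_cases h : t ∈ Icc (a n) (b n)
      · have h0 := (ha0 n).trans_le h.1
        have hφb : |groundState α t| ≤ √(b n) := by
          rw [abs_of_nonneg (hφnn t)]
          exact (hφle t).trans (Real.sqrt_le_sqrt h.2)
        have hub : ‖u t‖ ≤ √(b n) * Mf := by
          rw [hu_def, Complex.norm_real, Real.norm_eq_abs, abs_mul]
          exact mul_le_mul hφb (hMf t h) (abs_nonneg _) (Real.sqrt_nonneg _)
        have hdb : ‖d t‖ ≤ √(b n) * L := by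
          rw [hd_def, Complex.norm_real, Real.norm_eq_abs, abs_mul]
          exact mul_le_mul hφb (hL t h) (abs_nonneg _) (Real.sqrt_nonneg _)
        refine (norm_add_le _ _).trans (add_le_add ((norm_add_le _ _).trans (add_le_add ?_ ?_)) ?_)
        · rw [hD1, norm_mul, Complex.norm_real]
          exact (mul_le_of_le_one_left (norm_nonneg _) (hχabs n t)).trans hdb
        · rw [hD2, norm_mul, Complex.norm_real]
          have := ha0 n; have := hN0 n
          exact mul_le_mul (hdχle n t h0) hub (norm_nonneg _) (by positivity)
        · have := ha0 n
          rw [norm_mul, Complex.norm_real, Real.norm_eq_abs, abs_div, abs_of_pos h0]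
          refine mul_le_mul ?_ ?_ (norm_nonneg _) (by positivity)
          · exact div_le_div₀ (by positivity) (abs_logSlope_le α t) this h.1
          · rw [hU, norm_mul, Complex.norm_real]
            exact (mul_le_of_le_one_left (norm_nonneg _) (hχabs n t)).trans hub
      · have h2 : D1 n t + D2 n t + (logSlope α t / t : ℝ) * U n t = 0 := by
          rw [hUs t h]
          rcases le_or_gt t 0 with h0 | h0
          · simp [hD1, hD2, hu_def, hd_def, hφ0 t h0]
          · have := hout n t h0 fun h' => h ⟨h'.1.le, h'.2.le⟩
            simp [hD1, hD2, this.1, this.2]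
        rw [h2, norm_zero]
        have hL0 : 0 ≤ L := (abs_nonneg _).trans (hL (a n)
          ⟨le_rfl, Real.exp_le_exp.2 (by linarith [hN0 n])⟩)
        have := ha0 n; have := hN0 n
        positivity
    have key := isClosedGrad_of_compactSupport (α := α) (ha0 n) hUc hUs
      (hS.union (countable_singleton 1)) hUd hbd (hUp n)
      (by rw [hDeq]; exact (hD1p n).add (hD2p n))
    have e2 : (((hD1p n).add (hD2p n)).toLp _ : HalfLineL2) = _ :=
      MemLp.toLp_congr _ (by rw [hDeq]; exact (hD1p n).add (hD2p n))
        (Eventually.of_forall fun r => (congrFun (hDeq n) r).symm)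
    rw [e2]
    exact key
  have lim1 : Tendsto (fun n => (hUp n).toLp (U n)) atTop (𝓝 (hu.toLp u)) := by
    refine tendsto_toLp_of_dominated hUp hu hu.norm ?_ ?_
    · refine fun n => ae_of_all _ fun r => ?_
      rw [hU, norm_mul, Complex.norm_real]
      exact mul_le_of_le_one_left (norm_nonneg _) (hχabs n r)
    · refine ae_of_all _ fun r => tendsto_const_nhds.congr' ?_
      filter_upwards [hχlim r] with n hn
      simp [hU, hn]
  have lim2 : Tendsto (fun n => (hD1p n).toLp (D1 n)) atTop (𝓝 (hd.toLp d)) := by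
    refine tendsto_toLp_of_dominated hD1p hd hd.norm ?_ ?_
    · refine fun n => ae_of_all _ fun r => ?_
      rw [hD1, norm_mul, Complex.norm_real]
      exact mul_le_of_le_one_left (norm_nonneg _) (hχabs n r)
    · refine ae_of_all _ fun r => tendsto_const_nhds.congr' ?_
      filter_upwards [hχlim r] with n hn
      simp [hD1, hn]
  have lim3 : Tendsto (fun n => (hD2p n).toLp (D2 n)) atTop (𝓝 0) := by
    apply tendsto_toLp_zero_of_integral
    set I := ∫ r in Ioi (0 : ℝ), ‖u r‖ ^ 2 with hI
    have hNlim : Tendsto (fun n => (N n)⁻¹) atTop (𝓝 0) := by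
      simpa using tendsto_one_div_add_atTop_nhds_zero_nat (𝕜 := ℝ)
    have hub : Tendsto (fun n => 2 * (M * T) ^ 2 * (N n)⁻¹ + T ^ 2 * I * (N n)⁻¹ ^ 2) atTop (𝓝 0) := by
      have := (hNlim.const_mul (2 * (M * T) ^ 2)).add ((hNlim.pow 2).const_mul (T ^ 2 * I))
      simpa using this
    refine squeeze_zero (fun n => integral_nonneg fun r => sq_nonneg _) (fun n => ?_) hub
    have ha1 : a n ≤ 1 := Real.exp_le_one_iff.2 (by linarith [hN0 n])
    have hi1 : IntegrableOn (fun s : ℝ => (M * T / N n) ^ 2 * s⁻¹) (Ioc (a n) 1) := by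
      have : ContinuousOn (fun s : ℝ => (M * T / N n) ^ 2 * s⁻¹) (Icc (a n) 1) :=
        continuousOn_const.mul (continuousOn_inv₀.mono fun s hs => ((ha0 n).trans_le hs.1).ne')
      exact this.integrableOn_Icc.mono_set Ioc_subset_Icc_self
    have hi1' := (hi1.integrable_indicator measurableSet_Ioc).restrict (s := Ioi (0 : ℝ))
    have hi2 : Integrable (fun r => (T / N n) ^ 2 * ‖u r‖ ^ 2) (volume.restrict (Ioi (0 : ℝ))) :=
      (hu.norm.integrable_sq).const_mul _
    have hle : ∫ r in Ioi (0 : ℝ), ‖D2 n r‖ ^ 2 ≤ ∫ r in Ioi (0 : ℝ),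
        ((Ioc (a n) 1).indicator (fun s : ℝ => (M * T / N n) ^ 2 * s⁻¹) r
          + (T / N n) ^ 2 * ‖u r‖ ^ 2) := by
      refine integral_mono_of_nonneg (ae_of_all _ fun r => sq_nonneg _) (hi1'.add hi2) ?_
      filter_upwards [ae_restrict_mem measurableSet_Ioi] with r hr
      have hr0 : (0 : ℝ) < r := hr
      have hnn : 0 ≤ (Ioc (a n) 1).indicator (fun s : ℝ => (M * T / N n) ^ 2 * s⁻¹) r := by
        refine indicator_nonneg (fun s hs => ?_) r
        have := (ha0 n).trans hs.1; positivity
      have hnn2 : 0 ≤ (T / N n) ^ 2 * ‖u r‖ ^ 2 := by positivity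
      have hDn : ‖D2 n r‖ = |dχ n r| * ‖u r‖ := by rw [hD2, norm_mul, Complex.norm_real]; rfl
      change ‖D2 n r‖ ^ 2 ≤ _
      rw [hDn, mul_pow]
      by_cases hr1 : r ≤ 1
      · by_cases hr2 : a n < r
        · rw [indicator_of_mem (show r ∈ Ioc (a n) 1 from ⟨hr2, hr1⟩)]
          have hu2 : ‖u r‖ ≤ √r * M := by
            rw [hu_def, Complex.norm_real, Real.norm_eq_abs, abs_mul, abs_of_nonneg (hφnn r)]
            exact mul_le_mul (hφle r) (hM r ⟨hr0, hr1⟩) (abs_nonneg _) (Real.sqrt_nonneg _)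
          have h1 : |dχ n r| ^ 2 * ‖u r‖ ^ 2 ≤ (T * (r⁻¹ / N n)) ^ 2 * (√r * M) ^ 2 :=
            mul_le_mul (pow_le_pow_left₀ (abs_nonneg _) (hdχabs n r hr0) 2)
              (pow_le_pow_left₀ (norm_nonneg _) hu2 2) (sq_nonneg _) (sq_nonneg _)
          have h2 : (T * (r⁻¹ / N n)) ^ 2 * (√r * M) ^ 2 = (M * T / N n) ^ 2 * r⁻¹ := by
            rw [mul_pow (√r), Real.sq_sqrt hr0.le]
            field_simp
          linarith
        · have := (hout n r hr0 fun h => hr2 h.1).2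
          rw [this, abs_zero]
          simp only [ne_eq, OfNat.ofNat_ne_zero, not_false_eq_true, zero_pow, zero_mul]
          linarith
      · have h1 : |dχ n r| ≤ T / N n := by
          refine (hdχabs n r hr0).trans ?_
          rw [mul_div_assoc']
          refine div_le_div_of_nonneg_right ?_ (hN0 n).le
          exact mul_le_of_le_one_right hT0 (inv_le_one_of_one_le₀ (not_le.1 hr1).le)
        have h2 : |dχ n r| ^ 2 * ‖u r‖ ^ 2 ≤ (T / N n) ^ 2 * ‖u r‖ ^ 2 :=
          mul_le_mul_of_nonneg_right (pow_le_pow_left₀ (abs_nonneg _) h1 2) (sq_nonneg _)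
        linarith
    have hsub : Ioc (a n) 1 ⊆ Ioi (0 : ℝ) := fun s hs => (ha0 n).trans hs.1
    refine hle.trans (le_of_eq ?_)
    rw [integral_add hi1' hi2, integral_const_mul, ← hI, setIntegral_indicator measurableSet_Ioc,
      inter_eq_self_of_subset_right hsub,
      integral_const_mul, ← intervalIntegral.integral_of_le ha1]
    have hlog : ∫ s in (a n)..1, s⁻¹ = 2 * N n := by
      rw [integral_inv_of_pos (ha0 n) one_pos, one_div, Real.log_inv, ha, Real.log_exp, neg_neg]
    rw [hlog]
    have := (hN0 n).ne'
    field_simp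
  -- `IsClosedGrad` is a statement about the closed space `energySpace`, hence stable under limits
  have h1 : ∀ n, WithLp.toLp 2 (((1 : ℝ) : ℂ) • (hUp n).toLp (U n),
      ((hD1p n).add (hD2p n)).toLp _) ∈ energySpace α 1 := fun n =>
    (mem_energySpace_iff one_pos).2 (hmem n)
  refine (mem_energySpace_iff one_pos).1 ?_
  refine (Submodule.isClosed_topologicalClosure _).mem_of_tendsto (b := atTop) ?_
    (Eventually.of_forall h1)
  refine ((WithLp.prod_continuous_toLp 2 _ _).tendsto _).comp
    ((lim1.const_smul ((1 : ℝ) : ℂ)).prodMk_nhds ?_)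
  have h2 := lim2.add lim3
  rw [add_zero] at h2
  exact h2

/-! ### The Green function built from two solutions -/

/-- The weight `φ²`, where `φ` is the ground state. -/
def weight (α r : ℝ) : ℝ := groundState α r ^ 2

theorem weight_pos (α : ℝ) {r : ℝ} (hr : 0 < r) : 0 < weight α r :=
  pow_pos (groundState_pos α hr) 2

theorem continuous_weight (α : ℝ) : Continuous (weight α) :=
  (continuous_groundState α).pow 2

/-- `f` solves `(w f')' = κ² w f` on `(0, ∞)`, with `f' = df` and `w = φ²`; equivalently `φ f` solves
`T_α (φ f) = -κ² φ f`, jump condition at `r = 1` included. At the kink `r = 1` of `w` only continuity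
of `f` and `f'` is asked for. -/
structure IsSolution (α κ : ℝ) (f df : ℝ → ℝ) : Prop where
  continuousOn : ContinuousOn f (Ioi 0)
  continuousOn_deriv : ContinuousOn df (Ioi 0)
  hasDerivAt : ∀ r, 0 < r → r ≠ 1 → HasDerivAt f (df r) r
  hasDerivAt_flux : ∀ r, 0 < r → r ≠ 1 →
    HasDerivAt (fun s => weight α s * df s) (κ ^ 2 * (weight α r * f r)) r

theorem Core.intervalIntegrable_gradOp (α : ℝ) (η : Core) {a b : ℝ} (ha : 0 < a) (hab : a ≤ b) :
    IntervalIntegrable (gradOp α η) volume a b := by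
  rw [intervalIntegrable_iff_integrableOn_Ioc_of_le hab]
  have h : MemLp (gradOp α η) 2 (volume.restrict (Ioc a b)) :=
    (η.memLp_gradOp α).mono_measure (Measure.restrict_mono (fun s hs => ha.trans hs.1) le_rfl)
  exact h.integrable (by norm_num)

/-- Green's identity on `[a, b]` for a solution and a test function. -/
theorem IsSolution.integral_gradOp {α κ : ℝ} {f df : ℝ → ℝ} (h : IsSolution α κ f df) (η : Core)
    {a b : ℝ} (ha : 0 < a) (hab : a ≤ b) :
    ∫ s in a..b, (((groundState α s * df s : ℝ) : ℂ) * gradOp α η s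
        + (κ : ℂ) ^ 2 * (((groundState α s * f s : ℝ) : ℂ) * η s))
      = ((groundState α b * df b : ℝ) : ℂ) * η b - ((groundState α a * df a : ℝ) : ℂ) * η a := by
  set Q : ℝ → ℂ := fun s => ((weight α s * df s : ℝ) : ℂ) * ((((groundState α s)⁻¹ : ℝ) : ℂ) * η s)
    with hQ
  have hsub : uIcc a b ⊆ Ioi 0 := by
    rw [uIcc_of_le hab]; exact fun s hs => ha.trans_le hs.1
  have hφc : ContinuousOn (fun s => (groundState α s)⁻¹) (Ioi 0) :=
    (continuous_groundState α).continuousOn.inv₀ fun s hs => (groundState_pos α hs).ne'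
  have hval : ∀ s, 0 < s → Q s = ((groundState α s * df s : ℝ) : ℂ) * η s := by
    intro s hs
    have h0 : ((groundState α s : ℝ) : ℂ) ≠ 0 := by exact_mod_cast (groundState_pos α hs).ne'
    simp only [hQ, weight]
    push_cast
    field_simp
  rw [← hval b (ha.trans_le hab), ← hval a ha]
  have hc1 : ContinuousOn (fun s => ((groundState α s * df s : ℝ) : ℂ)) (Ioi 0) :=
    Complex.continuous_ofReal.comp_continuousOn
      ((continuous_groundState α).continuousOn.mul h.continuousOn_deriv)
  have hc2 : ContinuousOn (fun s => ((groundState α s * f s : ℝ) : ℂ)) (Ioi 0) :=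
    Complex.continuous_ofReal.comp_continuousOn
      ((continuous_groundState α).continuousOn.mul h.continuousOn)
  refine integral_eq_of_hasDerivAt_off_countable Q _ (countable_singleton (1 : ℝ)) ?_ ?_ ?_
  · refine ContinuousOn.mono ?_ hsub
    refine (Complex.continuous_ofReal.comp_continuousOn
      ((continuous_weight α).continuousOn.mul h.continuousOn_deriv)).mul
      ((Complex.continuous_ofReal.comp_continuousOn hφc).mul η.continuous.continuousOn)
  · rintro s ⟨hs, hs1⟩
    have hs0 : 0 < s := by
      rw [min_eq_left hab] at hs; exact ha.trans hs.1
    have hφ0 := (groundState_pos α hs0).ne'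
    have h0 : ((groundState α s : ℝ) : ℂ) ≠ 0 := by exact_mod_cast hφ0
    have d1 := (h.hasDerivAt_flux s hs0 hs1).ofReal_comp
    have d2 := ((hasDerivAt_groundState α hs0 hs1).inv hφ0).ofReal_comp
    refine (d1.mul (d2.mul (η.hasDerivAt s))).congr_deriv ?_
    simp only [gradOp, weight, Pi.inv_apply, Pi.mul_apply]
    push_cast
    field_simp
    ring
  · refine ((η.intervalIntegrable_gradOp α ha hab).continuousOn_mul (hc1.mono hsub)).add ?_
    exact (continuousOn_const.mul
      ((hc2.mono hsub).mul η.continuous.continuousOn)).intervalIntegrable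

theorem memLp_Ioc_of_bounded {h : ℝ → ℝ} (hc : ContinuousOn h (Ioi 0)) {M : ℝ}
    (hM : ∀ t ∈ Ioc (0 : ℝ) 1, |h t| ≤ M) (b : ℝ) :
    MemLp (fun r => (h r : ℂ)) 2 (volume.restrict (Ioc 0 b)) := by
  obtain ⟨C, hC⟩ := isCompact_Icc.exists_bound_of_continuousOn
    (hc.mono (fun t ht => one_pos.trans_le ht.1 : Icc (1 : ℝ) b ⊆ Ioi 0))
  refine MemLp.of_bound ?_ (max M C) ?_
  · exact (Complex.continuous_ofReal.comp_continuousOn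
      (hc.mono fun t ht => ht.1)).aestronglyMeasurable measurableSet_Ioc
  · filter_upwards [ae_restrict_mem measurableSet_Ioc] with t ht
    rw [Complex.norm_real, Real.norm_eq_abs]
    rcases le_total t 1 with h1 | h1
    · exact (hM t ⟨ht.1, h1⟩).trans (le_max_left _ _)
    · exact (hC t ⟨h1, ht.2⟩).trans (le_max_right _ _)

/-- A solution that is nonnegative and nonincreasing on `[1, ∞)` has finite energy at infinity, since
`(w v' v)' = w v'² + κ² w v²` and `w v' v ≤ 0`. -/
theorem IsSolution.integrableOn_energy {α κ : ℝ} {v dv : ℝ → ℝ} (h : IsSolution α κ v dv)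
    (hv : ∀ r, 1 ≤ r → 0 ≤ v r) (hdv : ∀ r, 1 ≤ r → dv r ≤ 0) {b : ℝ} (hb : 0 < b) :
    IntegrableOn (fun r => weight α r * dv r ^ 2 + κ ^ 2 * (weight α r * v r ^ 2)) (Ioi b) := by
  have hw := (continuous_weight α).continuousOn (s := Ioi 0)
  have hc : ContinuousOn (fun r => weight α r * dv r ^ 2 + κ ^ 2 * (weight α r * v r ^ 2))
      (Ioi 0) :=
    (hw.mul (h.continuousOn_deriv.pow 2)).add
      (continuousOn_const.mul (hw.mul (h.continuousOn.pow 2)))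
  have hsub : ∀ c, Icc b c ⊆ Ioi 0 := fun c t ht => hb.trans_le ht.1
  refine integrableOn_Ioi_of_intervalIntegral_norm_bounded (-(weight α b * dv b * v b)) b
    (b := fun n : ℕ => (n : ℝ)) ?_ tendsto_natCast_atTop_atTop ?_
  · exact fun n => ((hc.mono (hsub n)).integrableOn_Icc).mono_set Ioc_subset_Icc_self
  · obtain ⟨m, hm⟩ := exists_nat_ge (max b 1)
    filter_upwards [eventually_ge_atTop m] with n hn
    have hmn : (m : ℝ) ≤ n := by exact_mod_cast hn
    have hbn : b ≤ n := (le_max_left _ _).trans (hm.trans hmn)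
    have h1n : (1 : ℝ) ≤ n := (le_max_right _ _).trans (hm.trans hmn)
    have hu : uIcc b (n : ℝ) = Icc b n := uIcc_of_le hbn
    have e1 : ∫ r in b..(n : ℝ), ‖weight α r * dv r ^ 2 + κ ^ 2 * (weight α r * v r ^ 2)‖
        = ∫ r in b..(n : ℝ), (weight α r * dv r ^ 2 + κ ^ 2 * (weight α r * v r ^ 2)) := by
      refine intervalIntegral.integral_congr fun r hr => ?_
      rw [hu] at hr
      have := weight_pos α (hsub _ hr)
      exact Real.norm_of_nonneg (by positivity)
    have e2 : ∫ r in b..(n : ℝ), (weight α r * dv r ^ 2 + κ ^ 2 * (weight α r * v r ^ 2))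
        = weight α n * dv n * v n - weight α b * dv b * v b := by
      refine integral_eq_of_hasDerivAt_off_countable (fun r => weight α r * dv r * v r) _
        (countable_singleton (1 : ℝ)) ?_ ?_ ?_
      · rw [hu]
        exact ((hw.mul h.continuousOn_deriv).mul h.continuousOn).mono (hsub n)
      · rintro s ⟨hs, hs1⟩
        have hs0 : 0 < s := by
          rw [min_eq_left hbn] at hs; exact hb.trans hs.1
        refine ((h.hasDerivAt_flux s hs0 hs1).mul (h.hasDerivAt s hs0 hs1)).congr_deriv ?_
        ring
      · apply ContinuousOn.intervalIntegrable
        rw [hu]; exact hc.mono (hsub n)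
    rw [e1, e2]
    have : weight α n * dv n * v n ≤ 0 := mul_nonpos_of_nonpos_of_nonneg
      (mul_nonpos_of_nonneg_of_nonpos (weight_pos α (one_pos.trans_le h1n)).le (hdv _ h1n))
      (hv _ h1n)
    linarith

theorem IsSolution.memLp_Ioi {α κ : ℝ} (hκ : 0 < κ) {v dv : ℝ → ℝ} (h : IsSolution α κ v dv)
    (hv : ∀ r, 1 ≤ r → 0 ≤ v r) (hdv : ∀ r, 1 ≤ r → dv r ≤ 0) {b : ℝ} (hb : 0 < b) :
    MemLp (fun r => ((groundState α r * v r : ℝ) : ℂ)) 2 (volume.restrict (Ioi b)) ∧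
      MemLp (fun r => ((groundState α r * dv r : ℝ) : ℂ)) 2 (volume.restrict (Ioi b)) := by
  have hE := h.integrableOn_energy hv hdv hb
  have hsub : Ioi b ⊆ Ioi 0 := Ioi_subset_Ioi hb.le
  have hmeas : ∀ g : ℝ → ℝ, ContinuousOn g (Ioi 0) →
      AEStronglyMeasurable (fun r => groundState α r * g r) (volume.restrict (Ioi b)) := by
    intro g hg
    exact (((continuous_groundState α).continuousOn.mul hg).mono hsub).aestronglyMeasurable
      measurableSet_Ioi
  constructor
  · refine MemLp.ofReal ((memLp_two_iff_integrable_sq (hmeas v h.continuousOn)).2 ?_)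
    refine (hE.const_mul (κ ^ 2)⁻¹).mono' ((hmeas v h.continuousOn).pow 2) ?_
    filter_upwards [ae_restrict_mem measurableSet_Ioi] with r hr
    have := weight_pos α (hb.trans hr)
    rw [Real.norm_of_nonneg (sq_nonneg _), mul_pow, mul_add, inv_mul_cancel_left₀ (by positivity)]
    exact le_add_of_nonneg_left (by positivity)
  · refine MemLp.ofReal ((memLp_two_iff_integrable_sq (hmeas dv h.continuousOn_deriv)).2 ?_)
    refine hE.mono' ((hmeas dv h.continuousOn_deriv).pow 2) ?_
    filter_upwards [ae_restrict_mem measurableSet_Ioi] with r hr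
    have := weight_pos α (hb.trans hr)
    rw [Real.norm_of_nonneg (sq_nonneg _), mul_pow]
    exact le_add_of_nonneg_right (by positivity)

/-- The function `φ(r) φ(s) u(min r s) v(max r s)`. -/
def greenFun (α : ℝ) (u v : ℝ → ℝ) (r s : ℝ) : ℝ :=
  groundState α r * groundState α s * (u (min r s) * v (max r s))

theorem greenFun_comm (α : ℝ) (u v : ℝ → ℝ) (r s : ℝ) :
    greenFun α u v r s = greenFun α u v s r := by
  rw [greenFun, greenFun, min_comm, max_comm, mul_comm (groundState α r)]

theorem greenFun_of_le (α : ℝ) (u v : ℝ → ℝ) {r s : ℝ} (h : r ≤ s) :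
    greenFun α u v r s = groundState α r * groundState α s * (u r * v s) := by
  rw [greenFun, min_eq_left h, max_eq_right h]

theorem memLp_glue {r : ℝ} (hr : 0 < r) {f g : ℝ → ℂ}
    (hf : MemLp f 2 (volume.restrict (Ioc 0 r))) (hg : MemLp g 2 (volume.restrict (Ioi r))) :
    MemLp (fun s => if s ≤ r then f s else g s) 2 (volume.restrict (Ioi (0 : ℝ))) := by
  have h := MemLp.piecewise (μ := volume.restrict (Ioi (0 : ℝ))) (s := Iic r) (f := f) (g := g)
    (p := 2) measurableSet_Iic ?_ ?_
  · exact h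
  · rwa [Measure.restrict_restrict measurableSet_Iic, inter_comm, Ioi_inter_Iic]
  · rwa [Measure.restrict_restrict measurableSet_Iic.compl, compl_Iic, inter_eq_left.2]
    exact Ioi_subset_Ioi hr.le

/-- If `u` is a solution that is regular at `0`, `v` one that decays at infinity, and their weighted
Wronskian is `1`, then `φ(r) φ(s) u(min r s) v(max r s)` is the kernel of the resolvent. -/
theorem isResolventKernel_greenFun {α κ M : ℝ} (hα : 0 ≤ α) (hκ : 0 < κ) {u du v dv : ℝ → ℝ}
    (hu : IsSolution α κ u du) (hv : IsSolution α κ v dv)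
    (huM : ∀ t ∈ Ioc (0 : ℝ) 1, |u t| ≤ M) (hduM : ∀ t ∈ Ioc (0 : ℝ) 1, |du t| ≤ M)
    (hvpos : ∀ r, 1 ≤ r → 0 ≤ v r) (hdv : ∀ r, 1 ≤ r → dv r ≤ 0)
    (hW : ∀ r, 0 < r → weight α r * (du r * v r - u r * dv r) = 1) :
    IsResolventKernel α κ fun r s => (greenFun α u v r s : ℂ) := by
  have hφc := continuous_groundState α
  refine ⟨?_, resolventOp α κ, isResolvent_resolventOp hκ, ?_⟩
  · refine Complex.continuous_ofReal.comp_continuousOn (f := Function.uncurry (greenFun α u v)) ?_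
    have h1 : ContinuousOn (fun p : ℝ × ℝ => u (min p.1 p.2)) (Ioi 0 ×ˢ Ioi 0) :=
      hu.continuousOn.comp (by fun_prop) fun p hp => mem_Ioi.2 (lt_min hp.1 hp.2)
    have h2 : ContinuousOn (fun p : ℝ × ℝ => v (max p.1 p.2)) (Ioi 0 ×ˢ Ioi 0) :=
      hv.continuousOn.comp (by fun_prop) fun p hp => mem_Ioi.2 (lt_max_of_lt_left hp.1)
    exact (((hφc.comp continuous_fst).mul (hφc.comp continuous_snd)).continuousOn).mul (h1.mul h2)
  · refine isIntegralKernel_of_reproducing (isResolvent_resolventOp hκ)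
      (fun r s => Complex.conj_ofReal _) fun r hr => ?_
    set c := groundState α r with hc
    set f : ℝ → ℝ := fun s => if s ≤ r then c * v r * u s else c * u r * v s with hf
    set df : ℝ → ℝ := fun s => if s ≤ r then c * v r * du s else c * u r * dv s with hdf
    have hGf : (fun s => (greenFun α u v r s : ℂ)) = fun s => ((groundState α s * f s : ℝ) : ℂ) := by
      ext s
      congr 1
      simp only [hf]
      split_ifs with h
      · rw [greenFun_comm, greenFun_of_le _ _ _ h]; ring
      · rw [greenFun_of_le _ _ _ (not_le.1 h).le]; ring
    have hφ1 : ∀ t ∈ Ioc (0 : ℝ) 1, |groundState α t| ≤ 1 := fun t ht => by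
      rw [groundState_of_le_one α ht.2, abs_of_nonneg (Real.sqrt_nonneg _)]
      exact Real.sqrt_le_one.2 ht.2
    have hbd : ∀ g : ℝ → ℝ, (∀ t ∈ Ioc (0 : ℝ) 1, |g t| ≤ M) →
        ∀ t ∈ Ioc (0 : ℝ) 1, |groundState α t * g t| ≤ M := fun g hg t ht => by
      rw [abs_mul]
      exact (mul_le_of_le_one_left (abs_nonneg _) (hφ1 t ht)).trans (hg t ht)
    obtain ⟨hv1, hv2⟩ := hv.memLp_Ioi hκ hvpos hdv hr
    have hu1 := memLp_Ioc_of_bounded (hφc.continuousOn.mul hu.continuousOn) (hbd u huM) r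
    have hu2 := memLp_Ioc_of_bounded (hφc.continuousOn.mul hu.continuousOn_deriv) (hbd du hduM) r
    have hfL : MemLp (fun s => ((groundState α s * f s : ℝ) : ℂ)) 2
        (volume.restrict (Ioi (0 : ℝ))) := by
      refine (memLp_glue hr (hu1.const_mul ((c * v r : ℝ) : ℂ))
        (hv1.const_mul ((c * u r : ℝ) : ℂ))).ae_eq (ae_of_all _ fun s => ?_)
      simp only [hf, Pi.mul_apply]
      split_ifs <;> push_cast <;> ring
    have hdfL : MemLp (fun s => ((groundState α s * df s : ℝ) : ℂ)) 2
        (volume.restrict (Ioi (0 : ℝ))) := by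
      refine (memLp_glue hr (hu2.const_mul ((c * v r : ℝ) : ℂ))
        (hv2.const_mul ((c * u r : ℝ) : ℂ))).ae_eq (ae_of_all _ fun s => ?_)
      simp only [hdf, Pi.mul_apply]
      split_ifs <;> push_cast <;> ring
    have hdom : IsClosedGrad α (hfL.toLp _) (hdfL.toLp _) := by
      obtain ⟨Mv, hMv⟩ := isCompact_Icc.exists_bound_of_continuousOn
        (hv.continuousOn.mono (fun t ht => hr.trans_le ht.1 : Icc r 1 ⊆ Ioi 0))
      refine isClosedGrad_groundState_mul (S := {1, r})
        (M := max (|c * v r| * M) (|c * u r| * Mv)) hα ?_ ((countable_singleton r).insert 1)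
        ?_ ?_ ?_ hfL hdfL
      · have h1 : ContinuousOn (fun s => u (min s r)) (Ioi 0) :=
          hu.continuousOn.comp (by fun_prop) fun s hs => mem_Ioi.2 (lt_min hs hr)
        have h2 : ContinuousOn (fun s => v (max s r)) (Ioi 0) :=
          hv.continuousOn.comp (by fun_prop) fun s hs => mem_Ioi.2 (lt_max_of_lt_left hs)
        refine (continuousOn_const.mul (h1.mul h2) (f := fun _ => c)).congr fun s _ => ?_
        simp only [hf, Pi.mul_apply]
        split_ifs with h
        · rw [min_eq_left h, max_eq_right h]; ring
        · rw [min_eq_right (not_le.1 h).le, max_eq_left (not_le.1 h).le]; ring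
      · intro t ht htS
        simp only [mem_insert_iff, mem_singleton_iff, not_or] at htS
        rcases lt_or_gt_of_ne htS.2 with h | h
        · have e : f =ᶠ[𝓝 t] fun s => c * v r * u s := by
            filter_upwards [Iio_mem_nhds h] with s hs
            exact if_pos (le_of_lt hs)
          have : df t = c * v r * du t := if_pos h.le
          rw [this]
          exact ((hu.hasDerivAt t ht htS.1).const_mul _).congr_of_eventuallyEq e
        · have e : f =ᶠ[𝓝 t] fun s => c * u r * v s := by
            filter_upwards [Ioi_mem_nhds h] with s hs
            exact if_neg (not_le.2 hs)
          have : df t = c * u r * dv t := if_neg (not_le.2 h)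
          rw [this]
          exact ((hv.hasDerivAt t ht htS.1).const_mul _).congr_of_eventuallyEq e
      · intro a b ha
        have hsub : Icc a b ⊆ Ioi 0 := fun t ht => ha.trans_le ht.1
        obtain ⟨L1, hL1⟩ := isCompact_Icc.exists_bound_of_continuousOn
          (hu.continuousOn_deriv.mono hsub)
        obtain ⟨L2, hL2⟩ := isCompact_Icc.exists_bound_of_continuousOn
          (hv.continuousOn_deriv.mono hsub)
        refine ⟨max (|c * v r| * L1) (|c * u r| * L2), fun t ht => ?_⟩
        simp only [hdf]
        split_ifs
        · rw [abs_mul]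
          exact (mul_le_mul_of_nonneg_left (hL1 t ht) (abs_nonneg _)).trans (le_max_left _ _)
        · rw [abs_mul]
          exact (mul_le_mul_of_nonneg_left (hL2 t ht) (abs_nonneg _)).trans (le_max_right _ _)
      · intro t ht
        simp only [hf]
        split_ifs with h
        · rw [abs_mul]
          exact (mul_le_mul_of_nonneg_left (huM t ht) (abs_nonneg _)).trans (le_max_left _ _)
        · rw [abs_mul]
          exact (mul_le_mul_of_nonneg_left (hMv t ⟨(not_le.1 h).le, ht.2⟩) (abs_nonneg _)).trans
            (le_max_right _ _)
    have hGL : MemLp (fun s => (greenFun α u v r s : ℂ)) 2 (volume.restrict (Ioi (0 : ℝ))) := by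
      rw [hGf]; exact hfL
    have hGeq : hGL.toLp _ = hfL.toLp _ := MemLp.toLp_congr _ _ (ae_of_all _ (congrFun hGf))
    refine ⟨hGL, hdfL.toLp _, by rw [hGeq]; exact hdom, fun η => ?_⟩
    rw [hGeq, Core.gradL2, Core.toL2, inner_toLp, inner_toLp]
    simp only [Complex.conj_ofReal]
    have i1 : IntegrableOn (fun s => ((groundState α s * df s : ℝ) : ℂ) * gradOp α η s) (Ioi 0) :=
      hdfL.integrable_mul (η.memLp_gradOp α)
    have i2 : IntegrableOn (fun s => (κ : ℂ) ^ 2 * (((groundState α s * f s : ℝ) : ℂ) * η s))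
        (Ioi 0) := (hfL.integrable_mul (Core.memLp η)).const_mul _
    rw [← integral_const_mul, ← integral_add i1 i2]
    set J : ℝ → ℂ := fun s => ((groundState α s * df s : ℝ) : ℂ) * gradOp α η s
      + (κ : ℂ) ^ 2 * (((groundState α s * f s : ℝ) : ℂ) * η s) with hJ
    have iJ : IntegrableOn J (Ioi 0) := i1.add i2
    obtain ⟨a₀, b₀, ha₀, -, -, hsupp⟩ := η.exists_support_Icc
    set a := min (a₀ / 2) (r / 2) with ha_def
    set b := max (b₀ + 1) (r + 1) with hb_def
    have ha : 0 < a := by positivity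
    have har : a ≤ r := (min_le_right _ _).trans (by linarith)
    have hrb : r ≤ b := le_trans (by linarith) (le_max_right _ _)
    have haz : η a = 0 := image_eq_zero_of_notMem_tsupport fun h => by
      have h1 := (hsupp h).1
      have h2 : a ≤ a₀ / 2 := min_le_left _ _
      linarith
    have hbz : η b = 0 := image_eq_zero_of_notMem_tsupport fun h => by
      have h1 := (hsupp h).2
      have h2 : b₀ + 1 ≤ b := le_max_left _ _
      linarith
    have hJ0 : ∀ s ∈ Ioi 0 \ Ioc a b, J s = 0 := by
      rintro s ⟨-, hs⟩
      have hs' : s ∉ tsupport η := fun h => hs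
        ⟨lt_of_le_of_lt (min_le_left _ _) (by linarith [(hsupp h).1]),
          le_trans (by linarith [(hsupp h).2]) (le_max_left _ _)⟩
      have h1 : η s = 0 := image_eq_zero_of_notMem_tsupport hs'
      have h2 : deriv η s = 0 :=
        image_eq_zero_of_notMem_tsupport fun h => hs' (tsupport_deriv_subset h)
      simp [hJ, gradOp, h1, h2]
    have hsub : Ioc a b ⊆ Ioi 0 := fun s hs => ha.trans hs.1
    rw [setIntegral_eq_of_subset_of_forall_sdiff_eq_zero measurableSet_Ioi hsub hJ0,
      ← Ioc_union_Ioc_eq_Ioc har hrb, setIntegral_union (by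
        rw [Set.disjoint_left]; intro s hs hs'; exact absurd hs.2 (not_le.2 hs'.1)) measurableSet_Ioc
        (iJ.mono_set fun s hs => ha.trans hs.1) (iJ.mono_set fun s hs => hr.trans hs.1)]
    have e1 : ∫ s in Ioc a r, J s = ((c * v r : ℝ) : ℂ) * (((groundState α r * du r : ℝ) : ℂ) * η r) := by
      have := hu.integral_gradOp η ha har
      rw [haz, mul_zero, sub_zero, intervalIntegral.integral_of_le har] at this
      rw [← this, ← integral_const_mul]
      refine setIntegral_congr_fun measurableSet_Ioc fun s hs => ?_
      simp only [hJ, hf, hdf, if_pos hs.2]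
      push_cast; ring
    have e2 : ∫ s in Ioc r b, J s = ((c * u r : ℝ) : ℂ) * (-(((groundState α r * dv r : ℝ) : ℂ) * η r)) := by
      have := hv.integral_gradOp η hr hrb
      rw [hbz, mul_zero, zero_sub, intervalIntegral.integral_of_le hrb] at this
      rw [← this, ← integral_const_mul]
      refine setIntegral_congr_fun measurableSet_Ioc fun s hs => ?_
      simp only [hJ, hf, hdf, if_neg (not_le.2 hs.1)]
      push_cast; ring
    rw [e1, e2]
    have hWr : ((weight α r * (du r * v r - u r * dv r) : ℝ) : ℂ) = 1 := by
      rw [hW r hr]; norm_num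
    rw [weight, ← hc] at hWr
    rw [← hc]
    calc _ = ((c ^ 2 * (du r * v r - u r * dv r) : ℝ) : ℂ) * η r := by push_cast; ring
      _ = η r := by rw [hWr, one_mul]

/-! ### Macdonald functions -/

/-- The integrand `e^(-t - z/t) t^(s-1)`. -/
def macdonaldIntegrand (s z t : ℝ) : ℝ := Real.exp (-t - z / t) * t ^ (s - 1)

/-- The integral `∫₀^∞ e^(-t - z/t) t^(s-1) dt`, which is `2 z^(s/2) K_s(2√z)` in terms of the
modified Bessel function `K_s`. -/
def macdonald (s z : ℝ) : ℝ := ∫ t in Ioi (0 : ℝ), macdonaldIntegrand s z t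

theorem continuousOn_macdonaldIntegrand (s z : ℝ) :
    ContinuousOn (macdonaldIntegrand s z) (Ioi 0) := by
  unfold macdonaldIntegrand
  refine ContinuousOn.mul ?_ ?_
  · refine Real.continuous_exp.comp_continuousOn (continuousOn_id.neg.sub ?_)
    exact continuousOn_const.div continuousOn_id fun t ht => (mem_Ioi.1 ht).ne'
  · exact continuousOn_id.rpow_const fun t ht => Or.inl (mem_Ioi.1 ht).ne'

theorem macdonaldIntegrand_pos (s z : ℝ) {t : ℝ} (ht : 0 < t) : 0 < macdonaldIntegrand s z t :=
  mul_pos (Real.exp_pos _) (Real.rpow_pos_of_pos ht _)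

theorem macdonaldIntegrand_le_pow (s : ℝ) {z t : ℝ} (hz : 0 < z) (ht : 0 < t) (n : ℕ) :
    macdonaldIntegrand s z t ≤
      ((n.factorial : ℝ) / z ^ n) * (Real.exp (-t) * t ^ ((s + n) - 1)) := by
  have h1 : Real.exp (-(z / t)) ≤ n.factorial / z ^ n * t ^ n := by
    have h := Real.pow_div_factorial_le_exp (z / t) (div_pos hz ht).le n
    have hf : (0 : ℝ) < n.factorial := by exact_mod_cast n.factorial_pos
    rw [Real.exp_neg]
    have h2 : 0 < (z / t) ^ n / n.factorial := by positivity
    calc (Real.exp (z / t))⁻¹ ≤ ((z / t) ^ n / n.factorial)⁻¹ := inv_anti₀ h2 h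
      _ = n.factorial / z ^ n * t ^ n := by rw [div_pow]; field_simp
  have h3 : t ^ ((s + n) - 1) = t ^ (s - 1) * t ^ n := by
    rw [← Real.rpow_natCast, ← Real.rpow_add ht]; ring_nf
  rw [macdonaldIntegrand, sub_eq_add_neg, Real.exp_add, h3]
  have h4 : 0 < Real.exp (-t) * t ^ (s - 1) := mul_pos (Real.exp_pos _) (Real.rpow_pos_of_pos ht _)
  calc Real.exp (-t) * Real.exp (-(z / t)) * t ^ (s - 1)
      = Real.exp (-(z / t)) * (Real.exp (-t) * t ^ (s - 1)) := by ring
    _ ≤ (n.factorial / z ^ n * t ^ n) * (Real.exp (-t) * t ^ (s - 1)) :=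
        mul_le_mul_of_nonneg_right h1 h4.le
    _ = _ := by ring

theorem integrableOn_macdonaldIntegrand (s : ℝ) {z : ℝ} (hz : 0 < z) :
    IntegrableOn (macdonaldIntegrand s z) (Ioi 0) := by
  obtain ⟨n, hn⟩ := exists_nat_gt (-s)
  have h := (Real.GammaIntegral_convergent (show 0 < s + n by linarith)).const_mul
    ((n.factorial : ℝ) / z ^ n)
  refine h.mono' ((continuousOn_macdonaldIntegrand s z).aestronglyMeasurable measurableSet_Ioi) ?_
  filter_upwards [ae_restrict_mem measurableSet_Ioi] with t ht
  rw [Real.norm_of_nonneg (macdonaldIntegrand_pos s z ht).le]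
  exact macdonaldIntegrand_le_pow s hz ht n

theorem setIntegral_Ioi_pos {f : ℝ → ℝ} (hf : IntegrableOn f (Ioi 0)) (h : ∀ t, 0 < t → 0 < f t) :
    0 < ∫ t in Ioi (0 : ℝ), f t := by
  rw [setIntegral_pos_iff_support_of_nonneg_ae]
  · have : Function.support f ∩ Ioi 0 = Ioi 0 :=
      inter_eq_right.2 fun t ht => (h t ht).ne'
    rw [this, Real.volume_Ioi]
    exact ENNReal.zero_lt_top
  · filter_upwards [ae_restrict_mem measurableSet_Ioi] with t ht using (h t ht).le
  · exact hf

theorem macdonald_pos (s : ℝ) {z : ℝ} (hz : 0 < z) : 0 < macdonald s z :=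
  setIntegral_Ioi_pos (integrableOn_macdonaldIntegrand s hz) fun _ ht => macdonaldIntegrand_pos s z ht

theorem hasDerivAt_macdonald (s : ℝ) {z : ℝ} (hz : 0 < z) :
    HasDerivAt (macdonald s) (-macdonald (s - 1) z) z := by
  have h := hasDerivAt_integral_of_dominated_loc_of_deriv_le
    (μ := volume.restrict (Ioi (0 : ℝ))) (F := macdonaldIntegrand s)
    (F' := fun x t => -macdonaldIntegrand (s - 1) x t) (x₀ := z) (s := Ioi (z / 2))
    (bound := macdonaldIntegrand (s - 1) (z / 2)) (Ioi_mem_nhds (by linarith)) ?_ ?_ ?_ ?_ ?_ ?_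
  · have := h.2
    rwa [integral_neg] at this
  · exact Eventually.of_forall fun x =>
      (continuousOn_macdonaldIntegrand s x).aestronglyMeasurable measurableSet_Ioi
  · exact integrableOn_macdonaldIntegrand s hz
  · exact ((continuousOn_macdonaldIntegrand (s - 1) z).aestronglyMeasurable measurableSet_Ioi).neg
  · filter_upwards [ae_restrict_mem measurableSet_Ioi] with t ht x hx
    have ht0 : (0 : ℝ) < t := ht
    rw [norm_neg, Real.norm_of_nonneg (macdonaldIntegrand_pos _ _ ht0).le]
    refine mul_le_mul_of_nonneg_right (Real.exp_le_exp.2 ?_) (Real.rpow_pos_of_pos ht0 _).le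
    have : z / 2 / t ≤ x / t := div_le_div_of_nonneg_right (le_of_lt hx) ht0.le
    linarith
  · exact integrableOn_macdonaldIntegrand (s - 1) (half_pos hz)
  · filter_upwards [ae_restrict_mem measurableSet_Ioi] with t ht x _
    have ht0 : (0 : ℝ) < t := ht
    have h1 : HasDerivAt (fun y => -t - y / t) (-(1 / t)) x := by
      have := ((hasDerivAt_id x).div_const t).const_sub (-t)
      simpa using this
    refine (h1.exp.mul_const (t ^ (s - 1))).congr_deriv ?_
    rw [macdonaldIntegrand, show s - 1 - 1 = (s - 1) - 1 by ring, Real.rpow_sub_one ht0.ne' (s - 1)]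
    ring

/-- The three-term recurrence, from `∫₀^∞ d/dt (e^(-t - z/t) t^(s-1)) dt = 0`. -/
theorem macdonald_recurrence (s : ℝ) {z : ℝ} (hz : 0 < z) :
    macdonald s z = (s - 1) * macdonald (s - 1) z + z * macdonald (s - 2) z := by
  have hi0 := integrableOn_macdonaldIntegrand s hz
  have hi1 := integrableOn_macdonaldIntegrand (s - 1) hz
  have hi2 := integrableOn_macdonaldIntegrand (s - 2) hz
  set e : ℝ → ℝ := fun t => Real.exp (-t - z / t) with he
  set p : ℝ → ℝ := fun t => t ^ (s - 1) with hp
  have hed : ∀ t ∈ Ioi (0 : ℝ), HasDerivAt e (e t * (-1 + z / t ^ 2)) t := by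
    intro t ht
    have ht0 : t ≠ 0 := (mem_Ioi.1 ht).ne'
    have h1 : HasDerivAt (fun y => -y - z / y) (-1 + z / t ^ 2) t := by
      have := (hasDerivAt_id t).neg.sub ((hasDerivAt_inv ht0).const_mul z)
      refine this.congr_deriv ?_
      field_simp
      ring
    exact h1.exp
  have hpd : ∀ t ∈ Ioi (0 : ℝ), HasDerivAt p ((s - 1) * t ^ (s - 1 - 1)) t := fun t ht =>
    Real.hasDerivAt_rpow_const (Or.inl (mem_Ioi.1 ht).ne')
  have hpt : ∀ t ∈ Ioi (0 : ℝ), e t * (-1 + z / t ^ 2) * p t + e t * ((s - 1) * t ^ (s - 1 - 1))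
      = -macdonaldIntegrand s z t + z * macdonaldIntegrand (s - 2) z t
        + (s - 1) * macdonaldIntegrand (s - 1) z t := by
    intro t ht
    have ht0 : t ≠ 0 := (mem_Ioi.1 ht).ne'
    simp only [macdonaldIntegrand, he, hp]
    rw [show s - 2 - 1 = s - 1 - 1 - 1 by ring, Real.rpow_sub_one ht0 (s - 1 - 1),
      Real.rpow_sub_one ht0 (s - 1)]
    field_simp
  have hint : IntegrableOn (fun t => -macdonaldIntegrand s z t
      + z * macdonaldIntegrand (s - 2) z t + (s - 1) * macdonaldIntegrand (s - 1) z t) (Ioi 0) :=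
    (hi0.neg.add (hi2.const_mul z)).add (hi1.const_mul (s - 1))
  obtain ⟨n, hn⟩ := exists_nat_gt (1 - s)
  have h0 : Tendsto (e * p) (𝓝[>] 0) (𝓝 0) := by
    set c := (n.factorial : ℝ) / z ^ n
    have hlim : Tendsto (fun t : ℝ => c * (Real.exp (-t) * t ^ ((s + n) - 1))) (𝓝[>] 0) (𝓝 0) := by
      have hc : ContinuousAt (fun t : ℝ => c * (Real.exp (-t) * t ^ ((s + n) - 1))) 0 := by
        refine continuousAt_const.mul ((by fun_prop : ContinuousAt (fun t : ℝ => Real.exp (-t)) 0).mul ?_)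
        exact Real.continuousAt_rpow_const _ _ (Or.inr (by linarith))
      have := hc.tendsto.mono_left (nhdsWithin_le_nhds (s := Ioi (0 : ℝ)))
      rwa [Real.zero_rpow (by linarith), mul_zero, mul_zero] at this
    refine squeeze_zero' ?_ ?_ hlim
    · filter_upwards [self_mem_nhdsWithin] with t ht using (macdonaldIntegrand_pos s z ht).le
    · filter_upwards [self_mem_nhdsWithin] with t ht using macdonaldIntegrand_le_pow s hz ht n
  have hinf : Tendsto (e * p) atTop (𝓝 0) := by
    have hlim := tendsto_rpow_mul_exp_neg_mul_atTop_nhds_zero (s - 1) 1 one_pos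
    refine squeeze_zero' ?_ ?_ hlim
    · filter_upwards [eventually_gt_atTop 0] with t ht using (macdonaldIntegrand_pos s z ht).le
    · filter_upwards [eventually_gt_atTop 0] with t ht
      simp only [Pi.mul_apply, he, hp]
      rw [mul_comm]
      refine mul_le_mul_of_nonneg_left (Real.exp_le_exp.2 ?_) (Real.rpow_pos_of_pos ht _).le
      have : 0 < z / t := div_pos hz ht
      linarith
  have key := integral_Ioi_deriv_mul_eq_sub hed hpd
    (hint.congr_fun (fun t ht => (hpt t ht).symm) measurableSet_Ioi) h0 hinf
  rw [setIntegral_congr_fun measurableSet_Ioi hpt,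
    integral_add (by exact hi0.neg.add (hi2.const_mul z)) (hi1.const_mul (s - 1)),
    integral_add (by exact hi0.neg) (hi2.const_mul z), integral_neg, integral_const_mul,
    integral_const_mul] at key
  simp only [macdonald]
  linarith

theorem macdonald_le_Gamma {s z : ℝ} (hs : 0 < s) (hz : 0 < z) : macdonald s z ≤ Real.Gamma s := by
  rw [Real.Gamma_eq_integral hs]
  refine setIntegral_mono_on (integrableOn_macdonaldIntegrand s hz)
    (Real.GammaIntegral_convergent hs) measurableSet_Ioi fun t ht => ?_
  refine mul_le_mul_of_nonneg_right (Real.exp_le_exp.2 ?_) (Real.rpow_pos_of_pos ht _).le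
  have : 0 < z / t := div_pos hz ht
  linarith

theorem macdonald_zero_le {p z : ℝ} (hp : 0 < p) (hp1 : p ≤ 1) (hz : 0 < z) :
    macdonald 0 z ≤ z ^ (-p) * Real.Gamma p := by
  rw [Real.Gamma_eq_integral hp, ← integral_const_mul]
  refine setIntegral_mono_on (integrableOn_macdonaldIntegrand 0 hz)
    ((Real.GammaIntegral_convergent hp).const_mul _) measurableSet_Ioi fun t ht => ?_
  have ht0 : (0 : ℝ) < t := ht
  have hx : 0 < z / t := div_pos hz ht0
  -- `e^(-x) ≤ x^(-p)` for `0 ≤ p ≤ 1`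
  have h1 : Real.exp (-(z / t)) ≤ z ^ (-p) * t ^ p := by
    have h2 : (z / t) ^ p ≤ Real.exp (z / t) := by
      rcases le_total (z / t) 1 with h | h
      · exact (Real.rpow_le_one hx.le h hp.le).trans (Real.one_le_exp hx.le)
      · calc (z / t) ^ p ≤ (z / t) ^ (1 : ℝ) := Real.rpow_le_rpow_of_exponent_le h hp1
          _ = z / t := Real.rpow_one _
          _ ≤ Real.exp (z / t) := by linarith [Real.add_one_le_exp (z / t)]
    rw [Real.exp_neg]
    calc (Real.exp (z / t))⁻¹ ≤ ((z / t) ^ p)⁻¹ := inv_anti₀ (Real.rpow_pos_of_pos hx _) h2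
      _ = z ^ (-p) * t ^ p := by
        rw [Real.div_rpow hz.le ht0.le, inv_div, Real.rpow_neg hz.le]; ring
  rw [macdonaldIntegrand, sub_eq_add_neg, Real.exp_add, zero_sub]
  have h3 : t ^ (p - 1) = t ^ p * t ^ (-1 : ℝ) := by rw [← Real.rpow_add ht0]; ring_nf
  rw [h3]
  have h4 : 0 < Real.exp (-t) * t ^ (-1 : ℝ) := mul_pos (Real.exp_pos _) (Real.rpow_pos_of_pos ht0 _)
  nlinarith [mul_le_mul_of_nonneg_right h1 h4.le]

/-- The function `x ↦ 2^(1-ν) x^ν K_ν(x)`, in terms of the modified Bessel function `K_ν`. -/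
def besselK (ν x : ℝ) : ℝ := macdonald ν (x ^ 2 / 4)

/-- The derivative of `besselK`. -/
def besselKDeriv (ν x : ℝ) : ℝ := -(x / 2 * macdonald (ν - 1) (x ^ 2 / 4))

theorem besselK_pos (ν : ℝ) {x : ℝ} (hx : 0 < x) : 0 < besselK ν x :=
  macdonald_pos ν (by positivity)

theorem besselKDeriv_neg (ν : ℝ) {x : ℝ} (hx : 0 < x) : besselKDeriv ν x < 0 :=
  neg_neg_of_pos (mul_pos (half_pos hx) (macdonald_pos _ (by positivity)))

theorem hasDerivAt_sq_div_four (x : ℝ) : HasDerivAt (fun y : ℝ => y ^ 2 / 4) (x / 2) x := by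
  refine ((hasDerivAt_pow 2 x).div_const 4).congr_deriv ?_
  norm_num
  ring

theorem hasDerivAt_besselK (ν : ℝ) {x : ℝ} (hx : 0 < x) :
    HasDerivAt (besselK ν) (besselKDeriv ν x) x := by
  refine ((hasDerivAt_macdonald ν (z := x ^ 2 / 4) (by positivity)).comp x
    (hasDerivAt_sq_div_four x)).congr_deriv ?_
  rw [besselKDeriv]; ring

theorem hasDerivAt_besselKDeriv (ν : ℝ) {x : ℝ} (hx : 0 < x) :
    HasDerivAt (besselKDeriv ν) (besselK ν x - (1 - 2 * ν) / x * besselKDeriv ν x) x := by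
  have h1 := (hasDerivAt_macdonald (ν - 1) (z := x ^ 2 / 4) (by positivity)).comp x
    (hasDerivAt_sq_div_four x)
  have h2 := (((hasDerivAt_id x).div_const 2).mul h1).neg
  refine h2.congr_deriv ?_
  rw [besselK, besselKDeriv, macdonald_recurrence ν (z := x ^ 2 / 4) (by positivity),
    show ν - 1 - 1 = ν - 2 by ring]
  simp only [Function.comp_apply, id_eq]
  field_simp
  ring

/-- The modified Bessel equation, in divergence form. -/
theorem hasDerivAt_besselK_flux (ν : ℝ) {x : ℝ} (hx : 0 < x) :
    HasDerivAt (fun y => y ^ (1 - 2 * ν) * besselKDeriv ν y) (x ^ (1 - 2 * ν) * besselK ν x) x := by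
  refine ((Real.hasDerivAt_rpow_const (p := 1 - 2 * ν) (Or.inl hx.ne')).mul
    (hasDerivAt_besselKDeriv ν hx)).congr_deriv ?_
  rw [Real.rpow_sub_one hx.ne']
  field_simp
  ring

/-! ### The regular solution near the origin -/

/-- The function `π I₀(x) = ∫₀^π cosh(x cos θ) dθ`. -/
def besselI (x : ℝ) : ℝ := ∫ θ in (0 : ℝ)..Real.pi, Real.cosh (x * Real.cos θ)

/-- The derivative of `besselI`. -/
def besselIDeriv (x : ℝ) : ℝ := ∫ θ in (0 : ℝ)..Real.pi, Real.cos θ * Real.sinh (x * Real.cos θ)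

theorem hasDerivAt_intervalIntegral_param {F F' : ℝ → ℝ → ℝ}
    (hF : Continuous (Function.uncurry F)) (hF' : Continuous (Function.uncurry F'))
    (h : ∀ x t, HasDerivAt (fun y => F y t) (F' x t) x) (a b x : ℝ) :
    HasDerivAt (fun y => ∫ t in a..b, F y t) (∫ t in a..b, F' x t) x := by
  obtain ⟨C, hC⟩ := ((isCompact_closedBall x 1).prod (isCompact_uIcc (a := a) (b := b))
    ).exists_bound_of_continuousOn hF'.continuousOn
  refine (intervalIntegral.hasDerivAt_integral_of_dominated_loc_of_deriv_le
    (F := F) (F' := F') (bound := fun _ => C) (Metric.closedBall_mem_nhds x one_pos) ?_ ?_ ?_ ?_ ?_ ?_).2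
  · exact Eventually.of_forall fun y =>
      (hF.comp (Continuous.prodMk_right y)).aestronglyMeasurable
  · exact (hF.comp (Continuous.prodMk_right x)).intervalIntegrable _ _
  · exact (hF'.comp (Continuous.prodMk_right x)).aestronglyMeasurable
  · exact ae_of_all _ fun t ht y hy => hC (y, t) ⟨hy, uIoc_subset_uIcc ht⟩
  · exact intervalIntegrable_const
  · exact ae_of_all _ fun t _ y _ => h y t

theorem hasDerivAt_mul_cos (x t : ℝ) :
    HasDerivAt (fun y : ℝ => y * Real.cos t) (Real.cos t) x := by
  simpa using (hasDerivAt_id x).mul_const (Real.cos t)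

theorem hasDerivAt_besselI (x : ℝ) : HasDerivAt besselI (besselIDeriv x) x := by
  refine hasDerivAt_intervalIntegral_param (F := fun x θ => Real.cosh (x * Real.cos θ))
    (F' := fun x θ => Real.cos θ * Real.sinh (x * Real.cos θ)) ?_ ?_ ?_ _ _ x
  · exact Real.continuous_cosh.comp (continuous_fst.mul (Real.continuous_cos.comp continuous_snd))
  · exact (Real.continuous_cos.comp continuous_snd).mul
      (Real.continuous_sinh.comp (continuous_fst.mul (Real.continuous_cos.comp continuous_snd)))
  · intro x t
    refine ((Real.hasDerivAt_cosh _).comp x (hasDerivAt_mul_cos x t)).congr_deriv ?_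
    ring

/-- The modified Bessel equation `(x I₀')' = x I₀`. -/
theorem hasDerivAt_besselI_flux (x : ℝ) :
    HasDerivAt (fun y => y * besselIDeriv y) (x * besselI x) x := by
  have h2 : HasDerivAt besselIDeriv
      (∫ θ in (0 : ℝ)..Real.pi, Real.cos θ ^ 2 * Real.cosh (x * Real.cos θ)) x := by
    refine hasDerivAt_intervalIntegral_param
      (F := fun x θ => Real.cos θ * Real.sinh (x * Real.cos θ))
      (F' := fun x θ => Real.cos θ ^ 2 * Real.cosh (x * Real.cos θ)) ?_ ?_ ?_ _ _ x
    · exact (Real.continuous_cos.comp continuous_snd).mul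
        (Real.continuous_sinh.comp (continuous_fst.mul (Real.continuous_cos.comp continuous_snd)))
    · exact ((Real.continuous_cos.comp continuous_snd).pow 2).mul
        (Real.continuous_cosh.comp (continuous_fst.mul (Real.continuous_cos.comp continuous_snd)))
    · intro x t
      refine (((Real.hasDerivAt_sinh _).comp x (hasDerivAt_mul_cos x t)).const_mul _).congr_deriv ?_
      ring
  refine ((hasDerivAt_id x).mul h2).congr_deriv ?_
  have hc : Continuous fun θ => Real.cosh (x * Real.cos θ) :=
    Real.continuous_cosh.comp (continuous_const.mul Real.continuous_cos)
  have hs : Continuous fun θ => Real.sinh (x * Real.cos θ) :=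
    Real.continuous_sinh.comp (continuous_const.mul Real.continuous_cos)
  have i1 : IntervalIntegrable (fun θ => Real.cos θ * Real.sinh (x * Real.cos θ)) volume 0 Real.pi :=
    (Real.continuous_cos.mul hs).intervalIntegrable _ _
  have i2 : IntervalIntegrable (fun θ => x * (Real.cos θ ^ 2 * Real.cosh (x * Real.cos θ)))
      volume 0 Real.pi :=
    (continuous_const.mul ((Real.continuous_cos.pow 2).mul hc)).intervalIntegrable _ _
  have i3 : IntervalIntegrable (fun θ => x * Real.cosh (x * Real.cos θ)) volume 0 Real.pi :=
    (continuous_const.mul hc).intervalIntegrable _ _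
  -- integrate `d/dθ (sin θ sinh(x cos θ))` over `(0, π)`
  have hz : ∫ θ in (0 : ℝ)..Real.pi, (Real.cos θ * Real.sinh (x * Real.cos θ)
      + x * (Real.cos θ ^ 2 * Real.cosh (x * Real.cos θ)) - x * Real.cosh (x * Real.cos θ)) = 0 := by
    have := intervalIntegral.integral_eq_sub_of_hasDerivAt
      (f := fun θ => Real.sin θ * Real.sinh (x * Real.cos θ))
      (f' := fun θ => Real.cos θ * Real.sinh (x * Real.cos θ)
        + x * (Real.cos θ ^ 2 * Real.cosh (x * Real.cos θ)) - x * Real.cosh (x * Real.cos θ))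
      (a := 0) (b := Real.pi) ?_ ((i1.add i2).sub i3)
    · rw [this, Real.sin_pi, Real.sin_zero, zero_mul, zero_mul, sub_zero]
    · intro θ _
      have h3 : HasDerivAt (fun t => x * Real.cos t) (x * -Real.sin θ) θ :=
        (Real.hasDerivAt_cos θ).const_mul x
      refine ((Real.hasDerivAt_sin θ).mul ((Real.hasDerivAt_sinh _).comp θ h3)).congr_deriv ?_
      have := Real.sin_sq θ
      simp only [Function.comp_apply]
      linear_combination (-x * Real.cosh (x * Real.cos θ)) * this
  rw [intervalIntegral.integral_sub (i1.add i2) i3, intervalIntegral.integral_add i1 i2,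
    intervalIntegral.integral_const_mul, intervalIntegral.integral_const_mul] at hz
  simp only [id_eq, one_mul, besselI, besselIDeriv]
  linarith

theorem continuous_besselI : Continuous besselI :=
  continuous_iff_continuousAt.2 fun x => (hasDerivAt_besselI x).continuousAt

theorem continuous_besselIDeriv : Continuous besselIDeriv :=
  intervalIntegral.continuous_parametric_intervalIntegral_of_continuous'
    (f := fun x θ => Real.cos θ * Real.sinh (x * Real.cos θ))
    ((Real.continuous_cos.comp continuous_snd).mul
      (Real.continuous_sinh.comp (continuous_fst.mul (Real.continuous_cos.comp continuous_snd)))) _ _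

theorem besselI_pos (x : ℝ) : 0 < besselI x :=
  intervalIntegral.intervalIntegral_pos_of_pos
    ((Real.continuous_cosh.comp (continuous_const.mul Real.continuous_cos)).intervalIntegrable _ _)
    (fun _ => Real.cosh_pos _) Real.pi_pos

theorem besselIDeriv_nonneg {x : ℝ} (hx : 0 ≤ x) : 0 ≤ besselIDeriv x := by
  refine intervalIntegral.integral_nonneg Real.pi_pos.le fun θ _ => ?_
  rcases le_total 0 (Real.cos θ) with h | h
  · exact mul_nonneg h (Real.sinh_nonneg_iff.2 (mul_nonneg hx h))
  · exact mul_nonneg_of_nonpos_of_nonpos h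
      (Real.sinh_nonpos_iff.2 (mul_nonpos_of_nonneg_of_nonpos hx h))

/-! ### Decay rate of the Macdonald function -/

/-- The function `x^(1/2-ν) · besselK ν x`, a multiple of `√x K_ν(x)`, which satisfies
`V'' = (1 + (ν² - 1/4) / x²) V`. -/
def decayFun (ν x : ℝ) : ℝ := x ^ (1 / 2 - ν) * besselK ν x

/-- The logarithmic derivative `-V'/V` of `decayFun`. -/
def decayRate (ν x : ℝ) : ℝ := -((1 / 2 - ν) / x + besselKDeriv ν x / besselK ν x)

theorem decayFun_pos (ν : ℝ) {x : ℝ} (hx : 0 < x) : 0 < decayFun ν x :=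
  mul_pos (Real.rpow_pos_of_pos hx _) (besselK_pos ν hx)

theorem hasDerivAt_decayFun (ν : ℝ) {x : ℝ} (hx : 0 < x) :
    HasDerivAt (decayFun ν) (-(decayRate ν x * decayFun ν x)) x := by
  refine ((Real.hasDerivAt_rpow_const (p := 1 / 2 - ν) (Or.inl hx.ne')).mul
    (hasDerivAt_besselK ν hx)).congr_deriv ?_
  have := (besselK_pos ν hx).ne'
  rw [Real.rpow_sub_one hx.ne', decayRate, decayFun]
  field_simp

/-- The first-order form of `V'' = (1 + (ν² - 1/4) / x²) V`, in terms of `-V' = decayRate · V`. -/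
theorem hasDerivAt_decayRate_mul (ν : ℝ) {x : ℝ} (hx : 0 < x) :
    HasDerivAt (fun y => decayRate ν y * decayFun ν y)
      (-((1 + (ν ^ 2 - 1 / 4) / x ^ 2) * decayFun ν x)) x := by
  have e : (fun y => decayRate ν y * decayFun ν y) =ᶠ[𝓝 x] fun y =>
      -((1 / 2 - ν) * (y ^ (1 / 2 - ν - 1) * besselK ν y) + y ^ (1 / 2 - ν) * besselKDeriv ν y) := by
    filter_upwards [Ioi_mem_nhds hx] with y hy
    have hy0 : 0 < y := hy
    have := (besselK_pos ν hy0).ne'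
    rw [Real.rpow_sub_one hy0.ne', decayRate, decayFun]
    field_simp
  have d1 := (Real.hasDerivAt_rpow_const (p := 1 / 2 - ν - 1) (Or.inl hx.ne')).mul
    (hasDerivAt_besselK ν hx)
  have d2 := (Real.hasDerivAt_rpow_const (p := 1 / 2 - ν) (Or.inl hx.ne')).mul
    (hasDerivAt_besselKDeriv ν hx)
  refine (((d1.const_mul (1 / 2 - ν)).add d2).neg.congr_of_eventuallyEq e).congr_deriv ?_
  rw [Real.rpow_sub_one hx.ne' (1 / 2 - ν - 1), Real.rpow_sub_one hx.ne' (1 / 2 - ν), decayFun]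
  field_simp
  ring

theorem besselK_le_one {ν x : ℝ} (hx : 1 ≤ x) : besselK ν x ≤ besselK ν 1 := by
  have hpos : ∀ y ∈ Ici (1 : ℝ), 0 < y := fun y hy => one_pos.trans_le hy
  refine antitoneOn_of_deriv_nonpos (convex_Ici 1)
    (fun y hy => (hasDerivAt_besselK ν (hpos y hy)).continuousAt.continuousWithinAt)
    (fun y hy => (hasDerivAt_besselK ν (hpos y (interior_subset hy))
      ).differentiableAt.differentiableWithinAt) (fun y hy => ?_) self_mem_Ici hx hx
  rw [(hasDerivAt_besselK ν (hpos y (interior_subset hy))).deriv]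
  exact (besselKDeriv_neg ν (hpos y (interior_subset hy))).le

theorem monotoneOn_besselK_flux (ν : ℝ) :
    MonotoneOn (fun y => y ^ (1 - 2 * ν) * besselKDeriv ν y) (Ioi 0) := by
  refine monotoneOn_of_deriv_nonneg (convex_Ioi 0)
    (fun y hy => (hasDerivAt_besselK_flux ν hy).continuousAt.continuousWithinAt)
    (fun y hy => (hasDerivAt_besselK_flux ν (interior_subset hy)
      ).differentiableAt.differentiableWithinAt) (fun y hy => ?_)
  have hy0 : (0 : ℝ) < y := mem_Ioi.1 (interior_subset hy)
  rw [(hasDerivAt_besselK_flux ν hy0).deriv]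
  exact (mul_pos (Real.rpow_pos_of_pos hy0 _) (besselK_pos ν hy0)).le

theorem tendsto_exp_mul_decayFun (ν : ℝ) {q : ℝ} (hq : 0 < q) :
    Tendsto (fun x => Real.exp (-q * x) * decayFun ν x) atTop (𝓝 0) := by
  have h := (tendsto_rpow_mul_exp_neg_mul_atTop_nhds_zero (1 / 2 - ν) q hq).const_mul (besselK ν 1)
  rw [mul_zero] at h
  refine squeeze_zero' ?_ ?_ h
  · filter_upwards [eventually_gt_atTop 0] with x hx
    exact mul_nonneg (Real.exp_pos _).le (decayFun_pos ν hx).le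
  · filter_upwards [eventually_ge_atTop 1] with x hx
    have hx0 : 0 < x := one_pos.trans_le hx
    have h1 : 0 ≤ x ^ (1 / 2 - ν) * Real.exp (-q * x) :=
      mul_nonneg (Real.rpow_pos_of_pos hx0 _).le (Real.exp_pos _).le
    rw [decayFun]
    nlinarith [mul_le_mul_of_nonneg_left (besselK_le_one (ν := ν) hx) h1]

theorem tendsto_exp_mul_besselKDeriv (ν : ℝ) {q : ℝ} (hq : 0 < q) :
    Tendsto (fun x => Real.exp (-q * x) * (x ^ (1 / 2 - ν) * besselKDeriv ν x)) atTop (𝓝 0) := by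
  have h := (tendsto_rpow_mul_exp_neg_mul_atTop_nhds_zero (ν - 1 / 2) q hq).const_mul
    (besselKDeriv ν 1)
  rw [mul_zero] at h
  refine tendsto_of_tendsto_of_tendsto_of_le_of_le' h tendsto_const_nhds ?_ ?_
  · filter_upwards [eventually_ge_atTop 1] with x hx
    have hx0 : 0 < x := one_pos.trans_le hx
    have h1 := monotoneOn_besselK_flux ν (mem_Ioi.2 one_pos) (mem_Ioi.2 hx0) hx
    simp only [Real.one_rpow, one_mul] at h1
    have h2 : x ^ (1 / 2 - ν) = x ^ (ν - 1 / 2) * x ^ (1 - 2 * ν) := by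
      rw [← Real.rpow_add hx0]; ring_nf
    have h3 : 0 ≤ x ^ (ν - 1 / 2) * Real.exp (-q * x) :=
      mul_nonneg (Real.rpow_pos_of_pos hx0 _).le (Real.exp_pos _).le
    rw [h2]
    nlinarith [mul_le_mul_of_nonneg_left h1 h3]
  · filter_upwards [eventually_gt_atTop 0] with x hx
    exact mul_nonpos_of_nonneg_of_nonpos (Real.exp_pos _).le
      (mul_nonpos_of_nonneg_of_nonpos (Real.rpow_pos_of_pos hx _).le (besselKDeriv_neg ν hx).le)

/-- `e^(-qx) (V' + q V)`, whose derivative has the sign of `V'' / V - q²`. -/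
def riccatiFun (ν q x : ℝ) : ℝ := Real.exp (-q * x) * (q - decayRate ν x) * decayFun ν x

theorem hasDerivAt_riccatiFun (ν q : ℝ) {x : ℝ} (hx : 0 < x) :
    HasDerivAt (riccatiFun ν q)
      (Real.exp (-q * x) * ((1 + (ν ^ 2 - 1 / 4) / x ^ 2 - q ^ 2) * decayFun ν x)) x := by
  have h1 : HasDerivAt (fun y => Real.exp (-q * y)) (Real.exp (-q * x) * (-q)) x := by
    simpa using ((hasDerivAt_id x).const_mul (-q)).exp
  have h2 := ((hasDerivAt_decayFun ν hx).const_mul q).sub (hasDerivAt_decayRate_mul ν hx)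
  refine ((h1.mul h2).congr_deriv ?_).congr_of_eventuallyEq (Eventually.of_forall fun y => ?_)
  · simp only [Pi.sub_apply]; ring
  · simp only [riccatiFun, Pi.sub_apply, Pi.mul_apply]; ring

theorem tendsto_riccatiFun (ν : ℝ) {q : ℝ} (hq : 0 < q) :
    Tendsto (riccatiFun ν q) atTop (𝓝 0) := by
  have h1 := tendsto_exp_mul_decayFun ν hq
  have h2 := tendsto_exp_mul_besselKDeriv ν hq
  have h3 : Tendsto (fun x : ℝ => q + (1 / 2 - ν) * x⁻¹) atTop (𝓝 (q + (1 / 2 - ν) * 0)) :=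
    (tendsto_inv_atTop_zero.const_mul _).const_add q
  have h4 := (h3.mul h1).add h2
  rw [mul_zero, add_zero] at h4
  refine h4.congr' ?_
  filter_upwards [eventually_gt_atTop 0] with x hx
  have := (besselK_pos ν hx).ne'
  rw [riccatiFun, decayRate, decayFun]
  field_simp
  ring

theorem decayRate_le {ν q x : ℝ} (hq : 0 < q) (hx : 0 < x)
    (h : ∀ t, x ≤ t → 1 + (ν ^ 2 - 1 / 4) / t ^ 2 ≤ q ^ 2) : decayRate ν x ≤ q := by
  have hpos : ∀ y ∈ Ici x, 0 < y := fun y hy => hx.trans_le hy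
  have hanti : AntitoneOn (riccatiFun ν q) (Ici x) := by
    refine antitoneOn_of_deriv_nonpos (convex_Ici x)
      (fun y hy => (hasDerivAt_riccatiFun ν q (hpos y hy)).continuousAt.continuousWithinAt)
      (fun y hy => (hasDerivAt_riccatiFun ν q (hpos y (interior_subset hy))
        ).differentiableAt.differentiableWithinAt) (fun y hy => ?_)
    have hy' := interior_subset hy
    rw [(hasDerivAt_riccatiFun ν q (hpos y hy')).deriv]
    refine mul_nonpos_of_nonneg_of_nonpos (Real.exp_pos _).le ?_
    exact mul_nonpos_of_nonpos_of_nonneg (by linarith [h y hy']) (decayFun_pos ν (hpos y hy')).le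
  have h0 : 0 ≤ riccatiFun ν q x := by
    refine le_of_tendsto (tendsto_riccatiFun ν hq) ?_
    filter_upwards [eventually_ge_atTop x] with y hy
    exact hanti self_mem_Ici hy hy
  rw [riccatiFun, mul_right_comm] at h0
  have h2 : 0 ≤ q - decayRate ν x :=
    nonneg_of_mul_nonneg_right h0 (mul_pos (Real.exp_pos _) (decayFun_pos ν hx))
  linarith

theorem le_decayRate {ν q x : ℝ} (hq : 0 < q) (hx : 0 < x)
    (h : ∀ t, x ≤ t → q ^ 2 ≤ 1 + (ν ^ 2 - 1 / 4) / t ^ 2) : q ≤ decayRate ν x := by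
  have hpos : ∀ y ∈ Ici x, 0 < y := fun y hy => hx.trans_le hy
  have hmono : MonotoneOn (riccatiFun ν q) (Ici x) := by
    refine monotoneOn_of_deriv_nonneg (convex_Ici x)
      (fun y hy => (hasDerivAt_riccatiFun ν q (hpos y hy)).continuousAt.continuousWithinAt)
      (fun y hy => (hasDerivAt_riccatiFun ν q (hpos y (interior_subset hy))
        ).differentiableAt.differentiableWithinAt) (fun y hy => ?_)
    have hy' := interior_subset hy
    rw [(hasDerivAt_riccatiFun ν q (hpos y hy')).deriv]
    refine mul_nonneg (Real.exp_pos _).le ?_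
    exact mul_nonneg (by linarith [h y hy']) (decayFun_pos ν (hpos y hy')).le
  have h0 : riccatiFun ν q x ≤ 0 := by
    refine ge_of_tendsto (tendsto_riccatiFun ν hq) ?_
    filter_upwards [eventually_ge_atTop x] with y hy
    exact hmono self_mem_Ici hy hy
  rw [riccatiFun, mul_right_comm] at h0
  have h2 : q - decayRate ν x ≤ 0 := by
    by_contra! hlt
    exact absurd h0 (not_le.2 (mul_pos (mul_pos (Real.exp_pos _) (decayFun_pos ν hx)) hlt))
  linarith

theorem decayRate_bounds {ν x : ℝ} (hν0 : 0 ≤ ν) (hν1 : ν < 1) (hx : 1 ≤ x) :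
    1 - 1 / (4 * x ^ 2) ≤ decayRate ν x ∧ decayRate ν x ≤ 1 + 1 / (2 * x ^ 2) := by
  have hx0 : 0 < x := one_pos.trans_le hx
  have hx2 : 1 ≤ x ^ 2 := one_le_pow₀ hx
  set z := 1 / x ^ 2 with hz
  have hz0 : 0 < z := by positivity
  have hz1 : z ≤ 1 := by rw [hz, div_le_one (by positivity)]; exact hx2
  have e1 : 1 / (4 * x ^ 2) = z / 4 := by rw [hz]; field_simp
  have e2 : 1 / (2 * x ^ 2) = z / 2 := by rw [hz]; field_simp
  rw [e1, e2]
  have ht : ∀ t, x ≤ t → 0 < 1 / t ^ 2 ∧ 1 / t ^ 2 ≤ z := fun t ht => by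
    have ht0 : 0 < t := hx0.trans_le ht
    exact ⟨by positivity, one_div_le_one_div_of_le (by positivity) (pow_le_pow_left₀ hx0.le ht 2)⟩
  constructor
  · refine le_decayRate (by linarith) hx0 fun t hxt => ?_
    obtain ⟨h1, h2⟩ := ht t hxt
    rw [div_eq_mul_one_div _ (t ^ 2)]
    have h3 : z * z ≤ z := mul_le_of_le_one_left hz0.le hz1
    nlinarith [mul_nonneg (sq_nonneg ν) h1.le]
  · refine decayRate_le (by linarith) hx0 fun t hxt => ?_
    obtain ⟨h1, h2⟩ := ht t hxt
    rw [div_eq_mul_one_div _ (t ^ 2)]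
    have h3 : ν ^ 2 ≤ 1 := by nlinarith
    nlinarith [mul_le_mul_of_nonneg_right h3 h1.le]

theorem decayRate_ge {ν x : ℝ} (hν0 : 0 ≤ ν) (hν1 : ν < 1) (hx : 1 ≤ x) :
    3 / 4 ≤ decayRate ν x := by
  have h := (decayRate_bounds hν0 hν1 hx).1
  have hx2 : 1 ≤ x ^ 2 := one_le_pow₀ hx
  have : 1 / (4 * x ^ 2) ≤ 1 / 4 := one_div_le_one_div_of_le (by norm_num) (by linarith)
  linarith

theorem abs_decayRate_sub_le {ν μ x : ℝ} (hν0 : 0 ≤ ν) (hν1 : ν < 1) (hμ0 : 0 ≤ μ) (hμ1 : μ < 1)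
    (hx : 1 ≤ x) : |decayRate ν x - decayRate μ x| ≤ 1 / x ^ 2 := by
  obtain ⟨h1, h2⟩ := decayRate_bounds hν0 hν1 hx
  obtain ⟨h3, h4⟩ := decayRate_bounds hμ0 hμ1 hx
  have hx0 : 0 < x := one_pos.trans_le hx
  have e1 : 1 / (4 * x ^ 2) = (1 / x ^ 2) / 4 := by field_simp
  have e2 : 1 / (2 * x ^ 2) = (1 / x ^ 2) / 2 := by field_simp
  rw [e1] at h1 h3
  rw [e2] at h2 h4
  have : 0 < 1 / x ^ 2 := by positivity
  rw [abs_le]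
  constructor <;> linarith

theorem besselK_logDeriv_ge {ν x : ℝ} (hν0 : 0 ≤ ν) (hν1 : ν < 1) (hx : 1 ≤ x) :
    1 / 4 ≤ -(besselKDeriv ν x / besselK ν x) := by
  have h := decayRate_ge hν0 hν1 hx
  have hx0 : 0 < x := one_pos.trans_le hx
  rw [decayRate] at h
  have : -(1 / 2) ≤ (1 / 2 - ν) / x := by
    rw [le_div_iff₀ hx0]; nlinarith
  linarith

theorem decayFun_le {ν x y : ℝ} (hν0 : 0 ≤ ν) (hν1 : ν < 1) (hx : 1 ≤ x) (hxy : x ≤ y) :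
    decayFun ν y ≤ Real.exp (-(3 / 4) * (y - x)) * decayFun ν x := by
  have hpos : ∀ t ∈ Ici x, 0 < t := fun t ht => (one_pos.trans_le hx).trans_le ht
  have hd : ∀ t ∈ Ici x, HasDerivAt (fun t => Real.exp (3 / 4 * t) * decayFun ν t)
      (Real.exp (3 / 4 * t) * ((3 / 4 - decayRate ν t) * decayFun ν t)) t := fun t ht => by
    have h1 : HasDerivAt (fun y : ℝ => Real.exp (3 / 4 * y)) (Real.exp (3 / 4 * t) * (3 / 4)) t := by
      simpa using ((hasDerivAt_id t).const_mul (3 / 4)).exp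
    refine (h1.mul (hasDerivAt_decayFun ν (hpos t ht))).congr_deriv ?_
    ring
  have hanti : AntitoneOn (fun t => Real.exp (3 / 4 * t) * decayFun ν t) (Ici x) := by
    refine antitoneOn_of_deriv_nonpos (convex_Ici x)
      (fun t ht => (hd t ht).continuousAt.continuousWithinAt)
      (fun t ht => (hd t (interior_subset ht)).differentiableAt.differentiableWithinAt)
      (fun t ht => ?_)
    have ht' := interior_subset ht
    rw [(hd t ht').deriv]
    refine mul_nonpos_of_nonneg_of_nonpos (Real.exp_pos _).le
      (mul_nonpos_of_nonpos_of_nonneg ?_ (decayFun_pos ν (hpos t ht')).le)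
    linarith [decayRate_ge hν0 hν1 (hx.trans ht')]
  have h := hanti self_mem_Ici hxy hxy
  have e : Real.exp (-(3 / 4) * (y - x)) = Real.exp (-(3 / 4 * y)) * Real.exp (3 / 4 * x) := by
    rw [← Real.exp_add]; ring_nf
  have e2 : Real.exp (-(3 / 4 * y)) * Real.exp (3 / 4 * y) = 1 := by
    rw [← Real.exp_add, neg_add_cancel, Real.exp_zero]
  have h2 := mul_le_mul_of_nonneg_left h (Real.exp_pos (-(3 / 4 * y))).le
  simp only at h2
  rw [← mul_assoc, e2, one_mul] at h2
  rw [e, mul_assoc]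
  exact h2

/-- The ratio of two of the functions `decayFun` varies little on `[x, ∞)`. -/
theorem decayFun_ratio_bounds {ν μ x y : ℝ} (hν0 : 0 ≤ ν) (hν1 : ν < 1) (hμ0 : 0 ≤ μ) (hμ1 : μ < 1)
    (hx : 1 ≤ x) (hxy : x ≤ y) :
    |decayFun ν y / decayFun ν x - decayFun μ y / decayFun μ x|
      ≤ 3 / x * (decayFun μ y / decayFun μ x) := by
  have hx0 : 0 < x := one_pos.trans_le hx
  have hpos : ∀ t ∈ Ici x, 0 < t := fun t ht => hx0.trans_le ht
  set h : ℝ → ℝ := fun t => decayFun ν t / decayFun μ t with hh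
  have hhpos : ∀ t ∈ Ici x, 0 < h t := fun t ht =>
    div_pos (decayFun_pos ν (hpos t ht)) (decayFun_pos μ (hpos t ht))
  have hd : ∀ t ∈ Ici x, HasDerivAt h ((decayRate μ t - decayRate ν t) * h t) t := fun t ht => by
    have hμ := (decayFun_pos μ (hpos t ht)).ne'
    refine ((hasDerivAt_decayFun ν (hpos t ht)).div (hasDerivAt_decayFun μ (hpos t ht)) hμ
      ).congr_deriv ?_
    simp only [hh]
    field_simp
    ring
  have hexp : ∀ c t : ℝ, t ∈ Ici x → HasDerivAt (fun s => Real.exp (c * s⁻¹))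
      (Real.exp (c * t⁻¹) * (-c / t ^ 2)) t := fun c t ht => by
    refine ((hasDerivAt_inv (hpos t ht).ne').const_mul c).exp.congr_deriv ?_
    ring
  have hmono : ∀ c t : ℝ, t ∈ Ici x → HasDerivAt (fun s => Real.exp (c * s⁻¹) * h s)
      (Real.exp (c * t⁻¹) * ((decayRate μ t - decayRate ν t) - c / t ^ 2) * h t) t := fun c t ht => by
    refine ((hexp c t ht).mul (hd t ht)).congr_deriv ?_
    ring
  have up : MonotoneOn (fun s => Real.exp (-1 * s⁻¹) * h s) (Ici x) := by
    refine monotoneOn_of_deriv_nonneg (convex_Ici x)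
      (fun t ht => (hmono (-1) t ht).continuousAt.continuousWithinAt)
      (fun t ht => (hmono (-1) t (interior_subset ht)).differentiableAt.differentiableWithinAt)
      (fun t ht => ?_)
    have ht' := interior_subset ht
    rw [(hmono (-1) t ht').deriv]
    have hb := abs_le.1 (abs_decayRate_sub_le hμ0 hμ1 hν0 hν1 (hx.trans ht'))
    refine mul_nonneg (mul_nonneg (Real.exp_pos _).le ?_) (hhpos t ht').le
    rw [neg_div]; linarith [hb.1]
  have dn : AntitoneOn (fun s => Real.exp (1 * s⁻¹) * h s) (Ici x) := by
    refine antitoneOn_of_deriv_nonpos (convex_Ici x)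
      (fun t ht => (hmono 1 t ht).continuousAt.continuousWithinAt)
      (fun t ht => (hmono 1 t (interior_subset ht)).differentiableAt.differentiableWithinAt)
      (fun t ht => ?_)
    have ht' := interior_subset ht
    rw [(hmono 1 t ht').deriv]
    have hb := abs_le.1 (abs_decayRate_sub_le hμ0 hμ1 hν0 hν1 (hx.trans ht'))
    refine mul_nonpos_of_nonpos_of_nonneg (mul_nonpos_of_nonneg_of_nonpos (Real.exp_pos _).le ?_)
      (hhpos t ht').le
    linarith [hb.2]
  have hup := up self_mem_Ici hxy hxy
  have hdn := dn self_mem_Ici hxy hxy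
  simp only at hup hdn
  have hxp := hhpos x self_mem_Ici
  have hyp := hhpos y hxy
  have hy0 : 0 < y := hpos y hxy
  have hyinv : 0 < y⁻¹ := inv_pos.2 hy0
  have hxinv : 0 < x⁻¹ := inv_pos.2 hx0
  have hx1 : x⁻¹ ≤ 1 := inv_le_one_of_one_le₀ hx
  -- the quotient `h y / h x` lies in `[exp (-1/x), exp (1/x)]`
  have hub : h y ≤ (1 + 3 * x⁻¹) * h x := by
    have h1 : Real.exp (1 * x⁻¹) ≤ 1 + 3 * x⁻¹ := by
      have := Real.abs_exp_sub_one_sub_id_le (x := x⁻¹) (by rw [abs_of_pos hxinv]; exact hx1)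
      rw [one_mul]
      have h2 := (abs_le.1 this).2
      nlinarith
    have h2 : h y ≤ Real.exp (1 * y⁻¹) * h y := by
      refine le_mul_of_one_le_left hyp.le (Real.one_le_exp ?_)
      rw [one_mul]; exact hyinv.le
    calc h y ≤ Real.exp (1 * x⁻¹) * h x := h2.trans hdn
      _ ≤ _ := mul_le_mul_of_nonneg_right h1 hxp.le
  have hlb : (1 - 3 * x⁻¹) * h x ≤ h y := by
    have h1 : 1 - 3 * x⁻¹ ≤ Real.exp (-1 * x⁻¹) := by
      have := Real.add_one_le_exp (-1 * x⁻¹)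
      linarith
    have h2 : Real.exp (-1 * y⁻¹) * h y ≤ h y := by
      refine mul_le_of_le_one_left hyp.le (Real.exp_le_one_iff.2 ?_)
      linarith
    exact (mul_le_mul_of_nonneg_right h1 hxp.le).trans (hup.trans h2)
  have hVx := decayFun_pos ν hx0
  have hMx := decayFun_pos μ hx0
  have hMy := decayFun_pos μ hy0
  have e : decayFun ν y / decayFun ν x - decayFun μ y / decayFun μ x
      = (h y - h x) / h x * (decayFun μ y / decayFun μ x) := by
    simp only [hh]
    field_simp
  rw [e, abs_mul, abs_of_pos (div_pos hMy hMx)]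
  refine mul_le_mul_of_nonneg_right ?_ (div_pos hMy hMx).le
  rw [abs_div, abs_of_pos hxp, div_le_iff₀ hxp, abs_le, div_eq_mul_inv]
  constructor <;> nlinarith

/-! ### Solutions on the half-line -/

theorem weight_of_le_one (α : ℝ) {r : ℝ} (h0 : 0 ≤ r) (hr : r ≤ 1) : weight α r = r := by
  rw [weight, groundState_of_le_one α hr, Real.sq_sqrt h0]

theorem weight_of_one_le (α : ℝ) {r : ℝ} (hr : 1 ≤ r) : weight α r = r ^ (1 - 2 * α) := by
  rw [weight, groundState_of_one_le α hr, ← Real.rpow_natCast, ← Real.rpow_mul (by linarith)]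
  congr 1
  push_cast
  ring

theorem groundState_one (α : ℝ) : groundState α 1 = 1 := by
  rw [groundState_of_le_one α le_rfl, Real.sqrt_one]

theorem continuousOn_glue {f g : ℝ → ℝ} (hf : ContinuousOn f (Ioi 0)) (hg : ContinuousOn g (Ioi 0))
    (h : f 1 = g 1) : ContinuousOn (fun r => if r ≤ 1 then f r else g r) (Ioi 0) := by
  have h1 : ContinuousOn (fun r => f (min r 1)) (Ioi 0) :=
    hf.comp (by fun_prop) fun r hr => mem_Ioi.2 (lt_min hr one_pos)
  have h2 : ContinuousOn (fun r => g (max r 1)) (Ioi 0) :=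
    hg.comp (by fun_prop) fun r hr => mem_Ioi.2 (lt_max_of_lt_left hr)
  refine ((h1.add h2).sub continuousOn_const (g := fun _ => g 1)).congr fun r _ => ?_
  simp only [Pi.sub_apply, Pi.add_apply]
  split_ifs with hr
  · rw [min_eq_left hr, max_eq_right hr]; ring
  · rw [min_eq_right (not_le.1 hr).le, max_eq_left (not_le.1 hr).le, h]; ring

theorem IsSolution.glue {α κ : ℝ} {f df g dg : ℝ → ℝ} (hf : ContinuousOn f (Ioi 0))
    (hdf : ContinuousOn df (Ioi 0)) (hg : ContinuousOn g (Ioi 0)) (hdg : ContinuousOn dg (Ioi 0))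
    (h : f 1 = g 1) (hd : df 1 = dg 1)
    (f1 : ∀ r, 0 < r → r < 1 → HasDerivAt f (df r) r)
    (f2 : ∀ r, 0 < r → r < 1 →
      HasDerivAt (fun s => weight α s * df s) (κ ^ 2 * (weight α r * f r)) r)
    (g1 : ∀ r, 1 < r → HasDerivAt g (dg r) r)
    (g2 : ∀ r, 1 < r →
      HasDerivAt (fun s => weight α s * dg s) (κ ^ 2 * (weight α r * g r)) r) :
    IsSolution α κ (fun r => if r ≤ 1 then f r else g r)
      (fun r => if r ≤ 1 then df r else dg r) := by
  refine ⟨continuousOn_glue hf hg h, continuousOn_glue hdf hdg hd, fun r hr hr1 => ?_,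
    fun r hr hr1 => ?_⟩
  · rcases lt_or_gt_of_ne hr1 with h | h
    · rw [if_pos h.le]
      refine (f1 r hr h).congr_of_eventuallyEq ?_
      filter_upwards [Iio_mem_nhds h] with s hs using if_pos (le_of_lt hs)
    · rw [if_neg (not_le.2 h)]
      refine (g1 r h).congr_of_eventuallyEq ?_
      filter_upwards [Ioi_mem_nhds h] with s hs using if_neg (not_le.2 hs)
  · rcases lt_or_gt_of_ne hr1 with h | h
    · rw [if_pos h.le]
      refine (f2 r hr h).congr_of_eventuallyEq ?_
      filter_upwards [Iio_mem_nhds h] with s hs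
      rw [if_pos (le_of_lt hs)]
    · rw [if_neg (not_le.2 h)]
      refine (g2 r h).congr_of_eventuallyEq ?_
      filter_upwards [Ioi_mem_nhds h] with s hs
      rw [if_neg (not_le.2 hs)]

/-- The function `A + B ∫₁^r ds / (w f²)`, by which a solution `f` is multiplied in d'Alembert's
reduction of order. -/
def reductionFactor (α : ℝ) (f : ℝ → ℝ) (A B r : ℝ) : ℝ :=
  A + B * ∫ s in (1 : ℝ)..r, (weight α s * f s ^ 2)⁻¹

theorem reductionFactor_one (α : ℝ) (f : ℝ → ℝ) (A B : ℝ) : reductionFactor α f A B 1 = A := by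
  rw [reductionFactor, intervalIntegral.integral_same, mul_zero, add_zero]

section Reduction

variable {α κ : ℝ} {f df : ℝ → ℝ}

theorem continuousOn_inv_weight_mul_sq (hf : ContinuousOn f (Ioi 0)) (hpos : ∀ r, 0 < r → 0 < f r) :
    ContinuousOn (fun s => (weight α s * f s ^ 2)⁻¹) (Ioi 0) :=
  ((continuous_weight α).continuousOn.mul (hf.pow 2)).inv₀ fun r hr =>
    (mul_pos (weight_pos α hr) (pow_pos (hpos r hr) 2)).ne'

theorem hasDerivAt_reductionFactor (hf : ContinuousOn f (Ioi 0)) (hpos : ∀ r, 0 < r → 0 < f r)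
    (A B : ℝ) {r : ℝ} (hr : 0 < r) :
    HasDerivAt (reductionFactor α f A B) (B * (weight α r * f r ^ 2)⁻¹) r := by
  have hc := continuousOn_inv_weight_mul_sq (α := α) hf hpos
  have hint : IntervalIntegrable (fun s => (weight α s * f s ^ 2)⁻¹) volume 1 r := by
    apply ContinuousOn.intervalIntegrable
    refine hc.mono fun s hs => ?_
    rw [mem_uIcc] at hs
    rcases hs with hs | hs
    · exact one_pos.trans_le hs.1
    · exact hr.trans_le hs.1
  refine ((intervalIntegral.integral_hasDerivAt_right hint ?_ ?_).const_mul B).const_add A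
  · exact hc.stronglyMeasurableAtFilter isOpen_Ioi r hr
  · exact hc.continuousAt (Ioi_mem_nhds hr)

theorem continuousOn_reductionFactor (hf : ContinuousOn f (Ioi 0)) (hpos : ∀ r, 0 < r → 0 < f r)
    (A B : ℝ) : ContinuousOn (reductionFactor α f A B) (Ioi 0) := fun _ hr =>
  (hasDerivAt_reductionFactor hf hpos A B hr).continuousAt.continuousWithinAt

theorem hasDerivAt_mul_reductionFactor (hf : ContinuousOn f (Ioi 0)) (hpos : ∀ r, 0 < r → 0 < f r)
    (A B : ℝ) {r : ℝ} (hr : 0 < r) (hd : HasDerivAt f (df r) r) :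
    HasDerivAt (fun s => f s * reductionFactor α f A B s)
      (df r * reductionFactor α f A B r + B * (weight α r * f r)⁻¹) r := by
  refine (hd.mul (hasDerivAt_reductionFactor hf hpos A B hr)).congr_deriv ?_
  have h1 := (hpos r hr).ne'
  have h2 := (weight_pos α hr).ne'
  field_simp

theorem hasDerivAt_flux_mul_reductionFactor (hf : ContinuousOn f (Ioi 0))
    (hpos : ∀ r, 0 < r → 0 < f r) (A B : ℝ) {r : ℝ} (hr : 0 < r) (hd : HasDerivAt f (df r) r)
    (hflux : HasDerivAt (fun s => weight α s * df s) (κ ^ 2 * (weight α r * f r)) r) :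
    HasDerivAt (fun s => weight α s *
        (df s * reductionFactor α f A B s + B * (weight α s * f s)⁻¹))
      (κ ^ 2 * (weight α r * (f r * reductionFactor α f A B r))) r := by
  have e : (fun s => weight α s * (df s * reductionFactor α f A B s + B * (weight α s * f s)⁻¹))
      =ᶠ[𝓝 r] fun s => weight α s * df s * reductionFactor α f A B s + B * (f s)⁻¹ := by
    filter_upwards [Ioi_mem_nhds hr] with s hs
    have h1 := (hpos s hs).ne'
    have h2 := (weight_pos α hs).ne'
    field_simp
  have h1 := (hpos r hr).ne'
  have h2 := (weight_pos α hr).ne'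
  refine (((hflux.mul (hasDerivAt_reductionFactor hf hpos A B hr)).add
    ((hd.inv h1).const_mul B)).congr_of_eventuallyEq e).congr_deriv ?_
  field_simp
  ring

end Reduction

/-- The solution on `(0, 1]` that is regular at `0`, normalised at `1`. -/
def leftSol (κ r : ℝ) : ℝ := besselI (κ * r) / besselI κ

/-- The derivative of `leftSol`. -/
def leftSolDeriv (κ r : ℝ) : ℝ := κ * besselIDeriv (κ * r) / besselI κ

/-- The solution on `[1, ∞)` that decays at infinity, normalised at `1`. -/
def rightSol (α κ r : ℝ) : ℝ := besselK α (κ * r) / besselK α κ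

/-- The derivative of `rightSol`. -/
def rightSolDeriv (α κ r : ℝ) : ℝ := κ * besselKDeriv α (κ * r) / besselK α κ

section Sol

variable {α κ : ℝ}

theorem leftSol_pos (κ r : ℝ) : 0 < leftSol κ r := div_pos (besselI_pos _) (besselI_pos _)

theorem leftSol_one (κ : ℝ) : leftSol κ 1 = 1 := by
  rw [leftSol, mul_one, div_self (besselI_pos κ).ne']

theorem hasDerivAt_leftSol (κ r : ℝ) : HasDerivAt (leftSol κ) (leftSolDeriv κ r) r := by
  have h := (hasDerivAt_besselI (κ * r)).comp r ((hasDerivAt_id r).const_mul κ)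
  refine (h.div_const (besselI κ)).congr_deriv ?_
  rw [leftSolDeriv]; ring

theorem continuous_leftSol (κ : ℝ) : Continuous (leftSol κ) :=
  (continuous_besselI.comp (continuous_const.mul continuous_id)).div_const _

theorem continuous_leftSolDeriv (κ : ℝ) : Continuous (leftSolDeriv κ) :=
  (continuous_const.mul (continuous_besselIDeriv.comp
    (continuous_const.mul continuous_id))).div_const _

theorem leftSolDeriv_nonneg (hκ : 0 < κ) {r : ℝ} (hr : 0 ≤ r) : 0 ≤ leftSolDeriv κ r :=
  div_nonneg (mul_nonneg hκ.le (besselIDeriv_nonneg (mul_nonneg hκ.le hr))) (besselI_pos κ).le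

theorem leftSol_le_one (hκ : 0 < κ) {r : ℝ} (h0 : 0 ≤ r) (hr : r ≤ 1) : leftSol κ r ≤ 1 := by
  rw [← leftSol_one κ]
  refine monotoneOn_of_deriv_nonneg (convex_Ici 0) (continuous_leftSol κ).continuousOn
    (fun y _ => (hasDerivAt_leftSol κ y).differentiableAt.differentiableWithinAt) (fun y hy => ?_)
    (mem_Ici.2 h0) (mem_Ici.2 zero_le_one) hr
  rw [(hasDerivAt_leftSol κ y).deriv]
  exact leftSolDeriv_nonneg hκ (interior_subset hy)

theorem hasDerivAt_leftSol_flux (α κ : ℝ) {r : ℝ} (hr : 0 < r) (hr1 : r < 1) :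
    HasDerivAt (fun s => weight α s * leftSolDeriv κ s)
      (κ ^ 2 * (weight α r * leftSol κ r)) r := by
  have h := (hasDerivAt_besselI_flux (κ * r)).comp r ((hasDerivAt_id r).const_mul κ)
  have e : (fun s => weight α s * leftSolDeriv κ s) =ᶠ[𝓝 r]
      fun s => κ * s * besselIDeriv (κ * s) / besselI κ := by
    filter_upwards [Ioo_mem_nhds hr hr1] with s hs
    rw [weight_of_le_one α hs.1.le hs.2.le, leftSolDeriv]; ring
  refine ((h.div_const (besselI κ)).congr_of_eventuallyEq e).congr_deriv ?_
  rw [weight_of_le_one α hr.le hr1.le, leftSol]; ring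

theorem rightSol_pos (α : ℝ) (hκ : 0 < κ) {r : ℝ} (hr : 0 < r) : 0 < rightSol α κ r :=
  div_pos (besselK_pos α (mul_pos hκ hr)) (besselK_pos α hκ)

theorem rightSol_one (α : ℝ) (hκ : 0 < κ) : rightSol α κ 1 = 1 := by
  rw [rightSol, mul_one, div_self (besselK_pos α hκ).ne']

theorem hasDerivAt_rightSol (α : ℝ) (hκ : 0 < κ) {r : ℝ} (hr : 0 < r) :
    HasDerivAt (rightSol α κ) (rightSolDeriv α κ r) r := by
  have h := (hasDerivAt_besselK α (mul_pos hκ hr)).comp r ((hasDerivAt_id r).const_mul κ)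
  refine (h.div_const (besselK α κ)).congr_deriv ?_
  rw [rightSolDeriv]; ring

theorem rightSolDeriv_neg (α : ℝ) (hκ : 0 < κ) {r : ℝ} (hr : 0 < r) : rightSolDeriv α κ r < 0 :=
  div_neg_of_neg_of_pos (mul_neg_of_pos_of_neg hκ (besselKDeriv_neg α (mul_pos hκ hr)))
    (besselK_pos α hκ)

theorem continuousOn_rightSol (α : ℝ) (hκ : 0 < κ) : ContinuousOn (rightSol α κ) (Ioi 0) :=
  fun _ hr => (hasDerivAt_rightSol α hκ hr).continuousAt.continuousWithinAt

theorem continuousOn_rightSolDeriv (α : ℝ) (hκ : 0 < κ) :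
    ContinuousOn (rightSolDeriv α κ) (Ioi 0) := by
  intro r hr
  have h := (hasDerivAt_besselKDeriv α (mul_pos hκ hr)).comp r ((hasDerivAt_id r).const_mul κ)
  exact ((h.const_mul κ).div_const (besselK α κ)).continuousAt.continuousWithinAt

theorem hasDerivAt_rightSol_flux (α : ℝ) (hκ : 0 < κ) {r : ℝ} (hr1 : 1 < r) :
    HasDerivAt (fun s => weight α s * rightSolDeriv α κ s)
      (κ ^ 2 * (weight α r * rightSol α κ r)) r := by
  have hr : 0 < r := one_pos.trans hr1
  have h := (hasDerivAt_besselK_flux α (mul_pos hκ hr)).comp r ((hasDerivAt_id r).const_mul κ)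
  set c := κ ^ (1 - 2 * α) with hc
  have hc0 : 0 < c := Real.rpow_pos_of_pos hκ _
  have e : (fun s => weight α s * rightSolDeriv α κ s) =ᶠ[𝓝 r]
      fun s => (κ / c / besselK α κ) * ((κ * s) ^ (1 - 2 * α) * besselKDeriv α (κ * s)) := by
    filter_upwards [Ioi_mem_nhds hr1] with s hs
    have hs1 : (1 : ℝ) < s := hs
    rw [weight_of_one_le α hs1.le, rightSolDeriv, Real.mul_rpow hκ.le (one_pos.trans hs1).le, ← hc]
    field_simp
  refine ((h.const_mul (κ / c / besselK α κ)).congr_of_eventuallyEq e).congr_deriv ?_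
  rw [weight_of_one_le α hr1.le, rightSol, Real.mul_rpow hκ.le hr.le, ← hc]
  field_simp

/-- The jump of logarithmic derivatives at `r = 1` between the left and the right solution. -/
def slopeGap (α κ : ℝ) : ℝ := leftSolDeriv κ 1 - rightSolDeriv α κ 1

theorem slopeGap_pos (α : ℝ) (hκ : 0 < κ) : 0 < slopeGap α κ := by
  have h1 := leftSolDeriv_nonneg hκ zero_le_one
  have h2 := rightSolDeriv_neg α hκ one_pos
  rw [slopeGap]; linarith

/-- The solution on `(0, ∞)` that is regular at `0`. -/
def regularSol (α κ r : ℝ) : ℝ :=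
  if r ≤ 1 then leftSol κ r
  else rightSol α κ r * reductionFactor α (rightSol α κ) 1 (slopeGap α κ) r

/-- The derivative of `regularSol`. -/
def regularSolDeriv (α κ r : ℝ) : ℝ :=
  if r ≤ 1 then leftSolDeriv κ r
  else rightSolDeriv α κ r * reductionFactor α (rightSol α κ) 1 (slopeGap α κ) r
    + slopeGap α κ * (weight α r * rightSol α κ r)⁻¹

/-- The solution on `(0, ∞)` that decays at infinity, normalised so that its weighted Wronskian with
`regularSol` is `1`. -/
def decayingSol (α κ r : ℝ) : ℝ :=
  if r ≤ 1 then leftSol κ r * reductionFactor α (leftSol κ) (slopeGap α κ)⁻¹ (-1) r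
  else (slopeGap α κ)⁻¹ * rightSol α κ r

/-- The derivative of `decayingSol`. -/
def decayingSolDeriv (α κ r : ℝ) : ℝ :=
  if r ≤ 1 then leftSolDeriv κ r * reductionFactor α (leftSol κ) (slopeGap α κ)⁻¹ (-1) r
    + (-1) * (weight α r * leftSol κ r)⁻¹
  else (slopeGap α κ)⁻¹ * rightSolDeriv α κ r

theorem weight_one (α : ℝ) : weight α 1 = 1 := weight_of_le_one α zero_le_one le_rfl

theorem isSolution_regularSol (α : ℝ) (hκ : 0 < κ) :
    IsSolution α κ (regularSol α κ) (regularSolDeriv α κ) := by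
  have hc := continuousOn_rightSol α hκ
  have hp : ∀ r, 0 < r → 0 < rightSol α κ r := fun r hr => rightSol_pos α hκ hr
  have hR := continuousOn_reductionFactor (α := α) hc hp 1 (slopeGap α κ)
  have hi : ContinuousOn (fun r => (weight α r * rightSol α κ r)⁻¹) (Ioi 0) :=
    ((continuous_weight α).continuousOn.mul hc).inv₀ fun r hr =>
      (mul_pos (weight_pos α hr) (hp r hr)).ne'
  refine IsSolution.glue (continuous_leftSol κ).continuousOn (continuous_leftSolDeriv κ).continuousOn
    (hc.mul hR) (((continuousOn_rightSolDeriv α hκ).mul hR).add (continuousOn_const.mul hi)) ?_ ?_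
    (fun r _ _ => hasDerivAt_leftSol κ r) (fun r hr hr1 => hasDerivAt_leftSol_flux α κ hr hr1)
    (fun r hr => hasDerivAt_mul_reductionFactor hc hp 1 _ (one_pos.trans hr)
      (hasDerivAt_rightSol α hκ (one_pos.trans hr)))
    (fun r hr => hasDerivAt_flux_mul_reductionFactor hc hp 1 _ (one_pos.trans hr)
      (hasDerivAt_rightSol α hκ (one_pos.trans hr)) (hasDerivAt_rightSol_flux α hκ hr))
  · rw [leftSol_one, rightSol_one α hκ, reductionFactor_one, one_mul]
  · rw [reductionFactor_one, rightSol_one α hκ, weight_one, slopeGap]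
    ring

theorem isSolution_decayingSol (α : ℝ) (hκ : 0 < κ) :
    IsSolution α κ (decayingSol α κ) (decayingSolDeriv α κ) := by
  have hc := (continuous_leftSol κ).continuousOn (s := Ioi 0)
  have hp : ∀ r, 0 < r → 0 < leftSol κ r := fun r _ => leftSol_pos κ r
  have hR := continuousOn_reductionFactor (α := α) hc hp (slopeGap α κ)⁻¹ (-1)
  have hi : ContinuousOn (fun r => (weight α r * leftSol κ r)⁻¹) (Ioi 0) :=
    ((continuous_weight α).continuousOn.mul hc).inv₀ fun r hr =>
      (mul_pos (weight_pos α hr) (hp r hr)).ne'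
  have hg := (slopeGap_pos α hκ).ne'
  refine IsSolution.glue (hc.mul hR)
    (((continuous_leftSolDeriv κ).continuousOn.mul hR).add (continuousOn_const.mul hi))
    (continuousOn_const.mul (continuousOn_rightSol α hκ))
    (continuousOn_const.mul (continuousOn_rightSolDeriv α hκ)) ?_ ?_
    (fun r hr _ => hasDerivAt_mul_reductionFactor hc hp _ _ hr (hasDerivAt_leftSol κ r))
    (fun r hr hr1 => hasDerivAt_flux_mul_reductionFactor hc hp _ _ hr
      (hasDerivAt_leftSol κ r) (hasDerivAt_leftSol_flux α κ hr hr1))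
    (fun r hr => (hasDerivAt_rightSol α hκ (one_pos.trans hr)).const_mul _) (fun r hr => ?_)
  · rw [leftSol_one, rightSol_one α hκ, reductionFactor_one]; ring
  · rw [reductionFactor_one, leftSol_one, weight_one]
    rw [slopeGap] at hg ⊢
    field_simp
    ring
  · have h := (hasDerivAt_rightSol_flux α hκ hr).const_mul (slopeGap α κ)⁻¹
    refine (h.congr_of_eventuallyEq (Eventually.of_forall fun s => ?_)).congr_deriv ?_
    · ring
    · ring

theorem decayingSol_of_one_le (α κ : ℝ) {r : ℝ} (hκ : 0 < κ) (hr : 1 ≤ r) :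
    decayingSol α κ r = (slopeGap α κ)⁻¹ * rightSol α κ r := by
  rcases hr.eq_or_lt with rfl | h
  · rw [decayingSol, if_pos le_rfl, leftSol_one, reductionFactor_one, rightSol_one α hκ]; ring
  · rw [decayingSol, if_neg (not_le.2 h)]

theorem decayingSolDeriv_of_one_le (α κ : ℝ) {r : ℝ} (hκ : 0 < κ) (hr : 1 ≤ r) :
    decayingSolDeriv α κ r = (slopeGap α κ)⁻¹ * rightSolDeriv α κ r := by
  have hg := (slopeGap_pos α hκ).ne'
  rcases hr.eq_or_lt with rfl | h
  · rw [decayingSolDeriv, if_pos le_rfl, leftSol_one, reductionFactor_one, weight_one]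
    rw [slopeGap] at hg ⊢
    field_simp
    ring
  · rw [decayingSolDeriv, if_neg (not_le.2 h)]

theorem decayingSol_pos (α : ℝ) (hκ : 0 < κ) {r : ℝ} (hr : 1 ≤ r) : 0 < decayingSol α κ r := by
  rw [decayingSol_of_one_le α κ hκ hr]
  exact mul_pos (inv_pos.2 (slopeGap_pos α hκ)) (rightSol_pos α hκ (one_pos.trans_le hr))

theorem decayingSolDeriv_neg (α : ℝ) (hκ : 0 < κ) {r : ℝ} (hr : 1 ≤ r) :
    decayingSolDeriv α κ r < 0 := by
  rw [decayingSolDeriv_of_one_le α κ hκ hr]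
  exact mul_neg_of_pos_of_neg (inv_pos.2 (slopeGap_pos α hκ))
    (rightSolDeriv_neg α hκ (one_pos.trans_le hr))

theorem wronskian_eq_one (α : ℝ) (hκ : 0 < κ) {r : ℝ} (hr : 0 < r) :
    weight α r * (regularSolDeriv α κ r * decayingSol α κ r
      - regularSol α κ r * decayingSolDeriv α κ r) = 1 := by
  have hg := (slopeGap_pos α hκ).ne'
  have hw := (weight_pos α hr).ne'
  have hl := (leftSol_pos κ r).ne'
  have hrs := (rightSol_pos α hκ hr).ne'
  simp only [regularSol, regularSolDeriv, decayingSol, decayingSolDeriv]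
  split_ifs
  · field_simp
    ring
  · field_simp
    ring

theorem regularSol_of_le_one (α κ : ℝ) {r : ℝ} (hr : r ≤ 1) : regularSol α κ r = leftSol κ r :=
  if_pos hr

/-- The Green function of `T_α + κ²`. -/
def resolventKernel (α κ : ℝ) : ℝ → ℝ → ℝ := greenFun α (regularSol α κ) (decayingSol α κ)

theorem isResolventKernel_resolventKernel (hα : 0 ≤ α) (hκ : 0 < κ) :
    IsResolventKernel α κ fun r s => (resolventKernel α κ r s : ℂ) := by
  obtain ⟨M, hM⟩ := isCompact_Icc.exists_bound_of_continuousOn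
    ((continuous_leftSolDeriv κ).continuousOn (s := Icc 0 1))
  refine isResolventKernel_greenFun (M := max 1 M) hα hκ (isSolution_regularSol α hκ)
    (isSolution_decayingSol α hκ) (fun t ht => ?_) (fun t ht => ?_)
    (fun r hr => (decayingSol_pos α hκ hr).le) (fun r hr => (decayingSolDeriv_neg α hκ hr).le)
    (fun r hr => wronskian_eq_one α hκ hr)
  · rw [regularSol_of_le_one α κ ht.2, abs_of_pos (leftSol_pos κ t)]
    exact (leftSol_le_one hκ ht.1.le ht.2).trans (le_max_left _ _)
  · rw [regularSolDeriv, if_pos ht.2]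
    exact (hM t ⟨ht.1.le, ht.2⟩).trans (le_max_right _ _)

end Sol

/-! ### Bounds for a single Green function -/

section Bounds

variable {α κ : ℝ}

theorem regularSol_pos (α : ℝ) (hκ : 0 < κ) {r : ℝ} (hr : 0 < r) : 0 < regularSol α κ r := by
  rw [regularSol]
  split_ifs with h
  · exact leftSol_pos κ r
  · refine mul_pos (rightSol_pos α hκ hr) ?_
    rw [reductionFactor]
    have h1 : 0 ≤ ∫ s in (1 : ℝ)..r, (weight α s * rightSol α κ s ^ 2)⁻¹ :=
      intervalIntegral.integral_nonneg (not_le.1 h).le fun s hs =>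
        inv_nonneg.2 (mul_nonneg (weight_pos α (one_pos.trans_le hs.1)).le (sq_nonneg _))
    have h2 := mul_nonneg (slopeGap_pos α hκ).le h1
    linarith

theorem regularSol_flux_nonneg (α : ℝ) (hκ : 0 < κ) {r : ℝ} (hr : 1 ≤ r) :
    0 ≤ weight α r * regularSolDeriv α κ r := by
  have hs := isSolution_regularSol α hκ
  have hmono : MonotoneOn (fun s => weight α s * regularSolDeriv α κ s) (Ici 1) := by
    have hd : ∀ t ∈ interior (Ici (1 : ℝ)), HasDerivAt
        (fun s => weight α s * regularSolDeriv α κ s)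
        (κ ^ 2 * (weight α t * regularSol α κ t)) t := fun t ht => by
      rw [interior_Ici] at ht
      exact hs.hasDerivAt_flux t (one_pos.trans ht) (ne_of_gt ht)
    refine monotoneOn_of_deriv_nonneg (convex_Ici 1) ?_
      (fun t ht => (hd t ht).differentiableAt.differentiableWithinAt) (fun t ht => ?_)
    · exact ((continuous_weight α).continuousOn.mul hs.continuousOn_deriv).mono
        fun t ht => mem_Ioi.2 (one_pos.trans_le ht)
    · rw [(hd t ht).deriv]
      have ht0 : 0 < t := one_pos.trans_le (interior_subset ht)
      exact mul_nonneg (sq_nonneg _) (mul_pos (weight_pos α ht0) (regularSol_pos α hκ ht0)).le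
  have h1 := hmono (mem_Ici.2 le_rfl) (mem_Ici.2 hr) hr
  refine le_trans ?_ h1
  simp only [weight_one, one_mul, regularSolDeriv, if_pos le_rfl]
  exact leftSolDeriv_nonneg hκ zero_le_one

/-- The Wronskian identity with the nonnegative term `w u' v` dropped. -/
theorem regularSol_mul_flux_le (α : ℝ) (hκ : 0 < κ) {r : ℝ} (hr : 1 ≤ r) :
    regularSol α κ r * -(weight α r * decayingSolDeriv α κ r) ≤ 1 := by
  have h1 := wronskian_eq_one α hκ (one_pos.trans_le hr)
  have h2 := mul_nonneg (regularSol_flux_nonneg α hκ hr) (decayingSol_pos α hκ hr).le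
  linarith

theorem resolventKernel_comm (α κ r s : ℝ) : resolventKernel α κ r s = resolventKernel α κ s r :=
  greenFun_comm _ _ _ _ _

theorem resolventKernel_of_le (α κ : ℝ) {r s : ℝ} (h : r ≤ s) :
    resolventKernel α κ r s
      = groundState α r * groundState α s * (regularSol α κ r * decayingSol α κ s) :=
  greenFun_of_le _ _ _ h

theorem resolventKernel_pos (α : ℝ) (hκ : 0 < κ) {r s : ℝ} (hr : 1 ≤ r) (hs : r ≤ s) :
    0 < resolventKernel α κ r s := by
  have hr0 := one_pos.trans_le hr
  rw [resolventKernel_of_le α κ hs]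
  exact mul_pos (mul_pos (groundState_pos α hr0) (groundState_pos α (hr0.trans_le hs)))
    (mul_pos (regularSol_pos α hκ hr0) (decayingSol_pos α hκ (hr.trans hs)))

theorem resolventKernel_mul_flux_le (α : ℝ) (hκ : 0 < κ) {r s : ℝ} (hr : 1 ≤ r) (hs : r ≤ s) :
    resolventKernel α κ r s * (weight α r * (κ * -besselKDeriv α (κ * r)))
      ≤ groundState α r * groundState α s * besselK α (κ * s) := by
  have hr0 := one_pos.trans_le hr
  have hφ := mul_pos (groundState_pos α hr0) (groundState_pos α (hr0.trans_le hs))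
  have hK := besselK_pos α (mul_pos hκ (hr0.trans_le hs))
  have h := mul_le_mul_of_nonneg_left (regularSol_mul_flux_le α hκ hr) (mul_pos hφ hK).le
  rw [mul_one] at h
  refine le_trans (le_of_eq ?_) h
  have h1 := (besselK_pos α hκ).ne'
  have h2 := (slopeGap_pos α hκ).ne'
  rw [resolventKernel_of_le α κ hs, decayingSol_of_one_le α κ hκ (hr.trans hs),
    decayingSolDeriv_of_one_le α κ hκ hr, rightSol, rightSolDeriv]
  field_simp

theorem resolventKernel_diag_le (hα0 : 0 ≤ α) (hα1 : α < 1) (hκ : 0 < κ) {r : ℝ} (hr : 1 ≤ r)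
    (hx : 1 ≤ κ * r) : resolventKernel α κ r r ≤ 4 / κ := by
  have hr0 := one_pos.trans_le hr
  have h := resolventKernel_mul_flux_le α hκ hr le_rfl
  have hK := besselK_pos α (mul_pos hκ hr0)
  have hw := weight_pos α hr0
  have hG := resolventKernel_pos α hκ hr le_rfl
  have hl := besselK_logDeriv_ge hα0 hα1 hx
  have e : groundState α r * groundState α r = weight α r := by rw [weight, sq]
  rw [e, mul_left_comm] at h
  have h2 := le_of_mul_le_mul_left h hw
  rw [← neg_div, le_div_iff₀ hK] at hl
  rw [le_div_iff₀ hκ]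
  have h3 := mul_le_mul_of_nonneg_left hl (mul_pos hG hκ).le
  have h4 : resolventKernel α κ r r * κ * (1 / 4) ≤ 1 := by
    refine le_of_mul_le_mul_right ?_ hK
    linarith
  linarith

theorem resolventKernel_one_one (α : ℝ) (hκ : 0 < κ) :
    resolventKernel α κ 1 1 = (slopeGap α κ)⁻¹ := by
  rw [resolventKernel_of_le α κ le_rfl, groundState_one, regularSol_of_le_one α κ le_rfl,
    leftSol_one, decayingSol_of_one_le α κ hκ le_rfl, rightSol_one α hκ]
  ring

/-- To the right of `1`, a slice of the Green function is a multiple of `decayFun`. -/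
theorem resolventKernel_eq_diag_mul (α : ℝ) (hκ : 0 < κ) {r s : ℝ} (hr : 1 ≤ r) (hs : r ≤ s) :
    resolventKernel α κ r s
      = resolventKernel α κ r r * (decayFun α (κ * s) / decayFun α (κ * r)) := by
  have hr0 := one_pos.trans_le hr
  have h1 := (besselK_pos α hκ).ne'
  have h2 := (slopeGap_pos α hκ).ne'
  have h3 := (besselK_pos α (mul_pos hκ hr0)).ne'
  have h4 := (Real.rpow_pos_of_pos hr0 (1 / 2 - α)).ne'
  have h5 := (Real.rpow_pos_of_pos hκ (1 / 2 - α)).ne'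
  rw [resolventKernel_of_le α κ hs, resolventKernel_of_le α κ le_rfl,
    decayingSol_of_one_le α κ hκ (hr.trans hs), decayingSol_of_one_le α κ hκ hr,
    groundState_of_one_le α hr, groundState_of_one_le α (hr.trans hs), rightSol, rightSol,
    decayFun, decayFun, Real.mul_rpow hκ.le hr0.le, Real.mul_rpow hκ.le (hr0.trans_le hs).le]
  field_simp

/-- The first-order equation satisfied by the diagonal of the Green function. -/
theorem hasDerivAt_resolventKernel_diag (α : ℝ) (hκ : 0 < κ) {r : ℝ} (hr : 1 < r) :
    HasDerivAt (fun t => resolventKernel α κ t t)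
      (1 - 2 * (κ * decayRate α (κ * r)) * resolventKernel α κ r r) r := by
  have hr0 := one_pos.trans hr
  have e : (fun t => resolventKernel α κ t t) =ᶠ[𝓝 r]
      fun t => t ^ (1 - 2 * α) * (regularSol α κ t * decayingSol α κ t) := by
    filter_upwards [Ioi_mem_nhds hr] with t ht
    rw [resolventKernel_of_le α κ le_rfl, ← weight_of_one_le α (le_of_lt ht), weight, sq]
  have d := (Real.hasDerivAt_rpow_const (p := 1 - 2 * α) (Or.inl hr0.ne')).mul
    (((isSolution_regularSol α hκ).hasDerivAt r hr0 hr.ne').mul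
      ((isSolution_decayingSol α hκ).hasDerivAt r hr0 hr.ne'))
  refine (d.congr_of_eventuallyEq e).congr_deriv ?_
  have hW := wronskian_eq_one α hκ hr0
  have h1 := (besselK_pos α hκ).ne'
  have h2 := (slopeGap_pos α hκ).ne'
  have h3 := (besselK_pos α (mul_pos hκ hr0)).ne'
  have hv : decayingSol α κ r * (κ * besselKDeriv α (κ * r) / besselK α (κ * r))
      = decayingSolDeriv α κ r := by
    rw [decayingSol_of_one_le α κ hκ hr.le, decayingSolDeriv_of_one_le α κ hκ hr.le, rightSol,
      rightSolDeriv]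
    field_simp
  have hρ : κ * decayRate α (κ * r)
      = -((1 / 2 - α) / r) - κ * besselKDeriv α (κ * r) / besselK α (κ * r) := by
    rw [decayRate]
    field_simp
    ring
  have hE : resolventKernel α κ r r = weight α r * (regularSol α κ r * decayingSol α κ r) := by
    rw [resolventKernel_of_le α κ le_rfl, weight, sq]
  rw [hρ, hE, Real.rpow_sub_one hr0.ne', ← weight_of_one_le α hr.le]
  rw [← hv] at hW ⊢
  simp only [Pi.mul_apply]
  linear_combination hW

theorem continuousOn_resolventKernel_diag (α : ℝ) (hκ : 0 < κ) :
    ContinuousOn (fun t => resolventKernel α κ t t) (Ioi 0) := by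
  have h : ContinuousOn (fun t => groundState α t * groundState α t *
      (regularSol α κ t * decayingSol α κ t)) (Ioi 0) :=
    ((continuous_groundState α).continuousOn.mul (continuous_groundState α).continuousOn).mul
      ((isSolution_regularSol α hκ).continuousOn.mul (isSolution_decayingSol α hκ).continuousOn)
  exact h.congr fun t _ => resolventKernel_of_le α κ le_rfl

end Bounds

/-! ### Comparison of two Green functions -/

section Comparison

variable {α κ : ℝ}

theorem abs_resolventKernel_one_one_sub_le (hα0 : 0 ≤ α) (hα1 : α < 1) (hκ : 1 ≤ κ) :
    |resolventKernel α κ 1 1 - resolventKernel 0 κ 1 1| ≤ 32 / κ ^ 2 := by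
  have hκ0 := one_pos.trans_le hκ
  have a1 := resolventKernel_diag_le hα0 hα1 hκ0 le_rfl (by rwa [mul_one])
  have a2 := resolventKernel_diag_le le_rfl one_pos hκ0 le_rfl (by rwa [mul_one])
  have p1 := slopeGap_pos α hκ0
  have p2 := slopeGap_pos 0 hκ0
  rw [resolventKernel_one_one α hκ0] at a1 ⊢
  rw [resolventKernel_one_one 0 hκ0] at a2 ⊢
  have hd : |slopeGap 0 κ - slopeGap α κ| ≤ 2 := by
    have h1 := abs_decayRate_sub_le le_rfl one_pos hα0 hα1 hκ
    have e : slopeGap 0 κ - slopeGap α κ = κ * (decayRate 0 κ - decayRate α κ) + α := by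
      have k1 := (besselK_pos α hκ0).ne'
      have k2 := (besselK_pos 0 hκ0).ne'
      rw [slopeGap, slopeGap, rightSolDeriv, rightSolDeriv, decayRate, decayRate, mul_one]
      field_simp
      ring
    have h2 : κ * |decayRate 0 κ - decayRate α κ| ≤ 1 := by
      have h3 := mul_le_mul_of_nonneg_left h1 hκ0.le
      have h4 : κ * (1 / κ ^ 2) ≤ 1 := by
        rw [mul_one_div, div_le_one (by positivity)]; nlinarith
      linarith
    rw [e]
    refine (abs_add_le _ _).trans ?_
    rw [abs_mul, abs_of_pos hκ0, abs_of_nonneg hα0]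
    linarith
  have e : (slopeGap α κ)⁻¹ - (slopeGap 0 κ)⁻¹
      = (slopeGap α κ)⁻¹ * (slopeGap 0 κ)⁻¹ * (slopeGap 0 κ - slopeGap α κ) := by
    field_simp
  rw [e, abs_mul, abs_of_pos (mul_pos (inv_pos.2 p1) (inv_pos.2 p2))]
  calc (slopeGap α κ)⁻¹ * (slopeGap 0 κ)⁻¹ * |slopeGap 0 κ - slopeGap α κ|
      ≤ 4 / κ * (4 / κ) * 2 := by
        refine mul_le_mul (mul_le_mul a1 a2 (inv_pos.2 p2).le (by positivity)) hd (abs_nonneg _)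
          (by positivity)
    _ = 32 / κ ^ 2 := by field_simp; norm_num

/-- The diagonals satisfy `E' = 1 - 2 ρ E` with rates `ρ` that differ by `O(1 / (κ r²))`; the
function `32 / (κ² r)` is a barrier for their difference. -/
theorem abs_resolventKernel_diag_sub_le (hα0 : 0 ≤ α) (hα1 : α < 1) (hκ : 0 < κ) {r : ℝ}
    (hr : 1 ≤ r) (hx : 1 ≤ κ * r) :
    |resolventKernel α κ r r - resolventKernel 0 κ r r| ≤ 32 / (κ ^ 2 * r) := by
  -- the comparison starts at `a = max(1, 1/κ)`
  obtain ⟨a, ha1, hax, har, hbase⟩ : ∃ a : ℝ, 1 ≤ a ∧ 1 ≤ κ * a ∧ a ≤ r ∧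
      |resolventKernel α κ a a - resolventKernel 0 κ a a| ≤ 32 / (κ ^ 2 * a) := by
    rcases le_total 1 κ with h | h
    · refine ⟨1, le_rfl, by rwa [mul_one], hr, ?_⟩
      rw [mul_one]
      exact abs_resolventKernel_one_one_sub_le hα0 hα1 h
    · have h1 : 1 ≤ κ⁻¹ := (one_le_inv₀ hκ).2 h
      have h2 : 1 ≤ κ * κ⁻¹ := (mul_inv_cancel₀ hκ.ne').ge
      refine ⟨κ⁻¹, h1, h2, ?_, ?_⟩
      · rwa [inv_le_iff_one_le_mul₀' hκ]
      · have b1 := resolventKernel_diag_le hα0 hα1 hκ h1 h2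
        have b2 := resolventKernel_diag_le le_rfl one_pos hκ h1 h2
        have b3 := resolventKernel_pos α hκ h1 le_rfl
        have b4 := resolventKernel_pos 0 hκ h1 le_rfl
        have e : 32 / (κ ^ 2 * κ⁻¹) = 8 * (4 / κ) := by field_simp; norm_num
        have : 0 < 4 / κ := by positivity
        rw [e, abs_le]
        constructor <;> linarith
  have ha0 : 0 < a := one_pos.trans_le ha1
  have key : ∀ σ : ℝ, |σ| = 1 →
      0 ≤ 32 / (κ ^ 2 * r) + σ * (resolventKernel α κ r r - resolventKernel 0 κ r r) := by
    intro σ hσ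
    set M : ℝ → ℝ := fun t =>
      32 / κ ^ 2 * t⁻¹ + σ * (resolventKernel α κ t t - resolventKernel 0 κ t t) with hM
    have hMv : ∀ t, 32 / (κ ^ 2 * t)
        + σ * (resolventKernel α κ t t - resolventKernel 0 κ t t) = M t := fun t => by
      simp only [hM]; rw [← div_div, div_eq_mul_inv _ t]
    set P : ℝ → ℝ := fun t => (decayFun α (κ * t) ^ 2)⁻¹ with hP
    have hPpos : ∀ t, 0 < t → 0 < P t := fun t ht =>
      inv_pos.2 (pow_pos (decayFun_pos α (mul_pos hκ ht)) 2)
    have hPd : ∀ t, 0 < t → HasDerivAt P (2 * (κ * decayRate α (κ * t)) * P t) t := fun t ht => by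
      have h0 := (decayFun_pos α (mul_pos hκ ht)).ne'
      have h1 := (hasDerivAt_decayFun α (mul_pos hκ ht)).comp t ((hasDerivAt_id t).const_mul κ)
      refine ((h1.pow 2).inv (pow_ne_zero 2 h0)).congr_deriv ?_
      simp only [hP, Function.comp_apply, Pi.pow_apply]
      field_simp
      ring
    have hMd : ∀ t, 1 < t → HasDerivAt M (32 / κ ^ 2 * (-(t ^ 2)⁻¹)
        + σ * ((1 - 2 * (κ * decayRate α (κ * t)) * resolventKernel α κ t t)
          - (1 - 2 * (κ * decayRate 0 (κ * t)) * resolventKernel 0 κ t t))) t := fun t ht =>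
      ((hasDerivAt_inv (one_pos.trans ht).ne').const_mul _).add
        (((hasDerivAt_resolventKernel_diag α hκ ht).sub
          (hasDerivAt_resolventKernel_diag 0 hκ ht)).const_mul σ)
    have hMc : ContinuousOn M (Ici a) := by
      refine ContinuousOn.mono (s := Ioi 0) ?_ fun t ht => mem_Ioi.2 (ha0.trans_le ht)
      exact (continuousOn_const.mul (continuousOn_inv₀.mono fun t ht => ne_of_gt ht)).add
        (continuousOn_const.mul ((continuousOn_resolventKernel_diag α hκ).sub
          (continuousOn_resolventKernel_diag 0 hκ)))
    -- `P` is an integrating factor for `M' ≥ -2 ρ M`; the rate is at least `3κ/4` and the other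
    -- diagonal at most `4/κ`, which leaves `48/x ≥ 32/x² + 8/x²`.
    have hmono : MonotoneOn (fun t => M t * P t) (Ici a) := by
      have hd : ∀ t ∈ interior (Ici a), HasDerivAt (fun t => M t * P t) _ t := fun t ht => by
        rw [interior_Ici] at ht
        exact (hMd t (ha1.trans_lt ht)).mul (hPd t (ha0.trans ht))
      refine monotoneOn_of_deriv_nonneg (convex_Ici a)
        (hMc.mul fun t ht => (hPd t (ha0.trans_le ht)).continuousAt.continuousWithinAt)
        (fun t ht => (hd t ht).differentiableAt.differentiableWithinAt) (fun t ht => ?_)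
      rw [(hd t ht).deriv]
      have hta := interior_subset ht
      have ht0 : 0 < t := ha0.trans_le hta
      have ht1 : 1 ≤ t := ha1.trans hta
      have hxt : 1 ≤ κ * t := hax.trans (mul_le_mul_of_nonneg_left hta hκ.le)
      set x := κ * t with hxdef
      have hx0 : 0 < x := one_pos.trans_le hxt
      set E := resolventKernel α κ t t
      set E₀ := resolventKernel 0 κ t t with hE₀
      have hE₀le : E₀ ≤ 4 / κ := resolventKernel_diag_le le_rfl one_pos hκ ht1 hxt
      have hE₀pos : 0 < E₀ := resolventKernel_pos 0 hκ ht1 le_rfl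
      have hρ := decayRate_ge hα0 hα1 hxt
      have hρd := abs_decayRate_sub_le le_rfl one_pos hα0 hα1 hxt
      have hdiff : -(8 / x ^ 2) ≤ 2 * (σ * ((κ * (decayRate 0 x - decayRate α x)) * E₀)) := by
        have h1 : |2 * (σ * ((κ * (decayRate 0 x - decayRate α x)) * E₀))| ≤ 8 / x ^ 2 := by
          rw [abs_mul, abs_mul, abs_mul, abs_mul, hσ, abs_of_pos hκ, abs_of_pos hE₀pos,
            abs_of_pos (by norm_num : (0 : ℝ) < 2), one_mul]
          calc 2 * (κ * |decayRate 0 x - decayRate α x| * E₀)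
              ≤ 2 * (κ * (1 / x ^ 2) * (4 / κ)) := by gcongr
            _ = 8 / x ^ 2 := by field_simp; norm_num
        exact (abs_le.1 h1).1
      have hmain : 0 ≤ 32 / κ ^ 2 * (-(t ^ 2)⁻¹) + 2 * (κ * decayRate α x) * (32 / κ ^ 2 * t⁻¹)
          - 8 / x ^ 2 := by
        have e1 : 32 / κ ^ 2 * (-(t ^ 2)⁻¹) = -(32 / x ^ 2) := by rw [hxdef]; field_simp
        have e2 : 2 * (κ * decayRate α x) * (32 / κ ^ 2 * t⁻¹) = decayRate α x * (64 / x) := by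
          rw [hxdef]; field_simp; ring
        have e3 : 48 / x ≤ decayRate α x * (64 / x) := by
          have h0 : 0 < 64 / x := by positivity
          have e4 : 48 / x = 3 / 4 * (64 / x) := by field_simp; norm_num
          rw [e4]
          exact mul_le_mul_of_nonneg_right hρ h0.le
        have e4 : 40 / x ^ 2 ≤ 48 / x := by
          rw [div_le_div_iff₀ (by positivity) hx0]; nlinarith
        have e5 : 40 / x ^ 2 = 32 / x ^ 2 + 8 / x ^ 2 := by ring
        rw [e1, e2]
        linarith
      have hPt := hPpos t ht0
      have : 0 ≤ (32 / κ ^ 2 * (-(t ^ 2)⁻¹) + 2 * (κ * decayRate α x) * (32 / κ ^ 2 * t⁻¹)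
          + 2 * (σ * ((κ * (decayRate 0 x - decayRate α x)) * E₀))) * P t :=
        mul_nonneg (by linarith) hPt.le
      refine this.trans (le_of_eq ?_)
      simp only [hM]
      ring
    have h1 := hmono (mem_Ici.2 le_rfl) (mem_Ici.2 har) har
    have h2 : 0 ≤ M a := by
      rw [← hMv]
      have h3 : |σ * (resolventKernel α κ a a - resolventKernel 0 κ a a)| ≤ 32 / (κ ^ 2 * a) := by
        rw [abs_mul, hσ, one_mul]; exact hbase
      linarith [(abs_le.1 h3).1]
    rw [hMv]
    refine nonneg_of_mul_nonneg_left (b := P r) ?_ (hPpos r (one_pos.trans_le hr))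
    exact (mul_nonneg h2 (hPpos a ha0).le).trans h1
  rw [abs_le]
  have k1 := key 1 (by simp)
  have k2 := key (-1) (by simp)
  constructor <;> linarith

theorem mul_groundState_of_one_le {α r s : ℝ} (hr : 1 ≤ r) (hs : 1 ≤ s) :
    groundState α r * groundState α s = (r * s) ^ (1 / 2 - α) := by
  rw [groundState_of_one_le α hr, groundState_of_one_le α hs,
    Real.mul_rpow (zero_le_one.trans hr) (zero_le_one.trans hs)]

theorem rpow_mul_mul_rpow {κ m : ℝ} (hκ : 0 < κ) (hm : 0 < m) (α : ℝ) :
    κ ^ (-2 * α) * m ^ (1 / 2 - α) = κ⁻¹ * (κ ^ 2 * m) ^ (1 / 2 - α) := by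
  rw [Real.mul_rpow (by positivity) hm.le, ← Real.rpow_natCast, ← Real.rpow_mul hκ.le,
    ← Real.rpow_neg_one, ← mul_assoc, ← Real.rpow_add hκ]
  congr 2
  push_cast
  ring

/-- The comparison at distances from the origin larger than the length scale `1 / κ`. -/
theorem abs_resolventKernel_sub_le_of_one_le_mul (hα0 : 0 ≤ α) (hα1 : α < 1) (hκ : 0 < κ)
    {r s : ℝ} (hr : 1 ≤ r) (hs : r ≤ s) (hx : 1 ≤ κ * r) :
    |resolventKernel α κ r s - resolventKernel 0 κ r s|
      ≤ 44 * (κ ^ (-2 * α) * (groundState α r * groundState α s)) := by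
  have hr0 : 0 < r := one_pos.trans_le hr
  have hs0 : 0 < s := hr0.trans_le hs
  have hδ := abs_resolventKernel_diag_sub_le hα0 hα1 hκ hr hx
  have hE := resolventKernel_diag_le le_rfl one_pos hκ hr hx
  have hE0 := resolventKernel_pos 0 hκ hr le_rfl
  have hxy : κ * r ≤ κ * s := mul_le_mul_of_nonneg_left hs hκ.le
  have e0 : 32 / (κ ^ 2 * r) = 32 / (κ * (κ * r)) := by ring
  rw [resolventKernel_eq_diag_mul α hκ hr hs, resolventKernel_eq_diag_mul 0 hκ hr hs,
    mul_groundState_of_one_le hr (hr.trans hs), rpow_mul_mul_rpow hκ (mul_pos hr0 hs0)]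
  have e1 : κ ^ 2 * (r * s) = κ * r * (κ * s) := by ring
  rw [e1]
  rw [e0] at hδ
  set x := κ * r
  set y := κ * s
  have hx0 : 0 < x := one_pos.trans_le hx
  have hy0 : 0 < y := hx0.trans_le hxy
  set q := Real.exp (-(3 / 4) * (y - x)) with hq
  have hq0 : 0 < q := Real.exp_pos _
  have hQ : ∀ ν, 0 ≤ ν → ν < 1 → decayFun ν y / decayFun ν x ≤ q := fun ν h0 h1 => by
    rw [div_le_iff₀ (decayFun_pos ν hx0)]
    exact decayFun_le h0 h1 hx hxy
  have hQ0 : ∀ ν, 0 < decayFun ν y / decayFun ν x := fun ν =>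
    div_pos (decayFun_pos ν hy0) (decayFun_pos ν hx0)
  have hrat := decayFun_ratio_bounds hα0 hα1 le_rfl one_pos hx hxy
  set Q := decayFun α y / decayFun α x
  set Q₀ := decayFun 0 y / decayFun 0 x
  set E := resolventKernel α κ r r
  set E₀ := resolventKernel 0 κ r r
  have h1 : |E * Q - E₀ * Q₀| ≤ 44 / (κ * x) * q := by
    have e : E * Q - E₀ * Q₀ = (E - E₀) * Q + E₀ * (Q - Q₀) := by ring
    rw [e]
    refine (abs_add_le _ _).trans ?_
    rw [abs_mul, abs_mul, abs_of_pos hE0, abs_of_pos (hQ0 α)]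
    have b1 : |E - E₀| * Q ≤ 32 / (κ * x) * q :=
      mul_le_mul hδ (hQ α hα0 hα1) (hQ0 α).le (by positivity)
    have b2 : E₀ * |Q - Q₀| ≤ 4 / κ * (3 / x * q) := by
      refine mul_le_mul hE (hrat.trans ?_) (abs_nonneg _) (by positivity)
      exact mul_le_mul_of_nonneg_left (hQ 0 le_rfl one_pos) (by positivity)
    have e2 : 44 / (κ * x) * q = 32 / (κ * x) * q + 4 / κ * (3 / x * q) := by
      field_simp; norm_num
    linarith
  -- `y / x ≤ 1 + (y - x) ≤ exp (y - x)` since `1 ≤ x`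
  have h2 : q / x ≤ (x * y) ^ (1 / 2 - α) := by
    have hexp : y ≤ x * Real.exp (y - x) := by
      have := Real.add_one_le_exp (y - x)
      nlinarith
    have hq2 : q ^ 2 * Real.exp (y - x) ≤ 1 := by
      rw [hq, ← Real.exp_nat_mul, ← Real.exp_add, Real.exp_le_one_iff]
      push_cast
      linarith
    have h3 : q ^ 2 * y ≤ x := by
      calc q ^ 2 * y ≤ q ^ 2 * (x * Real.exp (y - x)) := by gcongr
        _ = x * (q ^ 2 * Real.exp (y - x)) := by ring
        _ ≤ x * 1 := by gcongr
        _ = x := mul_one x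
    have h4 : q / x ≤ (x * y) ^ (-(1 / 2) : ℝ) := by
      rw [Real.rpow_neg (by positivity), ← Real.sqrt_eq_rpow, ← Real.sqrt_inv]
      apply Real.le_sqrt_of_sq_le
      rw [div_pow, div_le_iff₀ (by positivity)]
      have : (x * y)⁻¹ * x ^ 2 = x / y := by field_simp
      rw [this, le_div_iff₀ hy0]
      exact h3
    refine h4.trans (Real.rpow_le_rpow_of_exponent_le ?_ (by linarith))
    nlinarith
  refine h1.trans ?_
  have e3 : 44 / (κ * x) * q = 44 * (κ⁻¹ * (q / x)) := by field_simp
  rw [e3]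
  gcongr

theorem resolventKernel_le_of_mul_le_one (α : ℝ) (hκ : 0 < κ) {r s : ℝ} (hr : 1 ≤ r) (hs : r ≤ s)
    (hx : κ * r ≤ 1) : resolventKernel α κ r s
      ≤ κ ^ (-2 * α) * (r * s) ^ (1 / 2 - α) * (besselK α (κ * s) / -besselKDeriv α 1) := by
  have hr0 : 0 < r := one_pos.trans_le hr
  have hc : 0 < -besselKDeriv α 1 := neg_pos.2 (besselKDeriv_neg α one_pos)
  have h := resolventKernel_mul_flux_le α hκ hr hs
  rw [mul_groundState_of_one_le hr (hr.trans hs)] at h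
  have hf := monotoneOn_besselK_flux α (mem_Ioi.2 (mul_pos hκ hr0)) (mem_Ioi.2 one_pos) hx
  simp only [Real.one_rpow, one_mul] at hf
  have hκ2 : 0 < κ ^ (2 * α) := Real.rpow_pos_of_pos hκ _
  have e : weight α r * (κ * -besselKDeriv α (κ * r))
      = κ ^ (2 * α) * -((κ * r) ^ (1 - 2 * α) * besselKDeriv α (κ * r)) := by
    have e1 : κ = κ ^ (2 * α) * κ ^ (1 - 2 * α) := by
      rw [← Real.rpow_add hκ, add_sub_cancel, Real.rpow_one]
    rw [weight_of_one_le α hr, Real.mul_rpow hκ.le hr0.le]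
    nth_rewrite 1 [e1]
    ring
  have hG := (resolventKernel_pos α hκ hr hs).le
  have h2 : resolventKernel α κ r s * (κ ^ (2 * α) * -besselKDeriv α 1)
      ≤ (r * s) ^ (1 / 2 - α) * besselK α (κ * s) := by
    refine le_trans ?_ h
    rw [e]
    refine mul_le_mul_of_nonneg_left (mul_le_mul_of_nonneg_left ?_ hκ2.le) hG
    linarith
  rw [← le_div_iff₀ (mul_pos hκ2 hc)] at h2
  refine h2.trans (le_of_eq ?_)
  rw [show -2 * α = -(2 * α) by ring, Real.rpow_neg hκ.le]
  field_simp

/-- The comparison on scales shorter than `1 / κ`, where the two kernels are bounded separately. -/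
theorem abs_resolventKernel_sub_le_of_mul_le_one (hα0 : 0 < α) (hα1 : α < 1) (hκ : 0 < κ)
    {r s : ℝ} (hr : 1 ≤ r) (hs : r ≤ s) (hx : κ * r ≤ 1) :
    |resolventKernel α κ r s - resolventKernel 0 κ r s|
      ≤ (Real.Gamma α / -besselKDeriv α 1 + 2 * Real.Gamma (α / 2) / -besselKDeriv 0 1)
        * (κ ^ (-2 * α) * (groundState α r * groundState α s)) := by
  have hr0 : 0 < r := one_pos.trans_le hr
  have hs0 : 0 < s := hr0.trans_le hs
  have hy0 : 0 < κ * s := mul_pos hκ hs0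
  have hc : 0 < -besselKDeriv α 1 := neg_pos.2 (besselKDeriv_neg α one_pos)
  have hc0 : 0 < -besselKDeriv 0 1 := neg_pos.2 (besselKDeriv_neg 0 one_pos)
  have hΓ : 0 < Real.Gamma (α / 2) := Real.Gamma_pos_of_pos (by linarith)
  rw [mul_groundState_of_one_le hr (hr.trans hs)]
  set B := κ ^ (-2 * α) * (r * s) ^ (1 / 2 - α) with hB
  have hB0 : 0 < B := by positivity
  have h1 : resolventKernel α κ r s ≤ Real.Gamma α / -besselKDeriv α 1 * B := by
    refine (resolventKernel_le_of_mul_le_one α hκ hr hs hx).trans ?_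
    rw [← hB, mul_comm B]
    have hz : 0 < (κ * s) ^ 2 / 4 := by positivity
    have := macdonald_le_Gamma hα0 hz
    rw [besselK]
    gcongr
  have h2 : resolventKernel 0 κ r s ≤ 2 * Real.Gamma (α / 2) / -besselKDeriv 0 1 * B := by
    have hz : 0 < (κ * s) ^ 2 / 4 := by positivity
    have hm := macdonald_zero_le (p := α / 2) (by linarith) (by linarith) hz
    have e1 : ((κ * s) ^ 2 / 4) ^ (-(α / 2)) ≤ 2 * (κ * s) ^ (-α) := by
      have e2 : (κ * s) ^ 2 / 4 = (κ * s / 2) ^ (2 : ℝ) := by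
        rw [Real.rpow_two]; ring
      rw [e2, ← Real.rpow_mul (by positivity), show (2 : ℝ) * -(α / 2) = -α by ring,
        Real.div_rpow hy0.le (by norm_num), Real.rpow_neg (by norm_num : (0 : ℝ) ≤ 2), div_inv_eq_mul,
        mul_comm]
      have : (2 : ℝ) ^ α ≤ 2 ^ (1 : ℝ) :=
        Real.rpow_le_rpow_of_exponent_le (by norm_num) hα1.le
      rw [Real.rpow_one] at this
      gcongr
    have e3 : (κ * s) ^ (-α) ≤ (κ ^ 2 * (r * s)) ^ (-α) := by
      refine Real.rpow_le_rpow_of_nonpos (by positivity) ?_ (by linarith)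
      have : κ ^ 2 * (r * s) = κ * r * (κ * s) := by ring
      rw [this]
      exact mul_le_of_le_one_left hy0.le hx
    have e4 : B = (r * s) ^ (1 / 2 : ℝ) * (κ ^ 2 * (r * s)) ^ (-α) := by
      rw [hB, Real.mul_rpow (by positivity : 0 ≤ κ ^ 2) (by positivity : 0 ≤ r * s),
        ← Real.rpow_natCast κ, ← Real.rpow_mul hκ.le, sub_eq_add_neg,
        Real.rpow_add (by positivity : 0 < r * s)]
      have : ((2 : ℕ) : ℝ) * -α = -2 * α := by push_cast; ring
      rw [this]
      ring
    refine (resolventKernel_le_of_mul_le_one 0 hκ hr hs hx).trans ?_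
    rw [mul_zero, Real.rpow_zero, one_mul, sub_zero, besselK]
    calc (r * s) ^ (1 / 2 : ℝ) * (macdonald 0 ((κ * s) ^ 2 / 4) / -besselKDeriv 0 1)
        ≤ (r * s) ^ (1 / 2 : ℝ) * (2 * (κ ^ 2 * (r * s)) ^ (-α) * Real.Gamma (α / 2)
            / -besselKDeriv 0 1) := by
          have := hm.trans (mul_le_mul_of_nonneg_right (e1.trans
            (mul_le_mul_of_nonneg_left e3 zero_le_two)) hΓ.le)
          gcongr
      _ = _ := by rw [e4]; ring
  have p1 := resolventKernel_pos α hκ hr hs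
  have p2 := resolventKernel_pos 0 hκ hr hs
  have q1 := p1.le.trans h1
  have q2 := p2.le.trans h2
  rw [add_mul, abs_le]
  constructor <;> linarith

/-- The constant in the comparison of the Green functions of `T_α + κ²` and `T_0 + κ²`. -/
def comparisonConst (α : ℝ) : ℝ :=
  44 + (Real.Gamma α / -besselKDeriv α 1 + 2 * Real.Gamma (α / 2) / -besselKDeriv 0 1)

theorem comparisonConst_pos (hα0 : 0 < α) : 0 < comparisonConst α := by
  have hc : 0 < -besselKDeriv α 1 := neg_pos.2 (besselKDeriv_neg α one_pos)
  have hc0 : 0 < -besselKDeriv 0 1 := neg_pos.2 (besselKDeriv_neg 0 one_pos)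
  have hΓ : 0 < Real.Gamma (α / 2) := Real.Gamma_pos_of_pos (by linarith)
  have hΓ' : 0 < Real.Gamma α := Real.Gamma_pos_of_pos hα0
  rw [comparisonConst]
  positivity

theorem abs_resolventKernel_sub_le_of_one_le (hα0 : 0 < α) (hα1 : α < 1) (hκ : 0 < κ)
    {r s : ℝ} (hr : 1 ≤ r) (hs : r ≤ s) :
    |resolventKernel α κ r s - resolventKernel 0 κ r s|
      ≤ comparisonConst α * (κ ^ (-2 * α) * (groundState α r * groundState α s)) := by
  have hr0 : 0 < r := one_pos.trans_le hr
  have hc : 0 < -besselKDeriv α 1 := neg_pos.2 (besselKDeriv_neg α one_pos)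
  have hc0 : 0 < -besselKDeriv 0 1 := neg_pos.2 (besselKDeriv_neg 0 one_pos)
  have hΓ : 0 < Real.Gamma (α / 2) := Real.Gamma_pos_of_pos (by linarith)
  have hΓ' : 0 < Real.Gamma α := Real.Gamma_pos_of_pos hα0
  have hB : 0 ≤ κ ^ (-2 * α) * (groundState α r * groundState α s) :=
    mul_nonneg (Real.rpow_pos_of_pos hκ _).le
      (mul_pos (groundState_pos α hr0) (groundState_pos α (hr0.trans_le hs))).le
  rcases le_total 1 (κ * r) with hx | hx
  · refine (abs_resolventKernel_sub_le_of_one_le_mul hα0.le hα1 hκ hr hs hx).trans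
      (mul_le_mul_of_nonneg_right ?_ hB)
    rw [comparisonConst]
    refine le_add_of_nonneg_right ?_
    positivity
  · refine (abs_resolventKernel_sub_le_of_mul_le_one hα0 hα1 hκ hr hs hx).trans
      (mul_le_mul_of_nonneg_right ?_ hB)
    rw [comparisonConst]
    exact le_add_of_nonneg_left (by norm_num)

theorem resolventKernel_eq_mul_one (α κ : ℝ) {r s : ℝ} (hr : r ≤ 1) (hs : 1 ≤ s) :
    resolventKernel α κ r s = √r * leftSol κ r * resolventKernel α κ 1 s := by
  rw [resolventKernel_of_le α κ (hr.trans hs), resolventKernel_of_le α κ hs,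
    groundState_of_le_one α hr, groundState_one, regularSol_of_le_one α κ hr,
    regularSol_of_le_one α κ le_rfl, leftSol_one]
  ring

/-- On `(0, 1]²` the Green functions of different `α` differ by a multiple of the product of the
solutions regular at `0`, because the weights agree on `(0, 1]`. -/
theorem resolventKernel_sub_of_le_one (α : ℝ) (hκ : 0 < κ) {r s : ℝ} (hr : 0 < r) (hrs : r ≤ s)
    (hs : s ≤ 1) : resolventKernel α κ r s - resolventKernel 0 κ r s
      = √r * √s * (leftSol κ r * leftSol κ s)
        * (resolventKernel α κ 1 1 - resolventKernel 0 κ 1 1) := by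
  have hint : ∫ t in (1 : ℝ)..s, (weight α t * leftSol κ t ^ 2)⁻¹
      = ∫ t in (1 : ℝ)..s, (weight 0 t * leftSol κ t ^ 2)⁻¹ := by
    refine intervalIntegral.integral_congr fun t ht => ?_
    rw [uIcc_of_ge hs] at ht
    have ht0 : 0 ≤ t := (hr.trans_le hrs).le.trans ht.1
    rw [weight_of_le_one α ht0 ht.2, weight_of_le_one 0 ht0 ht.2]
  rw [resolventKernel_of_le α κ hrs, resolventKernel_of_le 0 κ hrs, resolventKernel_one_one α hκ,
    resolventKernel_one_one 0 hκ, groundState_of_le_one α (hrs.trans hs),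
    groundState_of_le_one 0 (hrs.trans hs), groundState_of_le_one α hs, groundState_of_le_one 0 hs,
    regularSol_of_le_one α κ (hrs.trans hs), regularSol_of_le_one 0 κ (hrs.trans hs), decayingSol,
    decayingSol, if_pos hs, if_pos hs, reductionFactor, reductionFactor, hint]
  ring

theorem abs_resolventKernel_sub_le_of_le (hα0 : 0 < α) (hα1 : α < 1) (hκ : 0 < κ)
    {r s : ℝ} (hr : 0 < r) (hs : r ≤ s) :
    |resolventKernel α κ r s - resolventKernel 0 κ r s|
      ≤ comparisonConst α * (κ ^ (-2 * α) * (groundState α r * groundState α s)) := by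
  have hs0 : 0 < s := hr.trans_le hs
  rcases le_total 1 r with h1 | h1
  · exact abs_resolventKernel_sub_le_of_one_le hα0 hα1 hκ h1 hs
  have hl := leftSol_pos κ r
  have hl1 := leftSol_le_one hκ hr.le h1
  have hsr : 0 ≤ √r := Real.sqrt_nonneg r
  rcases le_total 1 s with h2 | h2
  · rw [resolventKernel_eq_mul_one α κ h1 h2, resolventKernel_eq_mul_one 0 κ h1 h2, ← mul_sub,
      abs_mul, abs_of_nonneg (mul_nonneg hsr hl.le)]
    have h := abs_resolventKernel_sub_le_of_one_le hα0 hα1 hκ le_rfl h2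
    rw [groundState_one, one_mul] at h
    have h3 : √r * leftSol κ r ≤ √r := mul_le_of_le_one_right hsr hl1
    rw [groundState_of_le_one α h1]
    calc _ ≤ √r * (comparisonConst α * (κ ^ (-2 * α) * groundState α s)) :=
          mul_le_mul h3 h (abs_nonneg _) hsr
      _ = _ := by ring
  · have hls := leftSol_pos κ s
    have hls1 := leftSol_le_one hκ hs0.le h2
    have hss : 0 ≤ √s := Real.sqrt_nonneg s
    have h := abs_resolventKernel_sub_le_of_one_le hα0 hα1 hκ le_rfl le_rfl
    rw [groundState_one, one_mul, mul_one] at h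
    rw [resolventKernel_sub_of_le_one α hκ hr hs h2, groundState_of_le_one α h1,
      groundState_of_le_one α h2, abs_mul,
      abs_of_nonneg (mul_nonneg (mul_nonneg hsr hss) (mul_nonneg hl.le hls.le))]
    have h3 : √r * √s * (leftSol κ r * leftSol κ s) ≤ √r * √s :=
      mul_le_of_le_one_right (mul_nonneg hsr hss) (mul_le_one₀ hl1 hls.le hls1)
    calc _ ≤ √r * √s * (comparisonConst α * κ ^ (-2 * α)) :=
          mul_le_mul h3 h (abs_nonneg _) (mul_nonneg hsr hss)
      _ = _ := by ring

theorem groundState_le (hα0 : 0 ≤ α) (hα1 : α ≤ 1) {r : ℝ} (hr : 0 < r) :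
    groundState α r ≤ 2 * (√r * (1 + r) ^ (-α)) := by
  have h2 : (2 : ℝ) ^ α ≤ 2 := by
    simpa using Real.rpow_le_rpow_of_exponent_le (by norm_num : (1 : ℝ) ≤ 2) hα1
  have h2' : 0 < (2 : ℝ) ^ α := by positivity
  have key : ∀ t : ℝ, 0 < t → 1 + r ≤ 2 * t → t ^ (-α) ≤ 2 * (1 + r) ^ (-α) := by
    intro t ht h
    have h3 : (2 * t) ^ (-α) ≤ (1 + r) ^ (-α) :=
      Real.rpow_le_rpow_of_nonpos (by linarith) h (by linarith)
    rw [Real.mul_rpow (by norm_num) ht.le, Real.rpow_neg (by norm_num), ← div_eq_inv_mul,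
      div_le_iff₀ h2'] at h3
    have h4 : 0 ≤ (1 + r) ^ (-α) := by positivity
    nlinarith
  rcases le_total r 1 with h | h
  · rw [groundState_of_le_one α h]
    have h5 := key 1 one_pos (by linarith)
    rw [Real.one_rpow] at h5
    nlinarith [Real.sqrt_nonneg r]
  · rw [groundState_of_one_le α h, sub_eq_add_neg, Real.rpow_add hr, ← Real.sqrt_eq_rpow]
    nlinarith [key r hr (by linarith), Real.sqrt_nonneg r]

theorem abs_resolventKernel_sub_le (hα0 : 0 < α) (hα1 : α < 1) (hκ : 0 < κ)
    {r s : ℝ} (hr : 0 < r) (hs : 0 < s) :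
    |resolventKernel α κ r s - resolventKernel 0 κ r s|
      ≤ 4 * comparisonConst α * κ ^ (-2 * α) * √(r * s) * (1 + r) ^ (-α) * (1 + s) ^ (-α) := by
  have h : |resolventKernel α κ r s - resolventKernel 0 κ r s|
      ≤ comparisonConst α * (κ ^ (-2 * α) * (groundState α r * groundState α s)) := by
    rcases le_total r s with h | h
    · exact abs_resolventKernel_sub_le_of_le hα0 hα1 hκ hr h
    · rw [resolventKernel_comm α, resolventKernel_comm 0, mul_comm (groundState α r)]
      exact abs_resolventKernel_sub_le_of_le hα0 hα1 hκ hs h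
  refine h.trans ?_
  have g1 := groundState_le hα0.le hα1.le hr
  have g2 := groundState_le hα0.le hα1.le hs
  have hC := comparisonConst_pos hα0
  have hκ2 : 0 < κ ^ (-2 * α) := Real.rpow_pos_of_pos hκ _
  calc _ ≤ comparisonConst α * (κ ^ (-2 * α) *
        (2 * (√r * (1 + r) ^ (-α)) * (2 * (√s * (1 + s) ^ (-α))))) := by
        have := mul_le_mul g1 g2 (groundState_pos α hs).le (by positivity)
        gcongr
    _ = _ := by rw [Real.sqrt_mul hr.le]; ring

end Comparison

end PointInteraction

end

theorem lemma4p1 :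
    (∀ α : ℝ, 0 ≤ α → α < 1 → ∀ κ : ℝ, 0 < κ →
      ∃ G : ℝ → ℝ → ℂ, PointInteraction.IsResolventKernel α κ G) ∧
    (∀ α : ℝ, 0 < α → α < 1 → ∃ C : ℝ, ∀ κ : ℝ, 0 < κ → ∀ Gα G₀ : ℝ → ℝ → ℂ,
      PointInteraction.IsResolventKernel α κ Gα → PointInteraction.IsResolventKernel 0 κ G₀ →
      ∀ r r' : ℝ, 0 < r → 0 < r' →
        ‖Gα r r' - G₀ r r'‖ ≤
          C * κ ^ (-2 * α) * √(r * r') * (1 + r) ^ (-α) * (1 + r') ^ (-α)) := by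
  refine ⟨fun α hα _ κ hκ => ⟨_, PointInteraction.isResolventKernel_resolventKernel hα hκ⟩,
    fun α hα hα1 => ⟨4 * PointInteraction.comparisonConst α,
      fun κ hκ Gα G₀ hGα hG₀ r r' hr hr' => ?_⟩⟩
  rw [hGα.eq (PointInteraction.isResolventKernel_resolventKernel hα.le hκ) hr hr',
    hG₀.eq (PointInteraction.isResolventKernel_resolventKernel le_rfl hκ) hr hr',
    ← Complex.ofReal_sub, Complex.norm_real, Real.norm_eq_abs]
  exact PointInteraction.abs_resolventKernel_sub_le hα hα1 hκ hr hr'
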